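/- All vector spaces are over $\mathbb{C}$. Let $T\ge 1$ be an integer and let $(V,Y,\mathbf 1)$ be a vertex algebra. A \emph{weak $(V,T)$-module} is a vector space $M$ with a linear map $V\otimes M\to M((x^{1/T}))$, $a\otimes u\mapsto Y_M(a,x)u=\sum_{n\in\frac1T\mathbb{Z}}a_nu\,x^{-n-1}$, such that $Y_M(\mathbf 1,x)=\mathrm{id}_M$ and such that for all $a,b\in V$, $u\in M$ there is an element $F\in M[[x^{1/T},y^{1/T}]][x^{-1/T},y^{-1/T},(x-y)^{-1}]$ whose expansions are $\iota_{x,y}F=Y_M(a,x)Y_M(b,y)u$, $\iota_{y,x}F=Y_M(b,y)Y_M(a,x)u$ and $\iota_{y,x-y}F=Y_M(Y(a,x-y)b,y)u$ (in the domains $|x|>|y|$, $|y|>|x|$, $|y|>|x-y|$ respectively). Submodules, irreducible modules and isomorphisms are defined with respect to all operators $a_n$. For $\sigma\in\mathrm{Aut}\,V$, $M\cdot\sigma$ denotes the space $M$ with $Y_{M\cdot\sigma}(a,x)=Y_M(\sigma a,x)$. Let $V$ be a simple vertex algebra of countable dimension, $G$ a finite subgroup of $\mathrm{Aut}\,V$,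 $V^G$ the fixed point subalgebra, and $\mathcal S$ a finite set of pairwise non-isomorphic irreducible weak $(V,T)$-modules which is $G$-stable, that is, for all $M\in\mathcal S$ and $\sigma\in G$ the module $M\cdot\sigma$ is isomorphic to a (unique) member of $\mathcal S$, again denoted by $M\cdot\sigma$; this is a right action of $G$ on $\mathcal S$. Put $\mathcal M=\bigoplus_{M\in\mathcal S}M$. For $\sigma\in G$, $M\in\mathcal S$ choose a linear isomorphism $\phi(\sigma,M)$ from $M$ onto the member $N=M\cdot\sigma^{-1}$ of $\mathcal S$ with $\phi(\sigma,M)Y_M(a,x)=Y_N(\sigma a,x)\phi(\sigma,M)$ for all $a\in V$, and define the nonzero scalars $\alpha_M(\sigma,\tau)$ by $\phi(\sigma,M\cdot\tau^{-1})\phi(\tau,M)=\alpha_M(\sigma,\tau)\phi(\sigma\tau,M)$. Let $\mathcal A_\alpha(G,\mathcal S)$ be the associative algebra with basis $\sigma\otimes e(M)$ ($\sigma\in G$, $M\in\mathcal S$) and product $(\sigma\otimes e(M))(\tau\otimes e(N))=\delta_{M\cdot\tau,N}\,\alpha_N(\sigma,\tau)\,\sigma\tau\otimes e(N)$. It acts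 on $\mathcal M$: for $u\in N\in\mathcal S$, $(\sigma\otimes e(M))u=\delta_{M,N}\,\phi(\sigma,M)u$. This action commutes with that of $V^G$. Let $M^j$ ($j\in J$) be representatives of the $G$-orbits on $\mathcal S$, let $G_j=\{\sigma\in G: M^j\cdot\sigma\cong M^j\}$, and let $\mathbb{C}^{\alpha}[G_j]$ be the twisted group algebra for the cocycle $\alpha_{M^j}|_{G_j\times G_j}$; it acts on $M^j$ by $\sigma\mapsto\phi(\sigma,M^j)$ and is identified with $S(M^j)=\mathrm{span}\{\sigma\otimes e(M^j):\sigma\in G_j\}$. Let $W_{j,\lambda}$ ($\lambda\in\Lambda_j$) be a complete set of representatives of the isomorphism classes of irreducible $\mathbb{C}^{\alpha}[G_j]$-modules. Put $D(M^j)=\mathrm{span}\{\sigma\otimes e(M^j):\sigma\in G\}$, $W^j_\lambda=D(M^j)\otimes_{S(M^j)}W_{j,\lambda}$ and $M^j_\lambda=\mathrm{Hom}_{\mathbb{C}^{\alpha}[G_j]}(W_{j,\lambda},M^j)$, on which $V^G$ acts by $(a_nf)(w)=a_n(f(w))$; this makes $M^j_\lambda$ a weak $(V^G,T)$-module. Then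 the $W^j_\lambda$ ($j\in J$, $\lambda\in\Lambda_j$) form a complete set of representatives of the isomorphism classes of irreducible $\mathcal A_\alpha(G,\mathcal S)$-modules, and, compatibly with the actions of $\mathcal A_\alpha(G,\mathcal S)$ (on the first factors) and of $V^G$ (on the second factors), $$\mathcal M\;\cong\;\bigoplus_{j\in J,\ \lambda\in\Lambda_j}W^j_\lambda\otimes_{\mathbb{C}}M^j_\lambda .$$ Moreover: (1) for all $j\in J$, $\lambda\in\Lambda_j$, the space $M^j_\lambda$ is nonzero and is an irreducible weak $(V^G,T)$-module; (2) for $j_1,j_2\in J$, $\lambda_1\in\Lambda_{j_1}$, $\lambda_2\in\Lambda_{j_2}$, the weak $(V^G,T)$-modules $M^{j_1}_{\lambda_1}$ and $M^{j_2}_{\lambda_2}$ are isomorphic if and only if $(j_1,\lambda_1)=(j_2,\lambda_2)$. -/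

import Mathlib

open scoped TensorProduct DirectSum

universe u v w

noncomputable section

/-- A vertex algebra over `ℂ`. The operator `mode n a` is the coefficient `aₙ` in
`Y(a, x) = ∑ₙ aₙ x^{-n-1}`. -/
class VertexAlgebra (V : Type u) [AddCommGroup V] [Module ℂ V] where
  /-- the modes `aₙ b`, bilinear in `a` and `b` -/
  mode : ℤ → V →ₗ[ℂ] V →ₗ[ℂ] V
  /-- the vacuum vector -/
  vacuum : V
  /-- `Y(a, x) b` is a Laurent series -/
  truncation : ∀ a b : V, ∃ N : ℤ, ∀ n, N ≤ n → mode n a b = 0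
  /-- `Y(𝟏, x) = id` -/
  vacuum_mode : ∀ (n : ℤ) (b : V), mode n vacuum b = if n = -1 then b else 0
  /-- `Y(a, x) 𝟏` is a power series -/
  creation : ∀ (a : V) (n : ℤ), 0 ≤ n → mode n a vacuum = 0
  /-- the constant term of `Y(a, x) 𝟏` is `a` -/
  creation_neg_one : ∀ a : V, mode (-1) a vacuum = a
  /-- the coefficients of the Jacobi identity -/
  borcherds : ∀ (a b c : V) (p q r : ℤ),
    ∑ᶠ i : ℕ, ((Ring.choose p i : ℤ) : ℂ) • mode (p + q - i) (mode (r + i) a b) c =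
    ∑ᶠ i : ℕ, ((-1 : ℂ) ^ i * ((Ring.choose r i : ℤ) : ℂ)) •
      (mode (p + r - i) a (mode (q + i) b c) -
        (-1 : ℂ) ^ r • mode (q + r - i) b (mode (p + i) a c))

namespace VertexAlgebra

variable (V : Type u) [AddCommGroup V] [Module ℂ V] [VertexAlgebra V]

/-- A (two-sided) ideal of a vertex algebra. -/
def IsIdeal (I : Submodule ℂ V) : Prop :=
  ∀ (v w : V) (n : ℤ), w ∈ I → mode n v w ∈ I ∧ mode n w v ∈ I

/-- A vertex algebra is simple if it is nonzero and has no ideals except `0` and itself. -/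
def IsSimple : Prop :=
  Nontrivial V ∧ ∀ I : Submodule ℂ V, IsIdeal V I → I = ⊥ ∨ I = ⊤

/-- The group of automorphisms of a vertex algebra. -/
def Aut : Subgroup (V ≃ₗ[ℂ] V) where
  carrier := {g | g vacuum = vacuum ∧
    ∀ (n : ℤ) (a b : V), g (mode n a b) = mode n (g a) (g b)}
  one_mem' := ⟨rfl, fun _ _ _ => rfl⟩
  mul_mem' := by
    rintro g h ⟨hg, hg'⟩ ⟨hh, hh'⟩
    exact ⟨by simp [hg, hh], fun n a b => by simp [hg', hh']⟩
  inv_mem' := by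
    rintro g ⟨hg, hg'⟩
    refine ⟨?_, fun n a b => ?_⟩
    · apply g.injective
      rw [hg]
      exact g.apply_symm_apply _
    · apply g.injective
      rw [hg']
      exact (g.apply_symm_apply _).trans
        (congrArg₂ (fun x y => mode n x y) (g.apply_symm_apply a).symm (g.apply_symm_apply b).symm)

variable {V}

/-- The fixed point subalgebra `V^G`, as a subspace. -/
def fixedPoints (G : Subgroup (Aut V)) : Submodule ℂ V where
  carrier := {a | ∀ g : G, (g : V ≃ₗ[ℂ] V) a = a}
  zero_mem' := fun _ => map_zero _
  add_mem' := fun ha hb g => by rw [map_add, ha g, hb g]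
  smul_mem' := fun c a ha g => by rw [map_smul, ha g]

theorem mode_mem_fixedPoints (G : Subgroup (Aut V)) (n : ℤ) {a b : V}
    (ha : a ∈ fixedPoints G) (hb : b ∈ fixedPoints G) : mode n a b ∈ fixedPoints G := by
  intro g
  rw [(g : Aut V).2.2 n a b]
  exact congrArg₂ (fun x y => mode n x y) (ha g) (hb g)

/-- The fixed point subalgebra `V^G` is a vertex algebra. -/
instance (G : Subgroup (Aut V)) : VertexAlgebra (fixedPoints G) where
  mode n := LinearMap.mk₂ ℂ (fun a b => ⟨mode n (a : V) (b : V),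
      mode_mem_fixedPoints G n a.2 b.2⟩)
    (fun _ _ _ => Subtype.ext (by simp)) (fun _ _ _ => Subtype.ext (by simp))
    (fun _ _ _ => Subtype.ext (by simp)) (fun _ _ _ => Subtype.ext (by simp))
  vacuum := ⟨vacuum, fun g => (g : Aut V).2.1⟩
  truncation a b := by
    obtain ⟨N, hN⟩ := truncation (a : V) (b : V)
    exact ⟨N, fun n hn => Subtype.ext (hN n hn)⟩
  vacuum_mode n b := Subtype.ext (by
    have := vacuum_mode n (b : V)
    split_ifs with h <;> simpa [h] using this)
  creation a n hn := Subtype.ext (creation (a : V) n hn)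
  creation_neg_one a := Subtype.ext (creation_neg_one (a : V))
  borcherds a b c p q r := by
    have h := borcherds (a : V) (b : V) (c : V) p q r
    have hinj : Function.Injective (fixedPoints G).subtype.toAddMonoidHom :=
      Subtype.val_injective
    apply Subtype.val_injective
    refine (AddMonoidHom.map_finsum_of_injective _ hinj _).trans (Eq.trans ?_
      (AddMonoidHom.map_finsum_of_injective _ hinj _).symm)
    exact h

end VertexAlgebra

open VertexAlgebra

/-! ### Weak `(V, T)`-modules

An element of `M[[x^{1/T}, y^{1/T}]][x^{-1/T}, y^{-1/T}, (x - y)^{-1}]` is written `f (x - y)^l`,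
where `l : ℤ` and `f p q` is the coefficient of `x^{p/T} y^{q/T}` in a doubly infinite family
that vanishes when `p` or `q` is small enough. The exponents of `x` and `y` are
given in units of `1/T`. -/

section Expansion

variable {M : Type v} [AddCommGroup M] [Module ℂ M]

/-- The coefficient of `x^{P/T} y^{Q/T}` in `ι_{x,y} (f (x - y)^l)`, where
`(x - y)^l = ∑ᵢ (l choose i) (-1)^i x^{l-i} y^i`. -/
def iotaXY (T : ℕ) (f : ℤ → ℤ → M) (l P Q : ℤ) : M :=
  ∑ᶠ i : ℕ, ((-1 : ℂ) ^ i * ((Ring.choose l i : ℤ) : ℂ)) • f (P - T * (l - i)) (Q - T * i)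

/-- The coefficient of `x^{P/T} y^{Q/T}` in `ι_{y,x} (f (x - y)^l)`, where
`(x - y)^l = ∑ᵢ (l choose i) (-1)^{l-i} y^{l-i} x^i`. -/
def iotaYX (T : ℕ) (f : ℤ → ℤ → M) (l P Q : ℤ) : M :=
  ∑ᶠ i : ℕ, ((-1 : ℂ) ^ (l - i) * ((Ring.choose l i : ℤ) : ℂ)) •
    f (P - T * i) (Q - T * (l - i))

/-- The coefficient of `y^{Q/T} (x - y)^R` in `ι_{y,x-y} (f (x - y)^l)`, where
`x^{p/T} = ∑ᵢ (p/T choose i) y^{p/T-i} (x - y)^i`; only `i = R - l` contributes. -/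
def iotaYXsubY (T : ℕ) (f : ℤ → ℤ → M) (l Q R : ℤ) : M :=
  if l ≤ R then
    ∑ᶠ p : ℤ, Ring.choose ((p : ℂ) / T) (R - l).toNat • f p (Q + T * (R - l) - p)
  else 0

end Expansion

/-- A weak `(V, T)`-module structure on the vector space `M`. The operator `mode n a` is
`a_{n/T}`, the coefficient of `x^{-n/T-1}` in `Y_M(a, x)`. -/
structure WeakModule (V : Type u) [AddCommGroup V] [Module ℂ V] [VertexAlgebra V] (T : ℕ)
    (M : Type v) [AddCommGroup M] [Module ℂ M] where
  /-- the modes `a_{n/T} u`, bilinear in `a` and `u` -/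
  mode : ℤ → V →ₗ[ℂ] M →ₗ[ℂ] M
  /-- `Y_M(a, x) u` is a Laurent series in `x^{1/T}` -/
  truncation : ∀ (a : V) (u : M), ∃ N : ℤ, ∀ n, N ≤ n → mode n a u = 0
  /-- `Y_M(𝟏, x) = id` -/
  vacuum_mode : ∀ (n : ℤ) (u : M), mode n vacuum u = if n = -(T : ℤ) then u else 0
  /-- The series `Y_M(a, x) Y_M(b, y) u`, `Y_M(b, y) Y_M(a, x) u` and
  `Y_M(Y(a, x - y) b, y) u` are the three expansions of one element `f (x - y)^l`. -/
  duality : ∀ (a b : V) (u : M), ∃ (f : ℤ → ℤ → M) (l : ℤ),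
    (∃ N : ℤ, ∀ p q, p < N ∨ q < N → f p q = 0) ∧
    (∀ m n : ℤ, iotaXY T f l (-m - T) (-n - T) = mode m a (mode n b u)) ∧
    (∀ m n : ℤ, iotaYX T f l (-m - T) (-n - T) = mode n b (mode m a u)) ∧
    (∀ k n : ℤ, iotaYXsubY T f l (-n - T) (-k - 1) = mode n (VertexAlgebra.mode k a b) u)

namespace WeakModule

variable {V : Type u} [AddCommGroup V] [Module ℂ V] [VertexAlgebra V] {T : ℕ}
  {M : Type v} [AddCommGroup M] [Module ℂ M] {N : Type w} [AddCommGroup N] [Module ℂ N]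

/-- A subspace stable under all modes: these are the subspaces to which the structure of a weak
`(V, T)`-module restricts. -/
def IsSubmodule (Y : WeakModule V T M) (N : Submodule ℂ M) : Prop :=
  ∀ (n : ℤ) (a : V) (u : M), u ∈ N → Y.mode n a u ∈ N

/-- A nonzero weak `(V, T)`-module without submodules except `0` and itself. -/
def IsIrreducible (Y : WeakModule V T M) : Prop :=
  Nontrivial M ∧ ∀ N : Submodule ℂ M, Y.IsSubmodule N → N = ⊥ ∨ N = ⊤

/-- Isomorphism of weak `(V, T)`-modules. -/
def Iso (Y : WeakModule V T M) (Z : WeakModule V T N) : Prop :=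
  ∃ f : M ≃ₗ[ℂ] N, ∀ (n : ℤ) (a : V) (u : M), f (Y.mode n a u) = Z.mode n a (f u)

/-- The weak `(V, T)`-module `M · σ`, with `Y_{M·σ}(a, x) = Y_M(σ a, x)`. -/
def twist (Y : WeakModule V T M) (σ : Aut V) : WeakModule V T M where
  mode n := (Y.mode n).comp (σ : V ≃ₗ[ℂ] V).toLinearMap
  truncation a u := Y.truncation ((σ : V ≃ₗ[ℂ] V) a) u
  vacuum_mode n u := by
    have h : (σ : V ≃ₗ[ℂ] V) vacuum = vacuum := σ.2.1
    simp [h, Y.vacuum_mode n u]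
  duality a b u := by
    obtain ⟨f, l, h0, h1, h2, h3⟩ :=
      Y.duality ((σ : V ≃ₗ[ℂ] V) a) ((σ : V ≃ₗ[ℂ] V) b) u
    refine ⟨f, l, h0, h1, h2, fun k n => ?_⟩
    have h : (σ : V ≃ₗ[ℂ] V) (VertexAlgebra.mode k a b) = _ := σ.2.2 k a b
    simp [h3, h]

@[simp]
theorem twist_mode (Y : WeakModule V T M) (σ : Aut V) (n : ℤ) (a : V) (u : M) :
    (Y.twist σ).mode n a u = Y.mode n ((σ : V ≃ₗ[ℂ] V) a) u := rfl

end WeakModule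

section FiniteSums

variable {M : Type v} [AddCommGroup M] [Module ℂ M] {N : Type w} [AddCommGroup N] [Module ℂ N]

theorem map_finsum_smul {ι : Type*} (π : M →ₗ[ℂ] N) (c : ι → ℂ) (g : ι → M)
    (h : {i | g i ≠ 0}.Finite) : ∑ᶠ i, c i • π (g i) = π (∑ᶠ i, c i • g i) := by
  have h' : (Function.support fun i => c i • g i).Finite :=
    h.subset fun i hi hg => hi (by simp [hg])
  have := AddMonoidHom.map_finsum (f := fun i => c i • g i) π.toAddMonoidHom h'
  simpa using this.symm

theorem finite_of_lower_bound {M : Type v} [AddCommGroup M] {T : ℕ} (hT : 0 < T) {f : ℤ → ℤ → M} {B : ℤ}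
    (hf : ∀ p q, p < B ∨ q < B → f p q = 0) (A C : ℤ) (g : ℕ → ℤ) :
    {i : ℕ | f (g i) (A - T * i) ≠ 0}.Finite ∧ {i : ℕ | f (C - T * i) (g i) ≠ 0}.Finite := by
  have key : ∀ A : ℤ, {i : ℕ | B ≤ A - T * i}.Finite := by
    intro A
    refine (Set.finite_Iic (A - B).toNat).subset fun i hi => ?_
    have hi' : B ≤ A - T * i := hi
    have : (i : ℤ) ≤ T * i := le_mul_of_one_le_left (by positivity) (by exact_mod_cast hT)
    simp only [Set.mem_Iic]
    omega
  constructor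
  · refine (key A).subset fun i hi => ?_
    by_contra hlt
    exact hi (hf _ _ (Or.inr (not_le.mp hlt)))
  · refine (key C).subset fun i hi => ?_
    by_contra hlt
    exact hi (hf _ _ (Or.inl (not_le.mp hlt)))

theorem map_iotaXY {T : ℕ} (hT : 0 < T) (π : M →ₗ[ℂ] N) {f : ℤ → ℤ → M} {B : ℤ}
    (hf : ∀ p q, p < B ∨ q < B → f p q = 0) (l P Q : ℤ) :
    iotaXY T (fun p q => π (f p q)) l P Q = π (iotaXY T f l P Q) :=
  map_finsum_smul π _ _ (finite_of_lower_bound hT hf Q 0 _).1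

theorem map_iotaYX {T : ℕ} (hT : 0 < T) (π : M →ₗ[ℂ] N) {f : ℤ → ℤ → M} {B : ℤ}
    (hf : ∀ p q, p < B ∨ q < B → f p q = 0) (l P Q : ℤ) :
    iotaYX T (fun p q => π (f p q)) l P Q = π (iotaYX T f l P Q) :=
  map_finsum_smul π _ _ (finite_of_lower_bound hT hf 0 P _).2

theorem map_iotaYXsubY {T : ℕ} (π : M →ₗ[ℂ] N) {f : ℤ → ℤ → M} {B : ℤ}
    (hf : ∀ p q, p < B ∨ q < B → f p q = 0) (l Q R : ℤ) :
    iotaYXsubY T (fun p q => π (f p q)) l Q R = π (iotaYXsubY T f l Q R) := by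
  unfold iotaYXsubY
  split_ifs
  · refine map_finsum_smul π _ _ ((Set.finite_Icc B (Q + T * (R - l) - B)).subset fun p hp => ?_)
    rw [Set.mem_Icc]
    by_contra hlt
    refine hp (hf _ _ ?_)
    omega
  · simp

end FiniteSums

namespace WeakModule

variable {V : Type u} [AddCommGroup V] [Module ℂ V] [VertexAlgebra V] {T : ℕ}
  {M : Type v} [AddCommGroup M] [Module ℂ M] {N : Type w} [AddCommGroup N] [Module ℂ N]

/-- Operators on `N` that are compatible with the modes of `M` under an injective linear map
make `N` a weak `(V, T)`-module. -/
def pullback (hT : 0 < T) (Y : WeakModule V T M) (e : N →ₗ[ℂ] M) (he : Function.Injective e)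
    (m : ℤ → V →ₗ[ℂ] N →ₗ[ℂ] N) (hm : ∀ n a u, e (m n a u) = Y.mode n a (e u)) :
    WeakModule V T N where
  mode := m
  truncation a u := by
    obtain ⟨B, hB⟩ := Y.truncation a (e u)
    exact ⟨B, fun n hn => he (by rw [hm, hB n hn, map_zero])⟩
  vacuum_mode n u := he (by rw [hm, Y.vacuum_mode]; split_ifs <;> simp)
  duality a b u := by
    obtain ⟨f, l, ⟨B, hB⟩, h1, h2, h3⟩ := Y.duality a b (e u)
    obtain ⟨π, hπ⟩ := e.exists_leftInverse_of_injective (LinearMap.ker_eq_bot.mpr he)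
    have hπ' : ∀ x, π (e x) = x := fun x => LinearMap.congr_fun hπ x
    refine ⟨fun p q => π (f p q), l, ⟨B, fun p q h => by simp [hB p q h]⟩,
      fun i j => ?_, fun i j => ?_, fun i j => ?_⟩
    · rw [map_iotaXY hT π hB, h1, ← hm, ← hm, hπ']
    · rw [map_iotaYX hT π hB, h2, ← hm, ← hm, hπ']
    · rw [map_iotaYXsubY π hB, h3, ← hm, hπ']

/-- The weak `(V, T)`-module structure on a submodule. -/
def restrict (hT : 0 < T) (Y : WeakModule V T M) (N : Submodule ℂ M) (hN : Y.IsSubmodule N) :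
    WeakModule V T N :=
  Y.pullback hT N.subtype N.subtype_injective
    (fun n => LinearMap.mk₂ ℂ (fun a u => ⟨Y.mode n a (u : M), hN n a u u.2⟩)
      (fun _ _ _ => Subtype.ext (by simp)) (fun _ _ _ => Subtype.ext (by simp))
      (fun _ _ _ => Subtype.ext (by simp)) (fun _ _ _ => Subtype.ext (by simp)))
    (fun _ _ _ => rfl)

/-- A weak `(V, T)`-module is a weak `(V^G, T)`-module. -/
def toFixedPoints (G : Subgroup (Aut V)) (Y : WeakModule V T M) :
    WeakModule (fixedPoints G) T M where
  mode n := (Y.mode n).comp (fixedPoints G).subtype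
  truncation a u := Y.truncation (a : V) u
  vacuum_mode n u := Y.vacuum_mode n u
  duality a b u := Y.duality (a : V) (b : V) u

/-- A weak `(V, T)`-module has countable dimension if it is irreducible and `V` has countable
dimension. -/
theorem rank_le_aleph0 (hV : Module.rank ℂ V ≤ Cardinal.aleph0) (Y : WeakModule V T M)
    (hY : Y.IsIrreducible) : Module.rank ℂ M ≤ Cardinal.aleph0 := by
  obtain ⟨hnt, hirr⟩ := hY
  obtain ⟨u, hu⟩ := exists_ne (0 : M)
  let b := Module.Basis.ofVectorSpace ℂ V
  have hb : Countable (Module.Basis.ofVectorSpaceIndex ℂ V) := by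
    rw [← Cardinal.mk_le_aleph0_iff, b.mk_eq_rank'']
    exact hV
  let g : List (ℤ × Module.Basis.ofVectorSpaceIndex ℂ V) → M := fun L =>
    L.foldr (fun p x => Y.mode p.1 (b p.2) x) u
  let N : Submodule ℂ M := Submodule.span ℂ (Set.range g)
  have hN : Y.IsSubmodule N := by
    intro n a x hx
    induction hx using Submodule.span_induction with
    | mem x hx =>
      obtain ⟨L, rfl⟩ := hx
      have ha : a ∈ Submodule.span ℂ (Set.range b) := by rw [b.span_eq]; trivial
      induction ha using Submodule.span_induction with
      | mem a ha =>
        obtain ⟨i, rfl⟩ := ha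
        exact Submodule.subset_span ⟨(n, i) :: L, rfl⟩
      | zero => simp
      | add a a' _ _ h h' => rw [map_add, LinearMap.add_apply]; exact N.add_mem h h'
      | smul c a _ h => rw [map_smul, LinearMap.smul_apply]; exact N.smul_mem c h
    | zero => simp
    | add x y _ _ h h' => rw [map_add]; exact N.add_mem h h'
    | smul c x _ h => rw [map_smul]; exact N.smul_mem c h
  have hNu : u ∈ N := Submodule.subset_span ⟨[], rfl⟩
  have htop : N = ⊤ := (hirr N hN).resolve_left fun h => hu (by simpa [h] using hNu)
  have h1 : Module.rank ℂ N ≤ Cardinal.mk (Set.range g) := rank_span_le _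
  rw [htop, rank_top] at h1
  exact h1.trans (Cardinal.mk_le_aleph0_iff.mpr (Set.countable_range g).to_subtype)

open Polynomial in
/-- Schur's lemma. -/
theorem schur (hV : Module.rank ℂ V ≤ Cardinal.aleph0) (Y : WeakModule V T M)
    (hY : Y.IsIrreducible) (f : M →ₗ[ℂ] M)
    (hf : ∀ (n : ℤ) (a : V) (u : M), f (Y.mode n a u) = Y.mode n a (f u)) :
    ∃ c : ℂ, ∀ u, f u = c • u := by
  obtain ⟨hnt, hirr⟩ := id hY
  by_contra! hcon
  -- every `f - c` is bijective
  have hbij : ∀ c : ℂ, Function.Bijective (f - algebraMap ℂ (Module.End ℂ M) c) := by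
    intro c
    have hcomm : ∀ (n : ℤ) (a : V) (u : M),
        (f - algebraMap ℂ (Module.End ℂ M) c) (Y.mode n a u) =
          Y.mode n a ((f - algebraMap ℂ (Module.End ℂ M) c) u) := by
      intro n a u
      simp [hf, Module.algebraMap_end_apply]
    obtain ⟨x, hx⟩ := hcon c
    have hx' : (f - algebraMap ℂ (Module.End ℂ M) c) x ≠ 0 := by
      simpa [Module.algebraMap_end_apply, sub_eq_zero] using hx
    constructor
    · rw [← LinearMap.ker_eq_bot]
      refine (hirr _ ?_).resolve_right fun h => hx' ?_
      · intro n a u hu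
        rw [LinearMap.mem_ker] at hu ⊢
        rw [hcomm, hu, map_zero]
      · exact LinearMap.mem_ker.mp (h ▸ Submodule.mem_top)
    · rw [← LinearMap.range_eq_top]
      refine (hirr _ ?_).resolve_left fun h => hx' ?_
      · rintro n a _ ⟨u, rfl⟩
        exact ⟨_, hcomm n a u⟩
      · have := LinearMap.mem_range_self (f - algebraMap ℂ (Module.End ℂ M) c) x
        rw [h] at this
        simpa using this
  -- every nonzero polynomial in `f` is injective
  have hinj : ∀ p : ℂ[X], p ≠ 0 → Function.Injective (aeval f p) := by
    intro p hp
    have hs := IsAlgClosed.splits p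
    rw [hs.eq_prod_roots]
    rw [map_mul, aeval_C]
    have h2 : ∀ s : Multiset ℂ,
        Function.Injective (aeval f (s.map fun a => X - C a).prod) := by
      intro s
      induction s using Multiset.induction with
      | empty =>
        rw [Multiset.map_zero, Multiset.prod_zero, map_one]
        exact Function.injective_id
      | cons a s ih =>
        rw [Multiset.map_cons, Multiset.prod_cons, map_mul]
        simp only [map_sub, aeval_X, aeval_C]
        exact (hbij a).1.comp ih
    intro x y hxy
    apply h2 p.roots
    simpa [Module.algebraMap_end_apply, hp] using hxy
  obtain ⟨u, hu⟩ := exists_ne (0 : M)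
  choose g hg using fun c => (hbij c).2 u
  have hli : LinearIndependent ℂ g := by
    rw [linearIndependent_iff']
    intro s m hm i hi
    classical
    let p : ℂ[X] := ∑ j ∈ s, C (m j) * ∏ k ∈ s.erase j, (X - C k)
    have hpu : aeval f p u = 0 := by
      have hb := congrArg (aeval f (∏ k ∈ s, (X - C k))) hm
      rw [map_zero, map_sum] at hb
      rw [← hb]
      simp only [p, map_sum, LinearMap.sum_apply]
      refine Finset.sum_congr rfl fun j hj => ?_
      rw [← Finset.prod_erase_mul s _ hj, map_smul, map_mul, map_mul, aeval_C]
      simp only [map_sub, aeval_X, aeval_C, Module.End.mul_apply]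
      rw [hg, Module.algebraMap_end_apply]
    have hp0 : p = 0 := by
      by_contra hp
      exact hu (hinj p hp (by rw [hpu, map_zero]))
    have he := congrArg (eval i) hp0
    simp only [p, eval_finsetSum, eval_mul, eval_C, eval_prod, eval_sub, eval_X, eval_zero] at he
    rw [Finset.sum_eq_single_of_mem i hi] at he
    · refine (mul_eq_zero.mp he).resolve_right (Finset.prod_ne_zero_iff.mpr fun k hk => ?_)
      exact sub_ne_zero.mpr (Finset.ne_of_mem_erase hk).symm
    · intro j _ hji
      rw [Finset.prod_eq_zero (Finset.mem_erase.mpr ⟨hji.symm, hi⟩) (sub_self i), mul_zero]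
  have h1 := hli.cardinal_lift_le_rank
  have h2 := Cardinal.lift_le.{0}.mpr (rank_le_aleph0 hV Y hY)
  rw [Cardinal.mk_complex] at h1
  have h3 : Cardinal.lift.{v} Cardinal.continuum ≤ Cardinal.lift.{0} Cardinal.aleph0 :=
    h1.trans h2
  simp at h3
  exact absurd Cardinal.aleph0_lt_continuum (not_lt.mpr h3)

end WeakModule

/-! ### The algebra attached to a finite `G`-set and a `2`-cocycle -/

/-- A `2`-cocycle `α : G × G → 𝒰(ℂX)` for a `G`-set `X`, where `α(σ, τ) = ∑ₓ αₓ(σ, τ) e(x)`.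
The right action of the group on `X` is written `x · σ = σ⁻¹ • x`. -/
structure TwoCocycle (G : Type u) [Group G] (X : Type v) [MulAction G X] where
  /-- the coefficient `αₓ(σ, τ)` -/
  coeff : X → G → G → ℂ
  coeff_ne_zero : ∀ x σ τ, coeff x σ τ ≠ 0
  cocycle : ∀ (x : X) (σ τ ρ : G),
    coeff (ρ • x) σ τ * coeff x (σ * τ) ρ = coeff x σ (τ * ρ) * coeff x τ ρ

/-- The underlying space `ℂ[G] ⊗ ℂX` of the algebra `A_α(G, X)`, with basis `σ ⊗ e(x)`. For
`X` a point this is the twisted group algebra `ℂ^α[G]`. -/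
def TwistedAlgebra {G : Type u} [Group G] {X : Type v} [MulAction G X] (_α : TwoCocycle G X) :
    Type (max u v) := (G × X) →₀ ℂ

namespace TwistedAlgebra

variable {G : Type u} [Group G] {X : Type v} [MulAction G X] (α : TwoCocycle G X)

instance : AddCommGroup (TwistedAlgebra α) := inferInstanceAs (AddCommGroup ((G × X) →₀ ℂ))

instance : Module ℂ (TwistedAlgebra α) := inferInstanceAs (Module ℂ ((G × X) →₀ ℂ))

/-- The basis of the elements `σ ⊗ e(x)`. -/
def basis : Module.Basis (G × X) ℂ (TwistedAlgebra α) :=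
  Module.Basis.ofRepr (LinearEquiv.refl ℂ ((G × X) →₀ ℂ))

/-- The basis element `σ ⊗ e(x)`. -/
def of (σ : G) (x : X) : TwistedAlgebra α := basis α (σ, x)

open Classical in
/-- The multiplication
`(σ ⊗ e(x)) (τ ⊗ e(y)) = α_y(σ, τ) στ ⊗ e(x · τ) e(y)`,
which is `0` unless `x · τ = y`, that is, `x = τ • y`. -/
def mulMap : TwistedAlgebra α →ₗ[ℂ] TwistedAlgebra α →ₗ[ℂ] TwistedAlgebra α :=
  (basis α).constr ℂ fun p => (basis α).constr ℂ fun q =>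
    if p.2 = q.1 • q.2 then α.coeff q.2 p.1 q.1 • of α (p.1 * q.1) q.2 else 0

instance : Mul (TwistedAlgebra α) := ⟨fun a b => mulMap α a b⟩

theorem mul_def (a b : TwistedAlgebra α) : a * b = mulMap α a b := rfl

theorem of_mul_of (σ τ : G) (x y : X) [Decidable (x = τ • y)] :
    of α σ x * of α τ y = if x = τ • y then α.coeff y σ τ • of α (σ * τ) y else 0 := by
  rw [mul_def, mulMap, of, of, Module.Basis.constr_basis, Module.Basis.constr_basis]
  congr

variable {α} in
theorem induction_on {P : TwistedAlgebra α → Prop} (a : TwistedAlgebra α)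
    (hof : ∀ σ x, P (of α σ x)) (hzero : P 0) (hadd : ∀ a b, P a → P b → P (a + b))
    (hsmul : ∀ (c : ℂ) a, P a → P (c • a)) : P a := by
  have h : a ∈ Submodule.span ℂ (Set.range (basis α)) := by rw [(basis α).span_eq]; trivial
  induction h using Submodule.span_induction with
  | mem x hx => obtain ⟨⟨σ, y⟩, rfl⟩ := hx; exact hof σ y
  | zero => exact hzero
  | add x y _ _ hx hy => exact hadd x y hx hy
  | smul c x _ hx => exact hsmul c x hx

theorem coeff_one_right (x : X) (σ : G) : α.coeff x σ 1 = α.coeff x 1 1 := by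
  have h := α.cocycle x σ 1 1
  rw [one_smul, mul_one, mul_one] at h
  exact mul_left_cancel₀ (α.coeff_ne_zero x σ 1) h

theorem coeff_one_left (x : X) (τ : G) : α.coeff x 1 τ = α.coeff (τ • x) 1 1 := by
  have h := α.cocycle x 1 1 τ
  rw [one_mul, one_mul] at h
  exact (mul_right_cancel₀ (α.coeff_ne_zero x 1 τ) h).symm

protected theorem add_mul' (a b c : TwistedAlgebra α) : (a + b) * c = a * c + b * c := by
  simp [mul_def]

protected theorem mul_add' (a b c : TwistedAlgebra α) : a * (b + c) = a * b + a * c := by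
  simp [mul_def]

protected theorem smul_mul' (r : ℂ) (a b : TwistedAlgebra α) : (r • a) * b = r • (a * b) := by
  simp [mul_def]

protected theorem mul_smul' (r : ℂ) (a b : TwistedAlgebra α) : a * (r • b) = r • (a * b) := by
  simp [mul_def]

protected theorem zero_mul' (a : TwistedAlgebra α) : 0 * a = 0 := by
  simp [mul_def]

protected theorem mul_zero' (a : TwistedAlgebra α) : a * 0 = 0 := by
  simp [mul_def]

protected theorem mul_assoc' (a b c : TwistedAlgebra α) : a * b * c = a * (b * c) := by
  classical
  induction a using induction_on with
  | hzero => simp only [TwistedAlgebra.zero_mul']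
  | hadd a a' h h' => simp only [TwistedAlgebra.add_mul', h, h']
  | hsmul r a h => simp only [TwistedAlgebra.smul_mul', h]
  | hof σ x =>
  induction b using induction_on with
  | hzero => simp only [TwistedAlgebra.zero_mul', TwistedAlgebra.mul_zero']
  | hadd a a' h h' => simp only [TwistedAlgebra.add_mul', TwistedAlgebra.mul_add', h, h']
  | hsmul r a h => simp only [TwistedAlgebra.smul_mul', TwistedAlgebra.mul_smul', h]
  | hof τ y =>
  induction c using induction_on with
  | hzero => simp only [TwistedAlgebra.mul_zero']
  | hadd a a' h h' => simp only [TwistedAlgebra.mul_add', h, h']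
  | hsmul r a h => simp only [TwistedAlgebra.mul_smul', h]
  | hof ρ z =>
  rw [of_mul_of, of_mul_of]
  by_cases hyz : y = ρ • z
  · subst hyz
    by_cases hx : x = τ • ρ • z
    · subst hx
      rw [if_pos rfl, if_pos rfl, TwistedAlgebra.smul_mul', TwistedAlgebra.mul_smul',
        of_mul_of, of_mul_of, if_pos rfl, if_pos (mul_smul _ _ _).symm, smul_smul, smul_smul,
        mul_assoc, α.cocycle, mul_comm]
    · rw [if_neg hx, if_pos rfl, TwistedAlgebra.zero_mul', TwistedAlgebra.mul_smul', of_mul_of,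
        if_neg (by rwa [mul_smul]), smul_zero]
  · rw [if_neg hyz, TwistedAlgebra.mul_zero']
    split_ifs
    · rw [TwistedAlgebra.smul_mul', of_mul_of, if_neg hyz, smul_zero]
    · rw [TwistedAlgebra.zero_mul']

variable [Fintype X]

/-- The identity element; `αₓ(1, 1) = 1` if the cocycle is normalized. -/
instance : One (TwistedAlgebra α) := ⟨∑ x, (α.coeff x 1 1)⁻¹ • of α 1 x⟩

theorem one_def : (1 : TwistedAlgebra α) = ∑ x, (α.coeff x 1 1)⁻¹ • of α 1 x := rfl

protected theorem one_mul' (a : TwistedAlgebra α) : 1 * a = a := by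
  classical
  induction a using induction_on with
  | hzero => simp only [TwistedAlgebra.mul_zero']
  | hadd a a' h h' => simp only [TwistedAlgebra.mul_add', h, h']
  | hsmul r a h => simp only [TwistedAlgebra.mul_smul', h]
  | hof σ x =>
  rw [one_def, mul_def, map_sum, LinearMap.sum_apply]
  rw [Finset.sum_eq_single (σ • x)]
  · rw [← mul_def, TwistedAlgebra.smul_mul', of_mul_of, if_pos rfl, coeff_one_left α x σ, smul_smul,
      inv_mul_cancel₀ (α.coeff_ne_zero _ _ _), one_smul, one_mul]
  · intro y _ hy
    rw [← mul_def, TwistedAlgebra.smul_mul', of_mul_of, if_neg hy, smul_zero]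
  · simp

protected theorem mul_one' (a : TwistedAlgebra α) : a * 1 = a := by
  classical
  induction a using induction_on with
  | hzero => simp only [TwistedAlgebra.zero_mul']
  | hadd a a' h h' => simp only [TwistedAlgebra.add_mul', h, h']
  | hsmul r a h => simp only [TwistedAlgebra.smul_mul', h]
  | hof σ x =>
  rw [one_def, mul_def, map_sum]
  rw [Finset.sum_eq_single x]
  · rw [← mul_def, TwistedAlgebra.mul_smul', of_mul_of, if_pos (one_smul _ _).symm,
      coeff_one_right α x σ, smul_smul, inv_mul_cancel₀ (α.coeff_ne_zero _ _ _), one_smul, mul_one]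
  · intro y _ hy
    rw [← mul_def, TwistedAlgebra.mul_smul', of_mul_of,
      if_neg (by rw [one_smul]; exact hy.symm), smul_zero]
  · simp

instance : Ring (TwistedAlgebra α) where
  __ := instAddCommGroup α
  mul_assoc := TwistedAlgebra.mul_assoc' α
  one_mul := TwistedAlgebra.one_mul' α
  mul_one := TwistedAlgebra.mul_one' α
  left_distrib := TwistedAlgebra.mul_add' α
  right_distrib := TwistedAlgebra.add_mul' α
  zero_mul := TwistedAlgebra.zero_mul' α
  mul_zero := TwistedAlgebra.mul_zero' α

instance : Algebra ℂ (TwistedAlgebra α) :=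
  Algebra.ofModule (TwistedAlgebra.smul_mul' α) (TwistedAlgebra.mul_smul' α)

/-- The algebra homomorphism to `End E` determined by operators on a vector space `E` that
satisfy the relations of the basis elements `σ ⊗ e(x)`. -/
def lift {E : Type w} [AddCommGroup E] [Module ℂ E] (F : G → X → Module.End ℂ E)
    (hone : ∑ x, (α.coeff x 1 1)⁻¹ • F 1 x = 1)
    (hmul : ∀ σ τ y, F σ (τ • y) * F τ y = α.coeff y σ τ • F (σ * τ) y)
    (hzero : ∀ σ τ x y, x ≠ τ • y → F σ x * F τ y = 0) :
    TwistedAlgebra α →ₐ[ℂ] Module.End ℂ E :=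
  AlgHom.ofLinearMap ((basis α).constr ℂ fun p => F p.1 p.2)
    (by
      have h : ∀ σ x, (basis α).constr ℂ (fun p => F p.1 p.2) (of α σ x) = F σ x :=
        fun σ x => Module.Basis.constr_basis _ _ _ _
      rw [one_def, map_sum, ← hone]
      exact Finset.sum_congr rfl fun x _ => by rw [map_smul, h])
    (by
      classical
      have h : ∀ σ x, (basis α).constr ℂ (fun p => F p.1 p.2) (of α σ x) = F σ x :=
        fun σ x => Module.Basis.constr_basis _ _ _ _
      intro a b
      induction a using induction_on with
      | hzero => simp only [zero_mul, map_zero]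
      | hadd a a' h h' => simp only [add_mul, map_add, h, h']
      | hsmul r a h => simp only [smul_mul_assoc, map_smul, h]
      | hof σ x =>
      induction b using induction_on with
      | hzero => simp only [mul_zero, map_zero]
      | hadd a a' h h' => simp only [mul_add, map_add, h, h']
      | hsmul r a h => simp only [mul_smul_comm, map_smul, h]
      | hof τ y =>
      rw [of_mul_of, h, h]
      split_ifs with hxy
      · rw [map_smul, h, hxy, hmul]
      · rw [map_zero, hzero σ τ x y hxy])

theorem lift_of {E : Type w} [AddCommGroup E] [Module ℂ E] (F : G → X → Module.End ℂ E)
    (hone : ∑ x, (α.coeff x 1 1)⁻¹ • F 1 x = 1)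
    (hmul : ∀ σ τ y, F σ (τ • y) * F τ y = α.coeff y σ τ • F (σ * τ) y)
    (hzero : ∀ σ τ x y, x ≠ τ • y → F σ x * F τ y = 0) (σ : G) (x : X) :
    lift α F hone hmul hzero (of α σ x) = F σ x :=
  Module.Basis.constr_basis (basis α) ℂ (fun p => F p.1 p.2) (σ, x)

end TwistedAlgebra

/-! ### Twisted group algebras of stabilizers and induced modules -/

/-- The restriction of `αₓ` to the stabilizer of `x`. -/
def TwoCocycle.stabilizer {G : Type u} [Group G] {X : Type v} [MulAction G X]
    (α : TwoCocycle G X) (x : X) : TwoCocycle (MulAction.stabilizer G x) Unit where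
  coeff _ σ τ := α.coeff x σ τ
  coeff_ne_zero _ _ _ := α.coeff_ne_zero _ _ _
  cocycle _ σ τ ρ := by
    have h := α.cocycle x σ τ ρ
    rwa [show (ρ : G) • x = x from ρ.2] at h

namespace TwistedAlgebra

variable {G : Type u} [Group G] {X : Type v} [MulAction G X] [Fintype X] (α : TwoCocycle G X)
  (x : X)

/-- The inclusion of the twisted group algebra of the stabilizer of `x`, sending `σ` to
`σ ⊗ e(x)`. Its image is the subalgebra `S(x)`. -/
def stabilizerMap : TwistedAlgebra (α.stabilizer x) →ₗ[ℂ] TwistedAlgebra α :=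
  (basis (α.stabilizer x)).constr ℂ fun p => of α p.1 x

theorem mul_mem_span (a b : TwistedAlgebra α)
    (h : b ∈ Submodule.span ℂ (Set.range fun σ : G => of α σ x)) :
    a * b ∈ Submodule.span ℂ (Set.range fun σ : G => of α σ x) := by
  classical
  induction h using Submodule.span_induction with
  | zero => rw [mul_zero]; exact Submodule.zero_mem _
  | add b b' h1 h2 h h' => rw [mul_add]; exact Submodule.add_mem _ h h'
  | smul r b h1 h => rw [mul_smul_comm]; exact Submodule.smul_mem _ r h
  | mem b hb =>
    obtain ⟨τ, rfl⟩ := hb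
    induction a using induction_on with
    | hzero => rw [zero_mul]; exact Submodule.zero_mem _
    | hadd a a' h h' => rw [add_mul]; exact Submodule.add_mem _ h h'
    | hsmul r a h => rw [smul_mul_assoc]; exact Submodule.smul_mem _ r h
    | hof σ y =>
      simp only [of_mul_of]
      split_ifs
      · exact Submodule.smul_mem _ _ (Submodule.subset_span ⟨σ * τ, rfl⟩)
      · exact Submodule.zero_mem _

/-- The left ideal `D(x)` spanned by the `σ ⊗ e(x)` with `σ ∈ G`. -/
def leftIdeal : Submodule (TwistedAlgebra α) (TwistedAlgebra α) where
  __ := Submodule.span ℂ (Set.range fun σ : G => of α σ x)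
  smul_mem' a b hb := mul_mem_span α x a b hb

theorem stabilizerMap_mem (r : TwistedAlgebra (α.stabilizer x)) :
    stabilizerMap α x r ∈ leftIdeal α x := by
  change _ ∈ Submodule.span ℂ (Set.range fun σ : G => of α σ x)
  rw [stabilizerMap, Module.Basis.constr_apply]
  exact Submodule.sum_mem _ fun p _ =>
    Submodule.smul_mem _ _ (Submodule.subset_span ⟨(p.1 : G), rfl⟩)

variable (W : Type w) [AddCommGroup W] [Module ℂ W] [Module (TwistedAlgebra (α.stabilizer x)) W]

/-- The relations `d s ⊗ w = d ⊗ s w`, for `s` in the twisted group algebra of the stabilizer. -/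
def inducedRelations : Submodule (TwistedAlgebra α) (leftIdeal α x ⊗[ℂ] W) :=
  Submodule.span (TwistedAlgebra α)
    {t | ∃ (d : leftIdeal α x) (s : TwistedAlgebra (α.stabilizer x)) (m : W),
      t = (⟨d * stabilizerMap α x s,
        (leftIdeal α x).smul_mem d (stabilizerMap_mem α x s)⟩ : leftIdeal α x) ⊗ₜ[ℂ] m -
          d ⊗ₜ[ℂ] (s • m)}

/-- The induced module `D(x) ⊗_{S(x)} W`. -/
abbrev Induced : Type _ := (leftIdeal α x ⊗[ℂ] W) ⧸ inducedRelations α x W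

end TwistedAlgebra

/-- `W` is a complete set of representatives of the isomorphism classes of simple `R`-modules. -/
structure IsCompleteSimpleFamily (R : Type u) [Ring R] {Λ : Type v} (W : Λ → Type w)
    [∀ p, AddCommGroup (W p)] [∀ p, Module R (W p)] : Prop where
  isSimple : ∀ p, IsSimpleModule R (W p)
  eq_of_iso : ∀ p q, Nonempty (W p ≃ₗ[R] W q) → p = q
  complete : ∀ (N : Type w) [AddCommGroup N] [Module R N], IsSimpleModule R N →
    ∃ p, Nonempty (N ≃ₗ[R] W p)

/-! ### Stable families of irreducible weak modules -/

/-- A finite `G`-stable set of inequivalent irreducible weak `(V, T)`-modules. -/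
structure StableFamily {V : Type u} [AddCommGroup V] [Module ℂ V] [VertexAlgebra V]
    (G : Subgroup (Aut V)) (T : ℕ) where
  index : Type u
  [fintype : Fintype index]
  carrier : index → Type v
  [addCommGroup : ∀ i, AddCommGroup (carrier i)]
  [module : ∀ i, Module ℂ (carrier i)]
  str : ∀ i, WeakModule V T (carrier i)
  irreducible : ∀ i, (str i).IsIrreducible
  inequivalent : ∀ i j, (str i).Iso (str j) → i = j
  stable : ∀ (i : index) (σ : G), ∃ j, ((str i).twist σ).Iso (str j)

namespace StableFamily

attribute [instance] fintype addCommGroup module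

variable {V : Type u} [AddCommGroup V] [Module ℂ V] [VertexAlgebra V]
  {G : Subgroup (Aut V)} {T : ℕ} (S : StableFamily.{u, v} G T)

/-- The action of `G` on a stable family: `σ • M` is the member isomorphic to `M · σ⁻¹`. -/
instance : SMul G S.index := ⟨fun σ i => (S.stable i σ⁻¹).choose⟩

theorem smul_spec (σ : G) (i : S.index) :
    ((S.str i).twist (σ⁻¹ : G)).Iso (S.str (σ • i)) := (S.stable i σ⁻¹).choose_spec

theorem apply_inv_apply (σ : G) (a : V) : (σ : V ≃ₗ[ℂ] V) (((σ⁻¹ : G) : V ≃ₗ[ℂ] V) a) = a :=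
  (σ : V ≃ₗ[ℂ] V).apply_symm_apply a

theorem inv_apply_apply (σ : G) (a : V) : ((σ⁻¹ : G) : V ≃ₗ[ℂ] V) ((σ : V ≃ₗ[ℂ] V) a) = a :=
  (σ : V ≃ₗ[ℂ] V).symm_apply_apply a

theorem exists_map (σ : G) (i : S.index) :
    ∃ f : S.carrier i ≃ₗ[ℂ] S.carrier (σ • i), ∀ (n : ℤ) (a : V) (u : S.carrier i),
      f ((S.str i).mode n a u) = (S.str (σ • i)).mode n ((σ : V ≃ₗ[ℂ] V) a) (f u) := by
  obtain ⟨f, hf⟩ := S.smul_spec σ i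
  refine ⟨f, fun n a u => ?_⟩
  rw [← hf, WeakModule.twist_mode, inv_apply_apply]

theorem smul_eq_of_map {σ : G} {i j : S.index} (f : S.carrier i ≃ₗ[ℂ] S.carrier j)
    (hf : ∀ (n : ℤ) (a : V) (u : S.carrier i),
      f ((S.str i).mode n a u) = (S.str j).mode n ((σ : V ≃ₗ[ℂ] V) a) (f u)) : σ • i = j := by
  obtain ⟨g, hg⟩ := S.exists_map σ i
  refine S.inequivalent _ _ ⟨g.symm.trans f, fun n a u => ?_⟩
  obtain ⟨u, rfl⟩ := g.surjective u
  have h := hg n (((σ⁻¹ : G) : V ≃ₗ[ℂ] V) a) u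
  rw [apply_inv_apply] at h
  rw [← h]
  simp [hf]

instance : MulAction G S.index where
  one_smul i := S.smul_eq_of_map (LinearEquiv.refl ℂ _) fun _ _ _ => rfl
  mul_smul σ τ i := by
    obtain ⟨f, hf⟩ := S.exists_map τ i
    obtain ⟨g, hg⟩ := S.exists_map σ (τ • i)
    refine S.smul_eq_of_map (f.trans g) fun n a u => ?_
    rw [LinearEquiv.trans_apply, hf, hg]
    rfl

/-- A choice of isomorphisms `φ(σ, M) : M → N` with `φ(σ, M) Y_M(a, x) = Y_N(σ a, x) φ(σ, M)`,
where `N = σ • M` is the member of the family with `N · σ ≅ M`. -/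
structure Intertwiners where
  map : ∀ (σ : G) (i j : S.index), σ • i = j → (S.carrier i ≃ₗ[ℂ] S.carrier j)
  map_mode : ∀ (σ : G) (i j : S.index) (h : σ • i = j) (n : ℤ) (a : V) (u : S.carrier i),
    map σ i j h ((S.str i).mode n a u) = (S.str j).mode n ((σ : V ≃ₗ[ℂ] V) a) (map σ i j h u)

/-- Intertwiners exist for every stable family. -/
instance : Nonempty S.Intertwiners := by
  choose f hf using S.exists_map
  exact ⟨⟨fun σ i j h => h ▸ f σ i, by rintro σ i j rfl n a u; exact hf σ i n a u⟩⟩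

namespace Intertwiners

variable {S} (φ : S.Intertwiners)

theorem exists_coeff (hV : Module.rank ℂ V ≤ Cardinal.aleph0) (i : S.index) (σ τ : G) :
    ∃ c : ℂ, c ≠ 0 ∧ ∀ (j k : S.index) (hj : τ • i = j) (hk : σ • j = k) (hk' : (σ * τ) • i = k)
      (u : S.carrier i),
      φ.map σ j k hk (φ.map τ i j hj u) = c • φ.map (σ * τ) i k hk' u := by
  have hk' : (σ * τ) • i = σ • τ • i := mul_smul σ τ i
  let f : S.carrier i ≃ₗ[ℂ] S.carrier i :=
    ((φ.map τ i _ rfl).trans (φ.map σ (τ • i) _ rfl)).trans (φ.map (σ * τ) i _ hk').symm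
  obtain ⟨c, hc⟩ := (S.str i).schur hV (S.irreducible i) f.toLinearMap (by
    intro n a u
    apply (φ.map (σ * τ) i _ hk').injective
    simp only [f, LinearEquiv.coe_coe, LinearEquiv.trans_apply, LinearEquiv.apply_symm_apply,
      φ.map_mode]
    rfl)
  have hc' : ∀ u, φ.map σ (τ • i) _ rfl (φ.map τ i _ rfl u) = c • φ.map (σ * τ) i _ hk' u := by
    intro u
    have h := congrArg (φ.map (σ * τ) i _ hk') (hc u)
    simpa [f] using h
  refine ⟨c, ?_, ?_⟩
  · rintro rfl
    obtain ⟨hnt, -⟩ := S.irreducible i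
    obtain ⟨u, hu⟩ := exists_ne (0 : S.carrier i)
    have h := hc' u
    rw [zero_smul] at h
    simp at h
    exact hu h
  · rintro j k rfl rfl _ u
    exact hc' u

/-- The cocycle determined by
`φ(σ, M · τ⁻¹) φ(τ, M) = α_M(σ, τ) φ(σ τ, M)`. -/
def alpha (hV : Module.rank ℂ V ≤ Cardinal.aleph0) : TwoCocycle G S.index where
  coeff i σ τ := (φ.exists_coeff hV i σ τ).choose
  coeff_ne_zero i σ τ := (φ.exists_coeff hV i σ τ).choose_spec.1
  cocycle i σ τ ρ := by
    have h := fun i σ τ => (φ.exists_coeff hV i σ τ).choose_spec.2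
    obtain ⟨hnt, -⟩ := S.irreducible i
    obtain ⟨u, hu⟩ := exists_ne (0 : S.carrier i)
    obtain ⟨j, hj⟩ : ∃ j, ρ • i = j := ⟨_, rfl⟩
    obtain ⟨k, hk⟩ : ∃ k, τ • j = k := ⟨_, rfl⟩
    obtain ⟨l, hl⟩ : ∃ l, σ • k = l := ⟨_, rfl⟩
    have e1 : (τ * ρ) • i = k := by rw [mul_smul, hj, hk]
    have e2 : (σ * τ) • j = l := by rw [mul_smul, hk, hl]
    have e3 : (σ * τ * ρ) • i = l := by rw [mul_smul, hj, e2]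
    have e4 : (σ * (τ * ρ)) • i = l := by rw [mul_smul, e1, hl]
    have h1 := h j σ τ k l hk hl e2 (φ.map ρ i j hj u)
    rw [h i (σ * τ) ρ j l hj e2 e3 u, h i τ ρ j k hj hk e1 u, map_smul,
      h i σ (τ * ρ) k l e1 hl e4 u, smul_smul, smul_smul] at h1
    have e5 : ∀ (g g' : G) (hg : g • i = l) (hg' : g' • i = l), g = g' →
        φ.map g i l hg u = φ.map g' i l hg' u := by
      rintro g _ _ _ rfl
      rfl
    rw [e5 _ _ e4 e3 (mul_assoc σ τ ρ).symm] at h1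
    have hne : φ.map (σ * τ * ρ) i l e3 u ≠ 0 := by simpa using hu
    subst hj
    have h2 := smul_left_injective ℂ hne h1
    exact h2.symm.trans (mul_comm _ _)

theorem alpha_spec (hV : Module.rank ℂ V ≤ Cardinal.aleph0) (i : S.index) (σ τ : G)
    (j k : S.index) (hj : τ • i = j) (hk : σ • j = k) (hk' : (σ * τ) • i = k)
    (u : S.carrier i) :
    φ.map σ j k hk (φ.map τ i j hj u) = (φ.alpha hV).coeff i σ τ • φ.map (σ * τ) i k hk' u :=
  (φ.exists_coeff hV i σ τ).choose_spec.2 j k hj hk hk' u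

theorem inv_alpha_smul_map_one (hV : Module.rank ℂ V ≤ Cardinal.aleph0) (i : S.index)
    (h : (1 : G) • i = i) (u : S.carrier i) :
    ((φ.alpha hV).coeff i 1 1)⁻¹ • φ.map 1 i i h u = u := by
  have e : ((1 : G) * 1) • i = i := by rw [mul_one, h]
  have h1 := φ.alpha_spec hV i 1 1 i i h h e u
  have e5 : φ.map (1 * 1) i i e u = φ.map 1 i i h u := by
    congr 2
  rw [e5, ← map_smul] at h1
  have h2 := (φ.map 1 i i h).injective h1
  rw [h2, smul_smul, inv_mul_cancel₀ ((φ.alpha hV).coeff_ne_zero _ _ _), one_smul]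

/-- The algebra `A_α(G, S)`. -/
abbrev algebra (hV : Module.rank ℂ V ≤ Cardinal.aleph0) : Type u := TwistedAlgebra (φ.alpha hV)

/-- The twisted group algebra `ℂ^{α_M}[G_M]`, where `G_M = {σ | M · σ ≅ M}` is the stabilizer
of `M`. -/
abbrev stabilizerAlgebra (hV : Module.rank ℂ V ≤ Cardinal.aleph0) (i : S.index) : Type u :=
  TwistedAlgebra ((φ.alpha hV).stabilizer i)

open Classical in
/-- The action of `A_α(G, S)` on the direct sum `𝓜` of the members of the family:
`σ ⊗ e(M)` maps `u ∈ M` to `φ(σ, M) u` and is zero on the other summands. -/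
def action (hV : Module.rank ℂ V ≤ Cardinal.aleph0) :
    φ.algebra hV →ₐ[ℂ] Module.End ℂ (⨁ i, S.carrier i) :=
  TwistedAlgebra.lift (φ.alpha hV)
    (fun σ i => DirectSum.lof ℂ S.index S.carrier (σ • i) ∘ₗ (φ.map σ i _ rfl).toLinearMap ∘ₗ
      DirectSum.component ℂ S.index S.carrier i)
    (by
      refine DirectSum.linearMap_ext ℂ fun j => LinearMap.ext fun u => ?_
      have h : ∀ (k : S.index) (hk : (1 : G) • j = k), j = k →
          DirectSum.lof ℂ S.index S.carrier k (((φ.alpha hV).coeff j 1 1)⁻¹ • φ.map 1 j k hk u) =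
            DirectSum.lof ℂ S.index S.carrier j u := by
        rintro k hk rfl
        rw [φ.inv_alpha_smul_map_one hV j hk u]
      simp only [LinearMap.comp_apply, LinearMap.sum_apply, LinearMap.smul_apply,
        LinearEquiv.coe_coe, Module.End.one_apply]
      rw [Finset.sum_eq_single j]
      · rw [DirectSum.component.lof_self, ← map_smul]
        exact h _ rfl (one_smul G j).symm
      · intro k _ hk
        rw [DirectSum.component.of, dif_neg hk.symm]
        simp
      · simp)
    (by
      intro σ τ i
      refine LinearMap.ext fun u => ?_
      have h : ∀ (k : S.index) (hk : (σ * τ) • i = k), (hk' : σ • τ • i = k) →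
          DirectSum.lof ℂ S.index S.carrier (σ • τ • i) (φ.map σ (τ • i) _ rfl
            (φ.map τ i _ rfl (DirectSum.component ℂ S.index S.carrier i u))) =
          (φ.alpha hV).coeff i σ τ • DirectSum.lof ℂ S.index S.carrier k
            (φ.map (σ * τ) i k hk (DirectSum.component ℂ S.index S.carrier i u)) := by
        rintro k hk rfl
        rw [φ.alpha_spec hV i σ τ _ _ rfl rfl hk, map_smul]
      simp only [Module.End.mul_apply, LinearMap.comp_apply, LinearMap.smul_apply,
        LinearEquiv.coe_coe, DirectSum.component.lof_self]
      exact h _ rfl (mul_smul σ τ i).symm)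
    (by
      intro σ τ x y hxy
      refine LinearMap.ext fun u => ?_
      simp only [Module.End.mul_apply, LinearMap.comp_apply, LinearEquiv.coe_coe]
      rw [DirectSum.component.of, dif_neg (Ne.symm hxy)]
      simp)

/-- The action of `ℂ^{α_M}[G_M]` on `M`, where `σ` acts as `φ(σ, M)`. -/
def stabilizerAction (hV : Module.rank ℂ V ≤ Cardinal.aleph0) (i : S.index) :
    φ.stabilizerAlgebra hV i →ₐ[ℂ] Module.End ℂ (S.carrier i) :=
  TwistedAlgebra.lift ((φ.alpha hV).stabilizer i)
    (fun σ _ => (φ.map (σ : G) i i (MulAction.mem_stabilizer_iff.mp σ.2)).toLinearMap)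
    (by
      ext u
      simpa using! φ.inv_alpha_smul_map_one hV i (one_smul G i) u)
    (by
      intro σ τ _
      ext u
      exact φ.alpha_spec hV i σ τ i i _ _ _ u)
    (by
      intro σ τ x y h
      exact absurd rfl h)

section Multiplicity

variable (hV : Module.rank ℂ V ≤ Cardinal.aleph0) (i : S.index)
  (W : Type u) [AddCommGroup W] [Module ℂ W] [Module (φ.stabilizerAlgebra hV i) W]

/-- The multiplicity space `M_λ = Hom(W, M)`, the homomorphisms of `ℂ^{α_M}[G_M]`-modules. -/
def multiplicity : Submodule ℂ (W →ₗ[ℂ] S.carrier i) where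
  carrier := {f | ∀ (r : φ.stabilizerAlgebra hV i) (m : W),
    f (r • m) = φ.stabilizerAction hV i r (f m)}
  zero_mem' := fun r m => by simp
  add_mem' := fun hf hg r m => by simp [hf r m, hg r m]
  smul_mem' := fun c f hf r m => by simp [hf r m]

/-- For `a ∈ V^G` the modes of `a` commute with `ℂ^{α_M}[G_M]`. -/
theorem stabilizerAction_mode (r : φ.stabilizerAlgebra hV i) (n : ℤ) (a : fixedPoints G)
    (u : S.carrier i) :
    φ.stabilizerAction hV i r ((S.str i).mode n (a : V) u) =
      (S.str i).mode n (a : V) (φ.stabilizerAction hV i r u) := by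
  induction r using TwistedAlgebra.induction_on with
  | hzero => simp
  | hadd r r' h h' => simp [h, h']
  | hsmul c r h => simp [h]
  | hof σ x =>
    have e : φ.stabilizerAction hV i (TwistedAlgebra.of _ σ x) =
        (φ.map (σ : G) i i (MulAction.mem_stabilizer_iff.mp σ.2)).toLinearMap := TwistedAlgebra.lift_of _ _ _ _ _ _ _
    rw [e, LinearEquiv.coe_coe, φ.map_mode, a.2 σ]

/-- The modes of `V^G` on the multiplicity space: `(aₙ f)(w) = aₙ (f w)`. -/
def multiplicityMode (n : ℤ) :
    fixedPoints G →ₗ[ℂ] φ.multiplicity hV i W →ₗ[ℂ] φ.multiplicity hV i W :=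
  LinearMap.mk₂ ℂ (fun a f => ⟨(S.str i).mode n (a : V) ∘ₗ (f : W →ₗ[ℂ] S.carrier i),
      fun r m => by
        rw [LinearMap.comp_apply, f.2 r m, LinearMap.comp_apply, φ.stabilizerAction_mode]⟩)
    (fun _ _ _ => Subtype.ext (by ext; simp)) (fun _ _ _ => Subtype.ext (by ext; simp))
    (fun _ _ _ => Subtype.ext (by ext; simp)) (fun _ _ _ => Subtype.ext (by ext; simp))

/-- The multiplicity space `M_λ` of an irreducible module `W` as a weak `(V^G, T)`-module. -/
def multiplicityModule (hT : 0 < T) (hW : IsSimpleModule (φ.stabilizerAlgebra hV i) W) :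
    WeakModule (fixedPoints G) T (φ.multiplicity hV i W) :=
  have := IsSimpleModule.nontrivial (φ.stabilizerAlgebra hV i) W
  ((S.str i).toFixedPoints G).pullback hT
    ((LinearMap.applyₗ (exists_ne (0 : W)).choose) ∘ₗ (φ.multiplicity hV i W).subtype)
    (by
      intro f g h
      have hw := (exists_ne (0 : W)).choose_spec
      have h' : (f : W →ₗ[ℂ] S.carrier i) (exists_ne (0 : W)).choose =
        (g : W →ₗ[ℂ] S.carrier i) (exists_ne (0 : W)).choose := h
      refine Subtype.ext (LinearMap.ext fun m => ?_)
      obtain ⟨r, rfl⟩ := IsSimpleModule.toSpanSingleton_surjective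
        (φ.stabilizerAlgebra hV i) hw m
      rw [LinearMap.toSpanSingleton_apply, f.2 r, g.2 r, h'])
    (φ.multiplicityMode hV i W) (fun _ _ _ => rfl)

end Multiplicity

end Intertwiners

/-- The modes of `V^G` on the direct sum `𝓜` of the members of the family. -/
def sumMode (n : ℤ) (a : fixedPoints G) : Module.End ℂ (⨁ i, S.carrier i) :=
  DirectSum.lmap fun i => (S.str i).mode n (a : V)

end StableFamily

end

noncomputable section

open VertexAlgebra

/-! ### Formal calculus: each of the three expansions determines its element. -/

section ExpansionShift

variable {M : Type v} [AddCommGroup M] [Module ℂ M]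

/-! The theorem is a double centralizer statement for `A_α(G, S)` and `V^G` on `𝓜`. It says in
effect that `V^G` is as dense as the commuting action of the finite-dimensional semisimple algebra
`A_α(G, S)` permits.

The formal input is that an element `f (x - y)^l` is determined by any one of its three expansions.
A linear relation among products `aₘ bₙ u`, among the reversed products, or among the iterates `(aₖ
b)ₙ u` therefore implies the other two (`IsExpansionTriple.eq_zero_of`). Applied modulo the span of
single modes, this shows that products of modes agree, on finitely many vectors, with sums of single
modes. Jacobson density, together with the Schur lemma that countable dimension provides, then lets
sums of modes of `V` imitate arbitrary operators on finite subsets of the members of `S`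
(`WeakModule.exists_modeSum_eq`). Averaging over `G` turns this into a density statement for `V^G`
and operators commuting with the stabilizer algebra (`exists_fixedPoints_modeSum_eq`). Since that
algebra is semisimple, such operators move any nonzero `f : W → M` to any other one and separate
non-isomorphic `W`. This gives irreducibility and inequivalence of the multiplicity spaces.

That every `W` occurs in `M` is where simplicity of `V` enters. The relation `∑ Y(aᵢ, x) uᵢ = 0`
forces `∑ aᵢ ⊗ uᵢ = 0` (`sum_smul_eq_zero_of_sum_mode_eq_zero`), and a Dedekind-type argument shows
that distinct automorphisms are linearly independent (`linearIndependent_aut`). Together they make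
the twisted group algebra of the stabilizer act faithfully (`stabilizerAction_injective`), so all
its simple modules appear.

The rest is Clifford theory. The corner `e(x) A e(x)` is the stabilizer algebra, induction from it
yields all simple `A_α(G, S)`-modules (`isCompleteSimpleFamily_induced`), and extending each `f : W
→ M` to the induced module assembles the decomposition (`exists_equiv_directSum_tensor`). -/

theorem choose_sub_one_add (l : ℤ) (n : ℕ) :
    ((Ring.choose (l - 1) n : ℤ) : ℂ) + ((Ring.choose (l - 1) (n + 1) : ℤ) : ℂ) =
      ((Ring.choose l (n + 1) : ℤ) : ℂ) := by
  have h := Ring.choose_succ_succ (l - 1) n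
  rw [sub_add_cancel] at h
  rw [h]
  push_cast
  ring

/-- Summation by parts with Pascal's rule: a truncated form of `(1 - t)^(l-1) (1 - t) = (1 - t)^l`,
with the boundary term left by the truncation. -/
theorem sum_choose_telescope (l : ℤ) (g : ℕ → M) (n : ℕ) :
    ∑ i ∈ Finset.range (n + 1),
        ((-1 : ℂ) ^ i * ((Ring.choose (l - 1) i : ℤ) : ℂ)) • (g i - g (i + 1)) =
      ∑ i ∈ Finset.range (n + 1), ((-1 : ℂ) ^ i * ((Ring.choose l i : ℤ) : ℂ)) • g i -
        ((-1 : ℂ) ^ n * ((Ring.choose (l - 1) n : ℤ) : ℂ)) • g (n + 1) := by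
  induction n with
  | zero => simp [smul_sub]
  | succ n ih =>
    rw [Finset.sum_range_succ, ih, Finset.sum_range_succ _ (n + 1),
      ← choose_sub_one_add l n]
    module

/-- The coefficients of `f (x - y)`. -/
def mulSub {M : Type v} [AddCommGroup M] (T : ℕ) (f : ℤ → ℤ → M) : ℤ → ℤ → M :=
  fun p q => f (p - T) q - f p (q - T)

theorem mulSub_eq_zero {M : Type v} [AddCommGroup M] {T : ℕ} {f : ℤ → ℤ → M} {B : ℤ}
    (hf : ∀ p q, p < B ∨ q < B → f p q = 0) (p q : ℤ) (h : p < B ∨ q < B) :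
    mulSub T f p q = 0 := by
  rw [mulSub, hf _ _ (by omega), hf _ _ (by omega), sub_zero]

/-- As `T ≥ 1`, the exponent `Q - T i` is below `B` for every `i ≥ n`. The cutoff `n` is left free
so that several families can be summed over one range. -/
theorem iotaXY_eq_sum {T : ℕ} (hT : 0 < T) {f : ℤ → ℤ → M} {B : ℤ}
    (hf : ∀ p q, p < B ∨ q < B → f p q = 0) (l P Q : ℤ) {n : ℕ} (hn : Q - B < n) :
    iotaXY T f l P Q = ∑ i ∈ Finset.range n,
      ((-1 : ℂ) ^ i * ((Ring.choose l i : ℤ) : ℂ)) • f (P - T * (l - i)) (Q - T * i) := by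
  refine finsum_eq_sum_of_support_subset _ fun i hi => ?_
  simp only [Finset.coe_range, Set.mem_Iio]
  by_contra hlt
  refine hi ?_
  have : (i : ℤ) ≤ T * i := le_mul_of_one_le_left (by positivity) (by exact_mod_cast hT)
  simp only
  rw [hf _ _ (Or.inr (by omega)), smul_zero]

/-- This is `f (x - y)^l = (f (x - y)) (x - y)^(l-1)` on coefficients. The boundary term of the
summation by parts lies below the bound of `f`. -/
theorem iotaXY_mulSub {T : ℕ} (hT : 0 < T) {f : ℤ → ℤ → M} {B : ℤ}
    (hf : ∀ p q, p < B ∨ q < B → f p q = 0) (l P Q : ℤ) :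
    iotaXY T (mulSub T f) (l - 1) P Q = iotaXY T f l P Q := by
  obtain ⟨n, hn⟩ : ∃ n : ℕ, Q - B < n := ⟨(Q - B + 1).toNat, by omega⟩
  have h := sum_choose_telescope l (fun i : ℕ => f (P - T * (l - i)) (Q - T * i)) n
  have h1 : (n : ℤ) + 1 ≤ T * (n + 1) :=
    le_mul_of_one_le_left (by positivity) (by exact_mod_cast hT)
  have h0 : f (P - T * (l - ((n + 1 : ℕ) : ℤ))) (Q - T * ((n + 1 : ℕ) : ℤ)) = 0 :=
    hf _ _ (Or.inr (by push_cast; omega))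
  rw [iotaXY_eq_sum hT hf l P Q (n := n + 1) (by push_cast; omega),
    iotaXY_eq_sum hT (mulSub_eq_zero hf) _ P Q (n := n + 1) (by push_cast; omega)]
  simp only [h0, smul_zero, sub_zero] at h
  rw [← h]
  refine Finset.sum_congr rfl fun i _ => ?_
  rw [mulSub]
  congr 3
  · ring
  · push_cast; ring
  · push_cast; ring

theorem iotaXY_neg (T : ℕ) (f : ℤ → ℤ → M) (l P Q : ℤ) :
    iotaXY T (fun p q => -f p q) l P Q = -iotaXY T f l P Q := by
  simp only [iotaXY, smul_neg]
  exact finsum_neg_distrib _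

/-- Exchanging the variables multiplies `(x - y)^l` by `(-1)^l`, so facts about the domain `|y| >
|x|` follow from those about `|x| > |y|`. -/
theorem iotaYX_eq (T : ℕ) (f : ℤ → ℤ → M) (l P Q : ℤ) :
    iotaYX T f l P Q = (-1 : ℂ) ^ l • iotaXY T (fun p q => f q p) l Q P := by
  rw [iotaXY, smul_finsum, iotaYX]
  refine finsum_congr fun i => ?_
  rw [smul_smul, ← mul_assoc, zpow_sub₀ (by norm_num), zpow_natCast, div_eq_mul_inv, ← inv_pow]
  norm_num

theorem iotaYX_mulSub {T : ℕ} (hT : 0 < T) {f : ℤ → ℤ → M} {B : ℤ}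
    (hf : ∀ p q, p < B ∨ q < B → f p q = 0) (l P Q : ℤ) :
    iotaYX T (mulSub T f) (l - 1) P Q = iotaYX T f l P Q := by
  have h := iotaXY_mulSub hT (f := fun p q => f q p) (fun p q h => hf q p h.symm) l Q P
  have e : (fun p q => mulSub T f q p) = fun p q => -mulSub T (fun p q => f q p) p q := by
    funext p q
    simp [mulSub]
  rw [iotaYX_eq, iotaYX_eq, e, iotaXY_neg, h, zpow_sub_one₀ (by norm_num)]
  norm_num

theorem finite_support_antidiagonal {f : ℤ → ℤ → M} {B : ℤ}
    (hf : ∀ p q, p < B ∨ q < B → f p q = 0) (c : ℤ → ℂ) (s : ℤ) :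
    (Function.support fun p => c p • f p (s - p)).Finite := by
  refine (Set.finite_Icc B (s - B)).subset fun p hp => ?_
  rw [Set.mem_Icc]
  by_contra hlt
  refine hp ?_
  simp only
  rw [hf _ _ (by omega), smul_zero]

/-- Multiplication by `x` raises `p/T` by one, so the difference of the `x`- and `y`-multiples has
coefficients `choose (p/T + 1) (m + 1) - choose (p/T) (m + 1)`. Pascal's rule makes this `choose
(p/T) m`. -/
theorem iotaYXsubY_mulSub {T : ℕ} (hT : 0 < T) {f : ℤ → ℤ → M} {B : ℤ}
    (hf : ∀ p q, p < B ∨ q < B → f p q = 0) (l Q R : ℤ) :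
    iotaYXsubY T (mulSub T f) (l - 1) Q R = iotaYXsubY T f l Q R := by
  have hT' : (T : ℂ) ≠ 0 := by exact_mod_cast hT.ne'
  have key : ∀ (m : ℕ) (s : ℤ), ∑ᶠ p : ℤ, Ring.choose ((p : ℂ) / T) m •
      mulSub T f p (s + T - p) = ∑ᶠ p : ℤ, (Ring.choose ((p : ℂ) / T + 1) m -
        Ring.choose ((p : ℂ) / T) m) • f p (s - p) := by
    intro m s
    have h1 : ∑ᶠ p : ℤ, Ring.choose ((p : ℂ) / T) m • f (p - T) (s + T - p) =
        ∑ᶠ p : ℤ, Ring.choose ((p : ℂ) / T + 1) m • f p (s - p) := by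
      rw [← finsum_comp_equiv (Equiv.addRight (T : ℤ))]
      refine finsum_congr fun p => ?_
      simp only [Equiv.coe_addRight]
      congr 2
      · push_cast
        rw [add_div, div_self hT']
      · ring
      · ring
    have h2 : ∀ p : ℤ, Ring.choose ((p : ℂ) / T) m • mulSub T f p (s + T - p) =
        Ring.choose ((p : ℂ) / T) m • f (p - T) (s + T - p) -
          Ring.choose ((p : ℂ) / T) m • f p (s - p) := by
      intro p
      rw [mulSub, smul_sub, show s + T - p - T = s - p by ring]
    simp only [h2]
    rw [finsum_sub_distrib, h1, ← finsum_sub_distrib]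
    · exact finsum_congr fun p => (sub_smul _ _ _).symm
    · exact finite_support_antidiagonal hf (fun p => Ring.choose ((p : ℂ) / T + 1) m) s
    · exact finite_support_antidiagonal hf (fun p => Ring.choose ((p : ℂ) / T) m) s
    · refine (Set.finite_Icc (B + T) (s + T - B)).subset fun p hp => ?_
      rw [Set.mem_Icc]
      by_contra hlt
      refine hp ?_
      simp only
      rw [hf _ _ (by omega), smul_zero]
    · exact finite_support_antidiagonal hf (fun p => Ring.choose ((p : ℂ) / T) m) s
  have key' : ∀ p : ℤ, Q + T * (R - (l - 1)) - p = Q + T * (R - l) + T - p := fun p => by ring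
  unfold iotaYXsubY
  simp only [key', key]
  by_cases h : l ≤ R
  · rw [if_pos (by omega), if_pos h]
    refine finsum_congr fun p => ?_
    rw [show (R - (l - 1)).toNat = (R - l).toNat + 1 by omega, Ring.choose_succ_succ,
      add_sub_cancel_right]
  · rw [if_neg h]
    -- Only `R = l - 1` remains. There the binomial index is `0`, and the difference of the two
    -- binomials vanishes.
    split_ifs with h'
    · rw [show (R - (l - 1)).toNat = 0 by omega]
      simp
    · rfl

/-- The expansion is unitriangular in the exponent of `y`, which is bounded below, so `f` is
recovered by induction on that exponent. -/
theorem eq_zero_of_iotaXY_eq_zero {T : ℕ} (hT : 0 < T) {f : ℤ → ℤ → M} {B : ℤ}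
    (hf : ∀ p q, p < B ∨ q < B → f p q = 0) (l : ℤ) (h : ∀ P Q, iotaXY T f l P Q = 0) :
    f = 0 := by
  have key : ∀ (n : ℕ) (p q : ℤ), q < B + n → f p q = 0 := by
    intro n
    induction n with
    | zero => exact fun p q hq => hf p q (Or.inr (by simpa using hq))
    | succ n ih =>
      intro p q hq
      -- With this `P` the term `i = 0` is `f p q`. The other terms have second index at most `q -
      -- 1` and vanish by induction.
      have h1 := h (p + T * l) q
      rw [iotaXY_eq_sum hT hf l _ q (n := n + 1) (by push_cast at hq ⊢; omega),
        Finset.sum_range_succ'] at h1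
      rw [Finset.sum_eq_zero] at h1
      · simpa using h1
      · intro i _
        have : (i : ℤ) + 1 ≤ T * (i + 1) :=
          le_mul_of_one_le_left (by positivity) (by exact_mod_cast hT)
        rw [ih _ _ (by push_cast at hq ⊢; omega), smul_zero]
  funext p q
  exact key (q - B + 1).toNat p q (by omega)

theorem eq_zero_of_iotaYX_eq_zero {T : ℕ} (hT : 0 < T) {f : ℤ → ℤ → M} {B : ℤ}
    (hf : ∀ p q, p < B ∨ q < B → f p q = 0) (l : ℤ) (h : ∀ P Q, iotaYX T f l P Q = 0) :
    f = 0 := by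
  have h' := eq_zero_of_iotaXY_eq_zero hT (f := fun p q => f q p)
    (fun p q h => hf q p h.symm) l fun P Q => by
      have := h Q P
      rw [iotaYX_eq, smul_eq_zero] at this
      exact this.resolve_left (zpow_ne_zero _ (by norm_num))
  funext p q
  exact congrFun (congrFun h' q) p

/-- Multiplication by `z` in the binomial basis. It converts vanishing binomial moments into
vanishing moments against all polynomials. -/
theorem mul_choose (z : ℂ) (n : ℕ) :
    z * Ring.choose z n = (n + 1) * Ring.choose z (n + 1) + n * Ring.choose z n := by
  have h1 := Ring.descPochhammer_eq_factorial_smul_choose z (n + 1)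
  have h0 := Ring.descPochhammer_eq_factorial_smul_choose z n
  rw [descPochhammer_succ_right, Polynomial.smeval_mul, h0, Polynomial.smeval_sub,
    Polynomial.smeval_X, Polynomial.smeval_natCast, Nat.factorial_succ] at h1
  have hn : (n.factorial : ℂ) ≠ 0 := by exact_mod_cast n.factorial_ne_zero
  apply mul_left_cancel₀ hn
  simp only [nsmul_eq_mul, pow_one, pow_zero, mul_one] at h1
  push_cast at h1
  linear_combination h1

open Polynomial in
/-- A vector-valued function on a finite set of points is zero if all its binomial moments are. -/
theorem eq_zero_of_sum_choose_smul {ι : Type*} (s : Finset ι) (z : ι → ℂ)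
    (hz : Set.InjOn z s) (g : ι → M)
    (h : ∀ n : ℕ, ∑ i ∈ s, Ring.choose (z i) n • g i = 0) : ∀ i ∈ s, g i = 0 := by
  classical
  -- All `n` are treated at once because a factor `z` raises the binomial index by one.
  have key : ∀ (P : ℂ[X]) (n : ℕ),
      ∑ i ∈ s, (P.eval (z i) * Ring.choose (z i) n) • g i = 0 := by
    intro P
    induction P using Polynomial.induction_on' with
    | add P P' h1 h2 =>
      intro n
      simp only [eval_add, add_mul, add_smul, Finset.sum_add_distrib, h1, h2, add_zero]
    | monomial k c =>
      induction k with
      | zero =>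
        intro n
        simp only [eval_monomial, pow_zero, mul_one, mul_smul, ← Finset.smul_sum, h, smul_zero]
      | succ k ih =>
        intro n
        have e : ∀ i, ((monomial (k + 1) c).eval (z i) * Ring.choose (z i) n) • g i =
            ((n : ℂ) + 1) • ((monomial k c).eval (z i) * Ring.choose (z i) (n + 1)) • g i +
              (n : ℂ) • ((monomial k c).eval (z i) * Ring.choose (z i) n) • g i := by
          intro i
          rw [smul_smul, smul_smul, ← add_smul]
          congr 1
          simp only [eval_monomial]
          linear_combination c * z i ^ k * mul_choose (z i) n
        simp only [e, Finset.sum_add_distrib, ← Finset.smul_sum, ih, smul_zero, add_zero]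
  intro i hi
  -- A Lagrange polynomial: it vanishes at every node except `z i`.
  have h1 := key (∏ j ∈ s.erase i, (X - C (z j))) 0
  simp only [Ring.choose_zero_right, mul_one, eval_prod, eval_sub, eval_X, eval_C] at h1
  rw [Finset.sum_eq_single_of_mem i hi] at h1
  · refine (smul_eq_zero.mp h1).resolve_left (Finset.prod_ne_zero_iff.mpr fun j hj => ?_)
    rw [Finset.mem_erase] at hj
    exact sub_ne_zero.mpr fun e => hj.1 (hz hj.2 hi e.symm)
  · intro j hj hji
    rw [Finset.prod_eq_zero (Finset.mem_erase.mpr ⟨hji, hj⟩) (sub_self _), zero_smul]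

/-- For a fixed total exponent, the coefficients of `(x - y)^(l+n)` are the binomial moments of the
finite sequence `f r (p + q - r)` at the distinct nodes `r/T`. -/
theorem eq_zero_of_iotaYXsubY_eq_zero {T : ℕ} (hT : 0 < T) {f : ℤ → ℤ → M} {B : ℤ}
    (hf : ∀ p q, p < B ∨ q < B → f p q = 0) (l : ℤ) (h : ∀ Q R, iotaYXsubY T f l Q R = 0) :
    f = 0 := by
  have hT' : (T : ℂ) ≠ 0 := by exact_mod_cast hT.ne'
  funext p q
  by_cases hpq : p < B ∨ q < B
  · exact hf p q hpq
  have key := eq_zero_of_sum_choose_smul (Finset.Icc B (p + q - B)) (fun p : ℤ => (p : ℂ) / T)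
    (fun a _ b _ hab => by simpa [div_left_inj' hT'] using hab)
    (fun r => f r (p + q - r)) (fun n => by
      -- The shift by `T n` keeps the total exponent equal to `p + q` for every `n`.
      have h1 := h (p + q - T * n) (l + n)
      rw [iotaYXsubY, if_pos (by omega), show l + n - l = (n : ℤ) by ring, Int.toNat_natCast,
        sub_add_cancel] at h1
      rw [← h1]
      refine (finsum_eq_sum_of_support_subset _ fun r hr => ?_).symm
      simp only [Finset.coe_Icc, Set.mem_Icc]
      by_contra hlt
      refine hr ?_
      simp only
      rw [hf _ _ (by omega), smul_zero]) p (Finset.mem_Icc.mpr (by omega))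
  simpa using key

end ExpansionShift

/-! ### Duality for linear combinations. -/

section ExpansionTriple

variable {E : Type v} [AddCommGroup E] [Module ℂ E] {F : Type w} [AddCommGroup F] [Module ℂ F]

/-- The families `A`, `B`, `C` are the coefficients of the three expansions of one element
`f (x - y)^l`, indexed as in the duality axiom of weak modules. -/
def IsExpansionTriple (T : ℕ) (A B C : ℤ → ℤ → E) : Prop :=
  ∃ (f : ℤ → ℤ → E) (l : ℤ), (∃ N : ℤ, ∀ p q, p < N ∨ q < N → f p q = 0) ∧
    (∀ m n : ℤ, iotaXY T f l (-m - T) (-n - T) = A m n) ∧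
    (∀ m n : ℤ, iotaYX T f l (-m - T) (-n - T) = B m n) ∧
    (∀ k n : ℤ, iotaYXsubY T f l (-n - T) (-k - 1) = C k n)

namespace IsExpansionTriple

variable {T : ℕ} {A B C A' B' C' : ℤ → ℤ → E}

theorem map (hT : 0 < T) (h : IsExpansionTriple T A B C) (π : E →ₗ[ℂ] F) :
    IsExpansionTriple T (fun m n => π (A m n)) (fun m n => π (B m n))
      (fun m n => π (C m n)) := by
  obtain ⟨f, l, ⟨N, hN⟩, h1, h2, h3⟩ := h
  refine ⟨fun p q => π (f p q), l, ⟨N, fun p q h => by simp [hN p q h]⟩,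
    fun m n => ?_, fun m n => ?_, fun m n => ?_⟩
  · rw [map_iotaXY hT π hN, h1]
  · rw [map_iotaYX hT π hN, h2]
  · rw [map_iotaYXsubY π hN, h3]

theorem zero : IsExpansionTriple T (fun _ _ => (0 : E)) (fun _ _ => 0) (fun _ _ => 0) :=
  ⟨fun _ _ => 0, 0, ⟨0, fun _ _ _ => rfl⟩, fun _ _ => by simp [iotaXY],
    fun _ _ => by simp [iotaYX], fun _ _ => by simp [iotaYXsubY]⟩

/-- The exponent of `x - y` can be lowered by any amount. -/
theorem exists_of_lower (hT : 0 < T) (h : IsExpansionTriple T A B C) :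
    ∃ l : ℤ, ∀ k : ℕ, ∃ f : ℤ → ℤ → E, (∃ N : ℤ, ∀ p q, p < N ∨ q < N → f p q = 0) ∧
      (∀ m n : ℤ, iotaXY T f (l - k) (-m - T) (-n - T) = A m n) ∧
      (∀ m n : ℤ, iotaYX T f (l - k) (-m - T) (-n - T) = B m n) ∧
      (∀ j n : ℤ, iotaYXsubY T f (l - k) (-n - T) (-j - 1) = C j n) := by
  obtain ⟨f, l, hN, h1, h2, h3⟩ := h
  refine ⟨l, fun k => ?_⟩
  induction k with
  | zero => exact ⟨f, hN, by simpa using h1, by simpa using h2, by simpa using h3⟩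
  | succ k ih =>
    obtain ⟨g, ⟨N, hg⟩, h1, h2, h3⟩ := ih
    refine ⟨mulSub T g, ⟨N, mulSub_eq_zero hg⟩, fun m n => ?_, fun m n => ?_, fun m n => ?_⟩
    · rw [← h1, ← iotaXY_mulSub hT hg, Nat.cast_succ, sub_sub]
    · rw [← h2, ← iotaYX_mulSub hT hg, Nat.cast_succ, sub_sub]
    · rw [← h3, ← iotaYXsubY_mulSub hT hg, Nat.cast_succ, sub_sub]

theorem iotaXY_add (hT : 0 < T) {f g : ℤ → ℤ → E} {N : ℤ}
    (hf : ∀ p q, p < N ∨ q < N → f p q = 0) (hg : ∀ p q, p < N ∨ q < N → g p q = 0)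
    (l P Q : ℤ) :
    iotaXY T (fun p q => f p q + g p q) l P Q = iotaXY T f l P Q + iotaXY T g l P Q := by
  obtain ⟨n, hn⟩ : ∃ n : ℕ, Q - N < n := ⟨(Q - N + 1).toNat, by omega⟩
  rw [iotaXY_eq_sum hT hf l P Q hn, iotaXY_eq_sum hT hg l P Q hn,
    iotaXY_eq_sum hT (B := N) (fun p q h => by rw [hf p q h, hg p q h, add_zero]) l P Q hn,
    ← Finset.sum_add_distrib]
  exact Finset.sum_congr rfl fun i _ => smul_add _ _ _

theorem iotaYXsubY_add {f g : ℤ → ℤ → E} {N : ℤ}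
    (hf : ∀ p q, p < N ∨ q < N → f p q = 0) (hg : ∀ p q, p < N ∨ q < N → g p q = 0)
    (l Q R : ℤ) :
    iotaYXsubY T (fun p q => f p q + g p q) l Q R =
      iotaYXsubY T f l Q R + iotaYXsubY T g l Q R := by
  unfold iotaYXsubY
  split_ifs
  · rw [← finsum_add_distrib (finite_support_antidiagonal hf _ _)
      (finite_support_antidiagonal hg _ _)]
    exact finsum_congr fun p => smul_add _ _ _
  · rw [add_zero]

/-- The powers of `x - y` in the two elements may differ. Both are lowered to a common one, and then
the coefficients `f` and `g` add. -/
theorem add (hT : 0 < T) (h : IsExpansionTriple T A B C) (h' : IsExpansionTriple T A' B' C') :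
    IsExpansionTriple T (fun m n => A m n + A' m n) (fun m n => B m n + B' m n)
      (fun m n => C m n + C' m n) := by
  obtain ⟨l, hl⟩ := h.exists_of_lower hT
  obtain ⟨l', hl'⟩ := h'.exists_of_lower hT
  obtain ⟨k, k', hk⟩ : ∃ k k' : ℕ, l - k = l' - k' :=
    ⟨(l - l').toNat, (l' - l).toNat, by omega⟩
  obtain ⟨f, ⟨N, hf⟩, h1, h2, h3⟩ := hl k
  obtain ⟨g, ⟨N', hg⟩, h1', h2', h3'⟩ := hl' k'
  rw [← hk] at h1' h2' h3'
  have hf' : ∀ p q, p < min N N' ∨ q < min N N' → f p q = 0 := fun p q h => hf p q (by omega)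
  have hg' : ∀ p q, p < min N N' ∨ q < min N N' → g p q = 0 := fun p q h => hg p q (by omega)
  refine ⟨fun p q => f p q + g p q, l - k,
    ⟨min N N', fun p q h => by simp [hf' p q h, hg' p q h]⟩,
    fun m n => ?_, fun m n => ?_, fun m n => ?_⟩
  · rw [iotaXY_add hT hf' hg', h1, h1']
  · rw [iotaYX_eq, iotaXY_add hT (fun p q h => hf' q p h.symm) (fun p q h => hg' q p h.symm),
      smul_add, ← iotaYX_eq, ← iotaYX_eq, h2, h2']
  · rw [iotaYXsubY_add hf' hg', h3, h3']

theorem sum (hT : 0 < T) {ι : Type*} (s : Finset ι) {A B C : ι → ℤ → ℤ → E}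
    (h : ∀ i ∈ s, IsExpansionTriple T (A i) (B i) (C i)) :
    IsExpansionTriple T (fun m n => ∑ i ∈ s, A i m n) (fun m n => ∑ i ∈ s, B i m n)
      (fun m n => ∑ i ∈ s, C i m n) := by
  classical
  induction s using Finset.induction_on with
  | empty => simpa using zero
  | insert i s hi ih =>
    simp only [Finset.sum_insert hi]
    exact (h i (Finset.mem_insert_self i s)).add hT
      (ih fun j hj => h j (Finset.mem_insert_of_mem hj))

/-- If one of the three expansions vanishes, so do the others. -/
theorem eq_zero_of (hT : 0 < T) (h : IsExpansionTriple T A B C)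
    (h0 : (∀ m n, A m n = 0) ∨ (∀ m n, B m n = 0) ∨ (∀ m n, C m n = 0)) (m n : ℤ) :
    A m n = 0 ∧ B m n = 0 ∧ C m n = 0 := by
  obtain ⟨f, l, ⟨N, hN⟩, h1, h2, h3⟩ := h
  -- Each expansion is injective, so any single one detects `f`.
  have hf : f = 0 := by
    rcases h0 with h0 | h0 | h0
    · refine eq_zero_of_iotaXY_eq_zero hT hN l fun P Q => ?_
      have := h1 (-P - T) (-Q - T)
      rwa [h0, show -(-P - T) - T = P by ring, show -(-Q - T) - T = Q by ring] at this
    · refine eq_zero_of_iotaYX_eq_zero hT hN l fun P Q => ?_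
      have := h2 (-P - T) (-Q - T)
      rwa [h0, show -(-P - T) - T = P by ring, show -(-Q - T) - T = Q by ring] at this
    · refine eq_zero_of_iotaYXsubY_eq_zero hT hN l fun Q R => ?_
      have := h3 (-R - 1) (-Q - T)
      rwa [h0, show -(-Q - T) - T = Q by ring, show -(-R - 1) - 1 = R by ring] at this
  subst hf
  refine ⟨?_, ?_, ?_⟩
  · simp [← h1, iotaXY]
  · simp [← h2, iotaYX]
  · simp [← h3, iotaYXsubY]

end IsExpansionTriple

end ExpansionTriple

namespace WeakModule

variable {V : Type u} [AddCommGroup V] [Module ℂ V] [VertexAlgebra V] {T : ℕ}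
  {E : Type w} [AddCommGroup E] [Module ℂ E]

/-- Duality for finitely many vectors in several modules at once, after applying linear maps. -/
theorem isExpansionTriple_sum (hT : 0 < T) {κ : Type*} (s : Finset κ) {M : κ → Type v}
    [∀ i, AddCommGroup (M i)] [∀ i, Module ℂ (M i)] (Y : ∀ i, WeakModule V T (M i))
    (a b : κ → V) (x : ∀ i, M i) (ξ : ∀ i, M i →ₗ[ℂ] E) :
    IsExpansionTriple T (fun m n => ∑ i ∈ s, ξ i ((Y i).mode m (a i) ((Y i).mode n (b i) (x i))))
      (fun m n => ∑ i ∈ s, ξ i ((Y i).mode n (b i) ((Y i).mode m (a i) (x i))))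
      (fun k n => ∑ i ∈ s, ξ i ((Y i).mode n (VertexAlgebra.mode k (a i) (b i)) (x i))) :=
  IsExpansionTriple.sum hT s (A := fun i m n => ξ i ((Y i).mode m (a i) ((Y i).mode n (b i) (x i))))
    (B := fun i m n => ξ i ((Y i).mode n (b i) ((Y i).mode m (a i) (x i))))
    (C := fun i k n => ξ i ((Y i).mode n (VertexAlgebra.mode k (a i) (b i)) (x i))) fun i _ =>
      IsExpansionTriple.map hT ((Y i).duality (a i) (b i) (x i)) (ξ i)

end WeakModule

/-! ### Jacobson density for direct sums of inequivalent simple modules. -/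

section Density

variable {R : Type*} [Ring R] {ι : Type*} {W : ι → Type*}
  [∀ i, AddCommGroup (W i)] [∀ i, Module ℂ (W i)] [∀ i, Module R (W i)]

/-- The Jacobson density theorem for a direct sum of pairwise non-isomorphic simple modules with
scalar endomorphism rings. -/
theorem exists_smul_eq_of_simple (hs : ∀ i, IsSimpleModule R (W i))
    (hiso : ∀ i j, Nonempty (W i ≃ₗ[R] W j) → i = j)
    (hschur : ∀ i (f : W i →ₗ[R] W i), ∃ c : ℂ, ∀ x, f x = c • x)
    (E : ∀ i, W i →ₗ[ℂ] W i) (s : Finset (⨁ i, W i)) :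
    ∃ r : R, ∀ z ∈ s, ∀ i, r • z i = E i (z i) := by
  classical
  have := hs
  have : IsSemisimpleModule R (⨁ i, W i) := inferInstanceAs (IsSemisimpleModule R (Π₀ i, W i))
  -- By Schur's lemma the off-diagonal blocks of an endomorphism vanish and the diagonal ones are
  -- scalars.
  have hsingle : ∀ (g : (⨁ i, W i) →ₗ[R] ⨁ i, W i) (i : ι), ∃ c : ℂ, ∀ x : W i,
      g (DirectSum.lof R ι W i x) = c • DirectSum.lof R ι W i x := by
    intro g i
    obtain ⟨c, hc⟩ := hschur i (DirectSum.component R ι W i ∘ₗ g ∘ₗ DirectSum.lof R ι W i)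
    refine ⟨c, fun x => ?_⟩
    refine DFinsupp.ext fun j => ?_
    by_cases hij : i = j
    · subst hij
      refine (hc x).trans ?_
      change _ = c • (DirectSum.of W i x) i
      rw [DirectSum.of_eq_same]
    · have h0 : DirectSum.component R ι W j ∘ₗ g ∘ₗ DirectSum.lof R ι W i = 0 := by
        by_contra hne
        exact hij (hiso i j ⟨LinearEquiv.ofBijective _ (LinearMap.bijective_of_ne_zero hne)⟩)
      refine (LinearMap.congr_fun h0 x).trans ?_
      change _ = c • (DirectSum.of W i x) j
      rw [DirectSum.of_eq_of_ne _ _ _ (Ne.symm hij), smul_zero]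
      rfl
  have hcomm : ∀ (g : (⨁ i, W i) →ₗ[R] ⨁ i, W i) (z : ⨁ i, W i),
      DirectSum.lmap E (g z) = g (DirectSum.lmap E z) := by
    intro g z
    induction z using DirectSum.induction_on with
    | zero => simp
    | add x y hx hy => simp [hx, hy]
    | of i x =>
      obtain ⟨c, hc⟩ := hsingle g i
      have e : ∀ y : W i, DirectSum.of W i y = DirectSum.lof R ι W i y := fun _ => rfl
      have e' : ∀ y : W i, DirectSum.lof R ι W i y = DirectSum.lof ℂ ι W i y := fun _ => rfl
      rw [e, hc, map_smul, e', DirectSum.lmap_lof, ← e', hc]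
  -- Commuting with all `R`-endomorphisms, the blockwise operator `E` lies in the bicommutant, to
  -- which Jacobson's theorem applies.
  let D : Module.End (Module.End R (⨁ i, W i)) (⨁ i, W i) :=
    { toFun := DirectSum.lmap E
      map_add' := map_add _
      map_smul' := fun g z => hcomm g z }
  obtain ⟨r, hr⟩ := jacobson_density D s
  refine ⟨r, fun z hz i => ?_⟩
  have h := congrArg (fun y : ⨁ i, W i => y i) (hr z hz)
  exact h.symm

/-- The density theorem for finite subsets of the summands. -/
theorem exists_smul_eq_of_simple_of_finite [Finite ι] (hs : ∀ i, IsSimpleModule R (W i))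
    (hiso : ∀ i j, Nonempty (W i ≃ₗ[R] W j) → i = j)
    (hschur : ∀ i (f : W i →ₗ[R] W i), ∃ c : ℂ, ∀ x, f x = c • x)
    (E : ∀ i, W i →ₗ[ℂ] W i) (s : ∀ i, Set (W i)) (hfin : ∀ i, (s i).Finite) :
    ∃ r : R, ∀ i, ∀ x ∈ s i, r • x = E i x := by
  classical
  have hf : (⋃ i, DirectSum.of W i '' s i).Finite :=
    Set.finite_iUnion fun i => (hfin i).image _
  obtain ⟨r, hr⟩ := exists_smul_eq_of_simple hs hiso hschur E hf.toFinset
  refine ⟨r, fun i x hx => ?_⟩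
  have h := hr (DirectSum.of W i x)
    (hf.mem_toFinset.mpr (Set.mem_iUnion.mpr ⟨i, Set.mem_image_of_mem _ hx⟩)) i
  rwa [DirectSum.of_eq_same] at h

end Density

/-! ### Density for irreducible weak modules by sums of single modes. -/

namespace WeakModule

variable {V : Type u} [AddCommGroup V] [Module ℂ V] [VertexAlgebra V] {T : ℕ}
  {M : Type v} [AddCommGroup M] [Module ℂ M] {N : Type w} [AddCommGroup N] [Module ℂ N]

/-- The operator `∑ₙ (D n)_{n/T}` for a finitely supported family `D`. -/
def modeSum (Y : WeakModule V T M) : (ℤ →₀ V) →ₗ[ℂ] M →ₗ[ℂ] M :=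
  Finsupp.lsum ℂ Y.mode

@[simp]
theorem modeSum_single (Y : WeakModule V T M) (n : ℤ) (a : V) :
    Y.modeSum (Finsupp.single n a) = Y.mode n a := by
  simp [modeSum]

theorem modeSum_mem_of_isSubmodule {Y : WeakModule V T M} {N : Submodule ℂ M}
    (hN : Y.IsSubmodule N) (D : ℤ →₀ V) {u : M} (hu : u ∈ N) : Y.modeSum D u ∈ N := by
  induction D using Finsupp.induction_linear with
  | zero => simp
  | add D D' h h' => rw [map_add]; exact N.add_mem h h'
  | single n a => rw [modeSum_single]; exact hN n a u hu

theorem map_modeSum {Y : WeakModule V T M} {Z : WeakModule V T N} (f : M →ₗ[ℂ] N)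
    (hf : ∀ (n : ℤ) (a : V) (u : M), f (Y.mode n a u) = Z.mode n a (f u)) (D : ℤ →₀ V) (u : M) :
    f (Y.modeSum D u) = Z.modeSum D (f u) := by
  induction D using Finsupp.induction_linear with
  | zero => simp
  | add D D' h h' => simp [h, h']
  | single n a => simp [hf]

section Family

variable {κ : Type*} {L : κ → Type v} [∀ i, AddCommGroup (L i)] [∀ i, Module ℂ (L i)]
  (Y : ∀ i, WeakModule V T (L i))

/-- The simultaneous action of the operators `modeSum` on a family of vectors. -/
def modeSumPi (x : ∀ i, L i) : (ℤ →₀ V) →ₗ[ℂ] ∀ i, L i :=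
  LinearMap.pi fun i => (Y i).modeSum.flip (x i)

@[simp]
theorem modeSumPi_apply (x : ∀ i, L i) (D : ℤ →₀ V) (i : κ) :
    modeSumPi Y x D i = (Y i).modeSum D (x i) := rfl

variable [Finite κ]

/-- On finitely many vectors, `aₘ bₙ` agrees with a linear combination of the `(aₖ b)ᵣ`. -/
theorem mode_mode_mem_range (hT : 0 < T) (x : ∀ i, L i) (m n : ℤ) (a b : V) :
    (fun i => (Y i).mode m a ((Y i).mode n b (x i))) ∈ LinearMap.range (modeSumPi Y x) := by
  classical
  have := Fintype.ofFinite κ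
  let Z := LinearMap.range (modeSumPi Y x)
  have hsum : ∀ y : ∀ i, L i, ∑ i, (Z.mkQ ∘ₗ LinearMap.single ℂ L i) (y i) = Z.mkQ y := by
    intro y
    simp only [LinearMap.comp_apply, ← map_sum]
    congr 1
    exact Finset.univ_sum_single y
  -- Modulo the range `Z` all iterates `(aₖ b)ᵣ` vanish on the tuple `x`; hence so do all products
  -- `aₘ bₙ`.
  have h := (isExpansionTriple_sum hT Finset.univ Y (fun _ => a) (fun _ => b) x
    (fun i => Z.mkQ ∘ₗ LinearMap.single ℂ L i)).eq_zero_of hT (Or.inr (Or.inr fun k r => by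
      rw [hsum (fun i => (Y i).mode r (VertexAlgebra.mode k a b) (x i)), Submodule.mkQ_apply,
        Submodule.Quotient.mk_eq_zero]
      exact ⟨Finsupp.single r (VertexAlgebra.mode k a b), by ext i; simp⟩)) m n
  have h1 := h.1
  rwa [hsum (fun i => (Y i).mode m a ((Y i).mode n b (x i))), Submodule.mkQ_apply,
    Submodule.Quotient.mk_eq_zero] at h1

theorem modeSum_modeSum_mem_range (hT : 0 < T) (x : ∀ i, L i) (D D' : ℤ →₀ V) :
    (fun i => (Y i).modeSum D ((Y i).modeSum D' (x i))) ∈ LinearMap.range (modeSumPi Y x) := by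
  induction D using Finsupp.induction_linear with
  | zero => exact ⟨0, by ext i; simp⟩
  | add D₁ D₂ h h' =>
    convert Submodule.add_mem _ h h' using 1
    ext i
    simp
  | single m a =>
    induction D' using Finsupp.induction_linear with
    | zero => exact ⟨0, by ext i; simp⟩
    | add D₁ D₂ h h' =>
      convert Submodule.add_mem _ h h' using 1
      ext i
      simp
    | single n b => simpa using mode_mode_mem_range Y hT x m n a b

/-- The free algebra on all modes acts on every weak module. -/
def freeAction (Z : WeakModule V T M) : FreeAlgebra ℂ (ℤ × V) →ₐ[ℂ] Module.End ℂ M :=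
  FreeAlgebra.lift ℂ fun p => Z.mode p.1 p.2

/-- Words in the modes collapse to sums of single modes, so density for the free algebra becomes
density for `V` itself. The tuple `x` must vary in the induction, since in a product the right
factor moves it first. -/
theorem freeAction_mem_range (hT : 0 < T) (r : FreeAlgebra ℂ (ℤ × V)) (x : ∀ i, L i) :
    (fun i => (Y i).freeAction r (x i)) ∈ LinearMap.range (modeSumPi Y x) := by
  induction r using FreeAlgebra.induction generalizing x with
  | grade0 c =>
    -- In units of `1/T`, the index `-T` is the mode `-1`, in which the vacuum acts as the identity.
    refine ⟨Finsupp.single (-(T : ℤ)) (c • vacuum), ?_⟩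
    ext i
    simp [(Y i).vacuum_mode, Module.algebraMap_end_apply]
  | grade1 p =>
    refine ⟨Finsupp.single p.1 p.2, ?_⟩
    ext i
    simp [freeAction]
  | add r r' h h' =>
    convert Submodule.add_mem _ (h x) (h' x) using 1
    ext i
    simp
  | mul r r' h h' =>
    obtain ⟨D', hD'⟩ := h' x
    obtain ⟨D, hD⟩ := h (fun i => (Y i).freeAction r' (x i))
    simp only [map_mul, Module.End.mul_apply]
    rw [← hD]
    have h1 := modeSum_modeSum_mem_range Y hT x D D'
    convert h1 using 1
    ext i
    rw [modeSumPi_apply, ← congrFun hD' i]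
    rfl

/-- Density for a finite family of pairwise inequivalent irreducible weak modules: arbitrary
linear operators on the members agree on finite sets with a linear combination of modes. -/
theorem exists_modeSum_eq (hT : 0 < T) (hV : Module.rank ℂ V ≤ Cardinal.aleph0)
    (hirr : ∀ i, (Y i).IsIrreducible) (hineq : ∀ i j, (Y i).Iso (Y j) → i = j)
    (E : ∀ i, L i →ₗ[ℂ] L i) (s : ∀ i, Set (L i)) (hs : ∀ i, (s i).Finite) :
    ∃ D : ℤ →₀ V, ∀ i, ∀ u ∈ s i, (Y i).modeSum D u = E i u := by
  classical
  let : ∀ i, Module (FreeAlgebra ℂ (ℤ × V)) (L i) := fun i =>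
    Module.compHom (L i) (Y i).freeAction.toRingHom
  have hsmul : ∀ i (r : FreeAlgebra ℂ (ℤ × V)) (u : L i), r • u = (Y i).freeAction r u :=
    fun _ _ _ => rfl
  have hmode : ∀ i n a (u : L i), (Y i).mode n a u = FreeAlgebra.ι ℂ (n, a) • u := by
    intro i n a u
    simp [hsmul, freeAction]
  have : ∀ i, IsScalarTower ℂ (FreeAlgebra ℂ (ℤ × V)) (L i) := fun i =>
    ⟨fun c r u => by simp [hsmul]⟩
  have hsimple : ∀ i, IsSimpleModule (FreeAlgebra ℂ (ℤ × V)) (L i) := by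
    intro i
    obtain ⟨hnt, hi⟩ := hirr i
    refine { exists_pair_ne := ⟨⊥, ⊤, bot_ne_top⟩, eq_bot_or_eq_top := fun N => ?_ }
    have h := hi (N.restrictScalars ℂ) fun n a u hu => by
      rw [hmode]
      exact N.smul_mem _ hu
    simpa using h
  obtain ⟨r, hr⟩ := exists_smul_eq_of_simple_of_finite (R := FreeAlgebra ℂ (ℤ × V)) hsimple
    (fun i j ⟨e⟩ => hineq i j ⟨e.restrictScalars ℂ, fun n a u => by
      rw [hmode, hmode]
      exact e.map_smul _ _⟩)
    (fun i f => (Y i).schur hV (hirr i) (f.restrictScalars ℂ) fun n a u => by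
      rw [hmode, hmode]
      exact f.map_smul _ _) E s hs
  have : ∀ i, Finite (s i) := fun i => (hs i).to_subtype
  -- One copy of the module is taken for each vector, so that a single `D` serves all of them.
  obtain ⟨D, hD⟩ := freeAction_mem_range (κ := Σ i, s i) (fun p => Y p.1) hT r (fun p => p.2)
  refine ⟨D, fun i u hu => ?_⟩
  rw [← hr i u hu]
  exact congrFun hD ⟨i, u, hu⟩

end Family

end WeakModule

/-! ### Nondegeneracy and linear independence of automorphisms. -/

namespace WeakModule

variable {V : Type u} [AddCommGroup V] [Module ℂ V] [VertexAlgebra V] {T : ℕ}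
  {M : Type v} [AddCommGroup M] [Module ℂ M]

/-- A vector of a simple vertex algebra that acts as zero on a nonzero weak module is zero. -/
theorem eq_zero_of_mode_eq_zero (hT : 0 < T) (hsimple : VertexAlgebra.IsSimple V)
    (Y : WeakModule V T M) [Nontrivial M] {a : V} (ha : ∀ n u, Y.mode n a u = 0) : a = 0 := by
  let I : Submodule ℂ V := ⨅ n, LinearMap.ker (Y.mode n)
  have hI : ∀ b, b ∈ I ↔ ∀ n u, Y.mode n b u = 0 := by
    intro b
    simp only [I, Submodule.mem_iInf, LinearMap.mem_ker, LinearMap.ext_iff, LinearMap.zero_apply]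
  -- If `b` acts as zero, every product with a mode of `b` vanishes, hence so do the iterates `(vₖ
  -- b)ₙ` and `(bₖ v)ₙ`.
  have hideal : IsIdeal V I := by
    intro v b k hb
    rw [hI] at hb
    simp only [hI]
    refine ⟨fun n u => ?_, fun n u => ?_⟩
    · have h := IsExpansionTriple.eq_zero_of hT (Y.duality v b u)
        (Or.inl fun m n => by rw [hb, map_zero]) k n
      exact h.2.2
    · have h := IsExpansionTriple.eq_zero_of hT (Y.duality b v u)
        (Or.inl fun m n => by rw [hb]) k n
      exact h.2.2
  rcases hsimple.2 I hideal with h | h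
  · have : a ∈ I := (hI a).mpr ha
    rwa [h, Submodule.mem_bot] at this
  · obtain ⟨u, hu⟩ := exists_ne (0 : M)
    have h1 := (hI vacuum).mp (h ▸ Submodule.mem_top) (-(T : ℤ)) u
    rw [Y.vacuum_mode, if_pos rfl] at h1
    exact absurd h1 hu

/-- Nondegeneracy: `∑ᵢ Y(aᵢ, x) uᵢ = 0` implies `∑ᵢ aᵢ ⊗ uᵢ = 0`, tested against functionals
on the second factor. -/
theorem sum_smul_eq_zero_of_sum_mode_eq_zero (hT : 0 < T) (hsimple : VertexAlgebra.IsSimple V)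
    (hV : Module.rank ℂ V ≤ Cardinal.aleph0) (Y : WeakModule V T M) (hY : Y.IsIrreducible)
    {κ : Type*} (s : Finset κ) (a : κ → V) (x : κ → M)
    (h : ∀ n, ∑ i ∈ s, Y.mode n (a i) (x i) = 0) (η : M →ₗ[ℂ] ℂ) :
    ∑ i ∈ s, η (x i) • a i = 0 := by
  have := hY.1
  -- Applying `bₙ` on the outside preserves the relation, and duality moves `bₙ` inside onto the
  -- vectors `x i`.
  have hmode : ∀ (m n : ℤ) (b : V), ∑ i ∈ s, Y.mode m (a i) (Y.mode n b (x i)) = 0 := by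
    intro m n b
    have h1 := (isExpansionTriple_sum hT s (fun _ => Y) a (fun _ => b) x
      (fun _ => LinearMap.id)).eq_zero_of hT (Or.inr (Or.inl fun m n => by
        simp only [LinearMap.id_apply, ← map_sum, h, map_zero])) m n
    exact h1.1
  have hsum : ∀ (m : ℤ) (D : ℤ →₀ V), ∑ i ∈ s, Y.mode m (a i) (Y.modeSum D (x i)) = 0 := by
    intro m D
    induction D using Finsupp.induction_linear with
    | zero => simp
    | add D D' h h' => simp [Finset.sum_add_distrib, h, h']
    | single n b => simpa using hmode m n b
  refine eq_zero_of_mode_eq_zero hT hsimple Y fun m w => ?_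
  -- Density realises the rank-one operator `u ↦ η(u) w` on the `x i`, so the relation says that `∑
  -- η(x i) a i` kills `w`.
  obtain ⟨D, hD⟩ := exists_modeSum_eq (fun _ : Unit => Y) hT hV (fun _ => hY)
    (fun _ _ _ => rfl) (fun _ => η.smulRight w) (fun _ => x '' s)
    (fun _ => s.finite_toSet.image x)
  rw [← hsum m D, map_sum, LinearMap.sum_apply]
  refine Finset.sum_congr rfl fun i hi => ?_
  rw [hD () (x i) (Set.mem_image_of_mem x hi), LinearMap.smulRight_apply, map_smul, map_smul,
    LinearMap.smul_apply]

/-- Distinct automorphisms of a simple vertex algebra of countable dimension are linearly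
independent, if there is an irreducible weak module. -/
theorem linearIndependent_aut (hT : 0 < T) (hsimple : VertexAlgebra.IsSimple V)
    (hV : Module.rank ℂ V ≤ Cardinal.aleph0) (Y : WeakModule V T M) (hY : Y.IsIrreducible)
    {κ : Type*} {g : κ → Aut V} (hg : Function.Injective g) (s : Finset κ) (c : κ → ℂ)
    (h : ∀ a : V, ∑ i ∈ s, c i • (g i : V ≃ₗ[ℂ] V) a = 0) : ∀ i ∈ s, c i = 0 := by
  classical
  have := hY.1
  -- Dedekind's argument. Evaluating a relation at `aₖ b` and using duality and nondegeneracy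
  -- reweights each coefficient by `η((gᵢ b)ₙ u)`, which plays the role of a character value.
  have key : ∀ (s : Finset κ) (c : κ → ℂ), (∀ a : V, ∑ i ∈ s, c i • (g i : V ≃ₗ[ℂ] V) a = 0) →
      ∀ (b : V) (n : ℤ) (u : M) (η : M →ₗ[ℂ] ℂ) (a : V),
        ∑ i ∈ s, (c i * η (Y.mode n ((g i : V ≃ₗ[ℂ] V) b) u)) • (g i : V ≃ₗ[ℂ] V) a = 0 := by
    intro s c h b n u η a
    have h1 := fun m => ((isExpansionTriple_sum hT s (fun _ => Y)
      (fun i => (g i : V ≃ₗ[ℂ] V) a) (fun i => (g i : V ≃ₗ[ℂ] V) b) (fun _ => u)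
      (fun i => c i • LinearMap.id)).eq_zero_of hT (Or.inr (Or.inr fun k n => by
        have h2 := h (VertexAlgebra.mode k a b)
        simp only [fun i => (g i).2.2 k a b] at h2
        have h3 := congrArg (fun v => Y.mode n v u) h2
        simpa using h3)) m n).1
    have h2 := sum_smul_eq_zero_of_sum_mode_eq_zero hT hsimple hV Y hY s
      (fun i => c i • (g i : V ≃ₗ[ℂ] V) a) (fun i => Y.mode n ((g i : V ≃ₗ[ℂ] V) b) u)
      (fun m => by simpa using h1 m) η
    rw [← h2]
    exact Finset.sum_congr rfl fun i _ => by rw [smul_smul, mul_comm]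
  induction s using Finset.induction_on generalizing c with
  | empty => simp
  | insert j s hj ih =>
    have hs : ∀ i ∈ s, c i = 0 := by
      by_contra! hcon
      obtain ⟨i, hi, hci⟩ := hcon
      refine hj ?_
      suffices g j = g i by rwa [hg this]
      refine Subtype.ext (LinearEquiv.ext fun b => sub_eq_zero.mp ?_)
      refine eq_zero_of_mode_eq_zero hT hsimple Y fun n u => ?_
      by_contra hne
      have h1 : ∃ η : M →ₗ[ℂ] ℂ, η (Y.mode n ((g j : V ≃ₗ[ℂ] V) b -
          (g i : V ≃ₗ[ℂ] V) b) u) ≠ 0 := by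
        by_contra! hz
        exact hne ((Module.forall_dual_apply_eq_zero_iff ℂ _).mp hz)
      obtain ⟨η, hη⟩ := h1
      -- Subtracting the reweighted relation from the multiple of the original by the weight of `g
      -- j` eliminates `g j`.
      have h2 := ih (fun k => c k * η (Y.mode n ((g j : V ≃ₗ[ℂ] V) b) u) -
        c k * η (Y.mode n ((g k : V ≃ₗ[ℂ] V) b) u)) (fun a => by
          have e1 := h a
          have e2 := key _ c h b n u η a
          rw [Finset.sum_insert hj] at e1 e2
          simp only [sub_smul, Finset.sum_sub_distrib]
          have e3 : ∑ k ∈ s, (c k * η (Y.mode n ((g j : V ≃ₗ[ℂ] V) b) u)) •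
              (g k : V ≃ₗ[ℂ] V) a = η (Y.mode n ((g j : V ≃ₗ[ℂ] V) b) u) •
                ∑ k ∈ s, c k • (g k : V ≃ₗ[ℂ] V) a := by
            rw [Finset.smul_sum]
            exact Finset.sum_congr rfl fun k _ => by rw [smul_smul, mul_comm]
          rw [e3, eq_neg_of_add_eq_zero_right e1, eq_neg_of_add_eq_zero_right e2]
          module) i hi
      rw [← mul_sub, ← map_sub] at h2
      refine (mul_ne_zero hci hη) ?_
      rw [← h2, map_sub (Y.mode n), LinearMap.sub_apply]
    have hcj : c j = 0 := by
      have := hsimple.1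
      obtain ⟨a, ha⟩ := exists_ne (0 : V)
      have h1 := h ((g j : V ≃ₗ[ℂ] V).symm a)
      rw [Finset.sum_insert hj, Finset.sum_eq_zero fun i hi => by rw [hs i hi, zero_smul],
        add_zero, LinearEquiv.apply_symm_apply] at h1
      exact (smul_eq_zero.mp h1).resolve_right ha
    intro i hi
    rcases Finset.mem_insert.mp hi with rfl | hi
    · exact hcj
    · exact hs i hi

end WeakModule

/-! ### Faithfulness of the twisted group algebra of a stabilizer. -/

namespace StableFamily.Intertwiners

variable {V : Type u} [AddCommGroup V] [Module ℂ V] [VertexAlgebra V]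
  {G : Subgroup (Aut V)} {T : ℕ} {S : StableFamily.{u, v} G T} (φ : S.Intertwiners)

theorem stabilizerAction_of (hV : Module.rank ℂ V ≤ Cardinal.aleph0) (i : S.index)
    (σ : MulAction.stabilizer G i) (x : Unit) :
    φ.stabilizerAction hV i (TwistedAlgebra.of _ σ x) =
      (φ.map (σ : G) i i (MulAction.mem_stabilizer_iff.mp σ.2)).toLinearMap :=
  TwistedAlgebra.lift_of _ _ _ _ _ _ _

/-- The twisted group algebra of the stabilizer of `M` acts faithfully on `M`. -/
theorem stabilizerAction_injective [Finite G] (hT : 0 < T) (hsimple : VertexAlgebra.IsSimple V)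
    (hV : Module.rank ℂ V ≤ Cardinal.aleph0) (i : S.index) :
    Function.Injective (φ.stabilizerAction hV i) := by
  classical
  have := Fintype.ofFinite (MulAction.stabilizer G i)
  rw [injective_iff_map_eq_zero]
  intro r hr
  let b := TwistedAlgebra.basis ((φ.alpha hV).stabilizer i)
  let c : MulAction.stabilizer G i → ℂ := fun σ => b.repr r (σ, ())
  let f : MulAction.stabilizer G i → S.carrier i → S.carrier i := fun σ =>
    φ.map (σ : G) i i (MulAction.mem_stabilizer_iff.mp σ.2)
  have hr' : r = ∑ σ, c σ • TwistedAlgebra.of ((φ.alpha hV).stabilizer i) σ () := by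
    rw [← b.sum_repr r, Fintype.sum_prod_type]
    exact Finset.sum_congr rfl fun σ _ => Fintype.sum_unique _
  have hsum : ∀ u, ∑ σ, c σ • f σ u = 0 := by
    intro u
    have h1 := LinearMap.congr_fun hr u
    rw [hr', map_sum, LinearMap.sum_apply, LinearMap.zero_apply] at h1
    rw [← h1]
    refine Finset.sum_congr rfl fun σ _ => ?_
    rw [map_smul, LinearMap.smul_apply]
    congr 1
    rw [φ.stabilizerAction_of]
    rfl
  -- The relation at `aₙ u` reads `∑ c_σ (σ a)ₙ φ(σ) u = 0`. Nondegeneracy turns it into a relation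
  -- among the automorphisms `σ`, which are independent.
  have hrel : ∀ (u : S.carrier i) (η : S.carrier i →ₗ[ℂ] ℂ) (σ : MulAction.stabilizer G i),
      c σ * η (f σ u) = 0 := by
    intro u η σ
    refine WeakModule.linearIndependent_aut hT hsimple hV (S.str i) (S.irreducible i)
      (g := fun σ : MulAction.stabilizer G i => ((σ : G) : Aut V))
      (Subtype.val_injective.comp Subtype.val_injective) Finset.univ
      (fun σ => c σ * η (f σ u)) (fun a => ?_) σ (Finset.mem_univ σ)
    have h1 := WeakModule.sum_smul_eq_zero_of_sum_mode_eq_zero hT hsimple hV (S.str i)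
      (S.irreducible i) Finset.univ
      (fun σ : MulAction.stabilizer G i => c σ • (((σ : G) : Aut V) : V ≃ₗ[ℂ] V) a)
      (fun σ => f σ u) (fun n => by
        rw [← hsum ((S.str i).mode n a u)]
        refine Finset.sum_congr rfl fun σ _ => ?_
        simp only [f, φ.map_mode, map_smul, LinearMap.smul_apply]) η
    rw [← h1]
    exact Finset.sum_congr rfl fun σ _ => by rw [smul_smul, mul_comm]
  rw [hr']
  refine Finset.sum_eq_zero fun σ _ => ?_
  have := (S.irreducible i).1
  obtain ⟨u, hu⟩ := exists_ne (0 : S.carrier i)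
  have hfu : f σ u ≠ 0 := by simpa [f] using hu
  have hη : ∃ η : S.carrier i →ₗ[ℂ] ℂ, η (f σ u) ≠ 0 := by
    by_contra! hz
    exact hfu ((Module.forall_dual_apply_eq_zero_iff ℂ _).mp hz)
  obtain ⟨η, hη⟩ := hη
  rw [(mul_eq_zero.mp (hrel u η σ)).resolve_right hη, zero_smul]

end StableFamily.Intertwiners

/-! ### Averaging over `G` and density for `V^G`. -/

namespace VertexAlgebra

variable {V : Type u} [AddCommGroup V] [Module ℂ V] [VertexAlgebra V]

theorem sum_apply_mem_fixedPoints (G : Subgroup (Aut V)) [Fintype G] (a : V) :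
    ∑ σ : G, ((σ : Aut V) : V ≃ₗ[ℂ] V) a ∈ fixedPoints G := by
  intro τ
  rw [map_sum]
  exact Fintype.sum_equiv (Equiv.mulLeft τ) _ _ fun σ => rfl

/-- The average over a finite group of automorphisms. -/
def average (G : Subgroup (Aut V)) [Fintype G] : V →ₗ[ℂ] fixedPoints G :=
  (Fintype.card G : ℂ)⁻¹ • LinearMap.codRestrict (fixedPoints G)
    (∑ σ : G, ((σ : Aut V) : V ≃ₗ[ℂ] V).toLinearMap) fun a => by
      simpa using! sum_apply_mem_fixedPoints G a

theorem coe_average (G : Subgroup (Aut V)) [Fintype G] (a : V) :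
    (average G a : V) = (Fintype.card G : ℂ)⁻¹ • ∑ σ : G, ((σ : Aut V) : V ≃ₗ[ℂ] V) a := by
  simp [average]

end VertexAlgebra

namespace StableFamily.Intertwiners

variable {V : Type u} [AddCommGroup V] [Module ℂ V] [VertexAlgebra V]
  {G : Subgroup (Aut V)} {T : ℕ} {S : StableFamily.{u, v} G T} (φ : S.Intertwiners)

/-- As `(σ a)ₙ = φ(σ) aₙ φ(σ)⁻¹`, averaging vectors of `V` averages operators by conjugation. The
conjugates come from the members `σ⁻¹ • k`. -/
theorem modeSum_average [Fintype G] (D : ℤ →₀ V) (k : S.index) (u : S.carrier k) :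
    ((S.str k).toFixedPoints G).modeSum (Finsupp.mapRange.linearMap (average G) D) u =
      (Fintype.card G : ℂ)⁻¹ • ∑ σ : G, φ.map σ (σ⁻¹ • k) k (smul_inv_smul σ k)
        ((S.str (σ⁻¹ • k)).modeSum D ((φ.map σ (σ⁻¹ • k) k (smul_inv_smul σ k)).symm u)) := by
  induction D using Finsupp.induction_linear with
  | zero => simp
  | add D D' h h' =>
    simp only [map_add, LinearMap.add_apply, Finset.sum_add_distrib, smul_add, h, h']
  | single n a =>
    simp only [Finsupp.mapRange.linearMap_apply, Finsupp.mapRange_single,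
      WeakModule.modeSum_single, φ.map_mode, LinearEquiv.apply_symm_apply]
    change (S.str k).mode n (average G a : V) u = _
    rw [coe_average, map_smul, map_sum, LinearMap.smul_apply, LinearMap.sum_apply]

/-- Modes of `V` imitate a multiple of `E` at `i` and zero at the other members. Averaging does not
spoil this at `i`, because `E` commutes with the stabilizer, nor outside the orbit, where only zero
operators are averaged. Nothing is claimed at the other members of the orbit. -/
theorem exists_fixedPoints_modeSum_eq [Finite G] (hT : 0 < T)
    (hV : Module.rank ℂ V ≤ Cardinal.aleph0) (i : S.index)
    (E : S.carrier i →ₗ[ℂ] S.carrier i)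
    (hE : ∀ r x, E (φ.stabilizerAction hV i r x) = φ.stabilizerAction hV i r (E x))
    (s : ∀ k, Set (S.carrier k)) (hs : ∀ k, (s k).Finite) :
    ∃ D : ℤ →₀ fixedPoints G,
      (∀ u ∈ s i, ((S.str i).toFixedPoints G).modeSum D u = E u) ∧
      ∀ k, k ∉ MulAction.orbit G i → ∀ u ∈ s k,
        ((S.str k).toFixedPoints G).modeSum D u = 0 := by
  classical
  have := Fintype.ofFinite G
  let F : Finset G := Finset.univ.filter fun σ => σ⁻¹ • i = i
  have hF : (F.card : ℂ) ≠ 0 := by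
    have : (1 : G) ∈ F := by simp [F]
    exact_mod_cast (Finset.card_pos.mpr ⟨1, this⟩).ne'
  have hG : (Fintype.card G : ℂ) ≠ 0 := by exact_mod_cast Fintype.card_ne_zero
  -- Only the `|F|` terms with `σ⁻¹ • i = i` survive in the average, hence the factor `|G| / |F|`.
  let E' : ∀ k, S.carrier k →ₗ[ℂ] S.carrier k :=
    Function.update (fun _ => 0) i (((Fintype.card G : ℂ) * (F.card : ℂ)⁻¹) • E)
  -- The average evaluates `D` at the vectors `φ(σ)⁻¹ u`, so all of these must be controlled.
  let s' : ∀ k, Set (S.carrier k) := fun k =>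
    ⋃ (σ : G) (k' : S.index), {v | ∃ h : σ • k = k', φ.map σ k k' h v ∈ s k'}
  have hs' : ∀ k, (s' k).Finite := by
    intro k
    refine Set.finite_iUnion fun σ => Set.finite_iUnion fun k' => ?_
    by_cases h : σ • k = k'
    · exact ((hs k').preimage (φ.map σ k k' h).injective.injOn).subset fun v hv => hv.2
    · exact Set.finite_empty.subset fun v hv => h hv.1
  obtain ⟨D, hD⟩ := WeakModule.exists_modeSum_eq S.str hT hV S.irreducible S.inequivalent
    E' s' hs'
  have hD' : ∀ k, ∀ u ∈ s k, ∀ σ : G,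
      φ.map σ (σ⁻¹ • k) k (smul_inv_smul σ k)
        ((S.str (σ⁻¹ • k)).modeSum D ((φ.map σ (σ⁻¹ • k) k (smul_inv_smul σ k)).symm u)) =
      φ.map σ (σ⁻¹ • k) k (smul_inv_smul σ k)
        (E' (σ⁻¹ • k) ((φ.map σ (σ⁻¹ • k) k (smul_inv_smul σ k)).symm u)) := by
    intro k u hu σ
    rw [hD]
    simp only [s', Set.mem_iUnion]
    exact ⟨σ, k, smul_inv_smul σ k, by rwa [LinearEquiv.apply_symm_apply]⟩
  refine ⟨Finsupp.mapRange.linearMap (average G) D, fun u hu => ?_, fun k hk u hu => ?_⟩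
  · have hconj : ∀ (σ : G) (h : σ • i = i),
        φ.map σ i i h (E ((φ.map σ i i h).symm u)) = E u := by
      intro σ h
      have h1 := hE (TwistedAlgebra.of _ ⟨σ, h⟩ ()) ((φ.map σ i i h).symm u)
      rw [φ.stabilizerAction_of] at h1
      simpa using h1.symm
    have hterm : ∀ (σ : G) (k : S.index) (h : σ • k = i),
        φ.map σ k i h (E' k ((φ.map σ k i h).symm u)) =
          if k = i then ((Fintype.card G : ℂ) * (F.card : ℂ)⁻¹) • E u else 0 := by
      intro σ k h
      split_ifs with hk
      · subst hk
        simp only [E', Function.update_self, LinearMap.smul_apply, map_smul, hconj]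
      · simp [E', Function.update_of_ne hk]
    rw [φ.modeSum_average, Finset.sum_congr rfl fun σ _ => hD' i u hu σ,
      Finset.sum_congr rfl fun σ _ => hterm σ _ (smul_inv_smul σ i), ← Finset.sum_filter,
      Finset.sum_const, ← Nat.cast_smul_eq_nsmul ℂ, smul_smul, smul_smul]
    change ((Fintype.card G : ℂ)⁻¹ * (F.card : ℂ) *
      ((Fintype.card G : ℂ) * (F.card : ℂ)⁻¹)) • E u = E u
    rw [show (Fintype.card G : ℂ)⁻¹ * (F.card : ℂ) * ((Fintype.card G : ℂ) * (F.card : ℂ)⁻¹) = 1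
      by field_simp, one_smul]
  · rw [φ.modeSum_average, Finset.sum_congr rfl fun σ _ => hD' k u hu σ, Finset.sum_eq_zero,
      smul_zero]
    intro σ _
    have hne : σ⁻¹ • k ≠ i := by
      rintro rfl
      exact hk ⟨σ, smul_inv_smul σ k⟩
    simp [E', Function.update_of_ne hne]

end StableFamily.Intertwiners

/-! ### Idempotents, groupoid inverses and Maschke's theorem. -/

namespace TwistedAlgebra

variable {G : Type u} [Group G] {X : Type v} [MulAction G X] [Fintype X] (α : TwoCocycle G X)

/-- The idempotent `e(x)`. -/
def idem (x : X) : TwistedAlgebra α := (α.coeff x 1 1)⁻¹ • of α 1 x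

theorem sum_idem : ∑ x, idem α x = 1 := rfl

theorem idem_mul_of (σ : G) (x : X) : idem α (σ • x) * of α σ x = of α σ x := by
  classical
  rw [idem, smul_mul_assoc, of_mul_of, if_pos rfl, coeff_one_left α x σ, smul_smul,
    inv_mul_cancel₀ (α.coeff_ne_zero _ _ _), one_smul, one_mul]

theorem idem_mul_of_of_ne {σ : G} {x y : X} (h : y ≠ σ • x) : idem α y * of α σ x = 0 := by
  classical
  rw [idem, smul_mul_assoc, of_mul_of, if_neg h, smul_zero]

theorem of_mul_idem (σ : G) (x : X) : of α σ x * idem α x = of α σ x := by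
  classical
  rw [idem, mul_smul_comm, of_mul_of, if_pos (one_smul G x).symm, coeff_one_right α x σ, smul_smul,
    inv_mul_cancel₀ (α.coeff_ne_zero _ _ _), one_smul, mul_one]

theorem of_mul_idem_of_ne {σ : G} {x y : X} (h : x ≠ y) : of α σ x * idem α y = 0 := by
  classical
  rw [idem, mul_smul_comm, of_mul_of, if_neg (by rwa [one_smul]), smul_zero]

/-- The inverse of `σ ⊗ e(x)` in the groupoid sense. -/
def inv (σ : G) (x : X) : TwistedAlgebra α :=
  ((α.coeff x 1 1)⁻¹ * (α.coeff x σ⁻¹ σ)⁻¹) • of α σ⁻¹ (σ • x)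

theorem inv_mul_of (σ : G) (x : X) : inv α σ x * of α σ x = idem α x := by
  classical
  rw [inv, smul_mul_assoc, of_mul_of, if_pos rfl, smul_smul, mul_assoc,
    inv_mul_cancel₀ (α.coeff_ne_zero _ _ _), mul_one, inv_mul_cancel, idem]

/-- `inv` is normalized as a left inverse. The cocycle identity at `(σ, σ⁻¹, σ)` compares the
coefficients of `(σ, σ⁻¹)` and `(σ⁻¹, σ)` and makes it two-sided. -/
theorem of_mul_inv (σ : G) (x : X) : of α σ x * inv α σ x = idem α (σ • x) := by
  classical
  have h := α.cocycle x σ σ⁻¹ σ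
  rw [mul_inv_cancel, inv_mul_cancel, coeff_one_left α x σ, coeff_one_right α x σ] at h
  have h0 := α.coeff_ne_zero x 1 1
  have h1 := α.coeff_ne_zero (σ • x) 1 1
  have h2 := α.coeff_ne_zero x σ⁻¹ σ
  rw [inv, mul_smul_comm, of_mul_of, if_pos (inv_smul_smul σ x).symm, smul_smul, mul_inv_cancel,
    idem]
  congr 1
  field_simp
  linear_combination h

theorem idem_mul_inv (σ : G) (x : X) : idem α x * inv α σ x = inv α σ x := by
  have h := idem_mul_of α σ⁻¹ (σ • x)
  rw [inv_smul_smul] at h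
  rw [inv, mul_smul_comm, h]

theorem inv_mul_of_mul (τ σ : G) (x : X) :
    inv α (τ * σ) x * of α τ (σ • x) = α.coeff x τ σ • inv α σ x := by
  classical
  have h : of α τ (σ • x) * of α σ x = α.coeff x τ σ • of α (τ * σ) x := by
    rw [of_mul_of, if_pos rfl]
  rw [← of_mul_idem α τ (σ • x), ← of_mul_inv α σ x, ← mul_assoc (of α τ (σ • x)), h,
    smul_mul_assoc, mul_smul_comm, ← mul_assoc, inv_mul_of, idem_mul_inv]

theorem inv_mul_of_of_ne {σ τ : G} {x y : X} (h : σ • x ≠ τ • y) :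
    inv α σ x * of α τ y = 0 := by
  classical
  rw [inv, smul_mul_assoc, of_mul_of, if_neg h, smul_zero]

section Maschke

variable {N : Type w} [AddCommGroup N] [Module ℂ N] [Module (TwistedAlgebra α) N]
  [IsScalarTower ℂ (TwistedAlgebra α) N]

/-- The average of a linear map over the basis `σ ⊗ e(x)`. -/
def averageMap [Fintype G] (p : N →ₗ[ℂ] N) : N →ₗ[TwistedAlgebra α] N where
  toFun n := (Fintype.card G : ℂ)⁻¹ • ∑ σ : G, ∑ x : X, of α σ x • p (inv α σ x • n)
  map_add' m n := by simp only [smul_add, map_add, Finset.sum_add_distrib]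
  map_smul' a n := by
    rw [RingHom.id_apply, smul_comm a]
    congr 1
    induction a using induction_on with
    | hzero => simp
    | hadd a b ha hb =>
      simp only [add_smul, smul_add, map_add, Finset.sum_add_distrib, ha, hb]
    | hsmul c a ha =>
      refine Eq.trans ?_ (smul_assoc c a _).symm
      rw [← ha, Finset.smul_sum]
      refine Finset.sum_congr rfl fun σ _ => ?_
      rw [Finset.smul_sum]
      refine Finset.sum_congr rfl fun x _ => ?_
      rw [smul_assoc c a n, smul_comm _ c, map_smul, smul_comm _ c]
    | hof τ y =>
      classical
      -- After the substitution `σ ↦ τ σ` the terms match: for `y = σ • x` both sides carry the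
      -- scalar `αₓ(τ, σ)`, and otherwise both vanish.
      rw [Finset.smul_sum, ← Fintype.sum_equiv (Equiv.mulLeft τ) _ _ fun σ => rfl]
      refine Finset.sum_congr rfl fun σ _ => ?_
      rw [Finset.smul_sum]
      refine Finset.sum_congr rfl fun x _ => ?_
      rw [Equiv.coe_mulLeft, smul_smul, smul_smul, of_mul_of]
      split_ifs with h
      · subst h
        rw [inv_mul_of_mul, smul_assoc, map_smul, smul_comm, smul_assoc]
      · rw [inv_mul_of_of_ne, zero_smul, zero_smul, map_zero, smul_zero]
        rw [mul_smul]
        exact fun e => h (smul_left_cancel τ e).symm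

theorem averageMap_apply [Fintype G] (p : N →ₗ[ℂ] N) (n : N) :
    averageMap α p n =
      (Fintype.card G : ℂ)⁻¹ • ∑ σ : G, ∑ x : X, of α σ x • p (inv α σ x • n) := rfl

/-- Maschke's theorem for the algebras `A_α(G, X)`. -/
theorem isSemisimpleModule [Finite G] : IsSemisimpleModule (TwistedAlgebra α) N := by
  have := Fintype.ofFinite G
  refine { exists_isCompl := fun K => ?_ }
  obtain ⟨q, hq⟩ := (K.restrictScalars ℂ).subtype.exists_leftInverse_of_injective
    (Submodule.ker_subtype _)
  have hq' : ∀ n ∈ K, (q n : N) = n := fun n hn =>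
    congrArg Subtype.val (LinearMap.congr_fun hq ⟨n, hn⟩)
  let p : N →ₗ[ℂ] N := (K.restrictScalars ℂ).subtype ∘ₗ q
  have hp : ∀ n, averageMap α p n ∈ K := by
    intro n
    rw [averageMap_apply]
    refine (K.restrictScalars ℂ).smul_mem _ (Submodule.sum_mem _ fun σ _ =>
      Submodule.sum_mem _ fun x _ => K.smul_mem _ (q _).2)
  refine ⟨LinearMap.ker ((averageMap α p).codRestrict K hp), LinearMap.isCompl_of_proj fun n => ?_⟩
  refine Subtype.ext ?_
  have hG : (Fintype.card G : ℂ) ≠ 0 := by exact_mod_cast Fintype.card_ne_zero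
  -- For each single `σ` the sum over `x` already gives `∑ e(σ • x) n = n`, which is why the average
  -- divides by `|G|` only.
  have h1 : ∀ σ : G, ∑ x : X, of α σ x • p (inv α σ x • (n : N)) = (n : N) := by
    intro σ
    have h2 : ∀ x : X, of α σ x • p (inv α σ x • (n : N)) = idem α (σ • x) • (n : N) := by
      intro x
      rw [← of_mul_inv, mul_smul]
      congr 1
      exact hq' _ (K.smul_mem _ n.2)
    simp only [h2]
    exact (Equiv.sum_comp (MulAction.toPerm σ) fun y => idem α y • (n : N)).trans
      (by rw [← Finset.sum_smul, sum_idem, one_smul])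
  rw [LinearMap.codRestrict_apply, averageMap_apply, Finset.sum_congr rfl fun σ _ => h1 σ,
    Finset.sum_const, Finset.card_univ, ← Nat.cast_smul_eq_nsmul ℂ, smul_smul,
    inv_mul_cancel₀ hG, one_smul]

instance [Finite G] : IsSemisimpleRing (TwistedAlgebra α) := isSemisimpleModule α

end Maschke

instance [Finite G] : Module.Finite ℂ (TwistedAlgebra α) := Module.Finite.of_basis (basis α)

end TwistedAlgebra

/-- Schur's lemma for simple modules over a finite-dimensional algebra. -/
theorem IsSimpleModule.exists_eq_smul {R : Type*} [Ring R] [Algebra ℂ R] [Module.Finite ℂ R]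
    {W : Type*} [AddCommGroup W] [Module ℂ W] [Module R W] [IsScalarTower ℂ R W]
    [IsSimpleModule R W] (f : W →ₗ[R] W) : ∃ c : ℂ, ∀ x, f x = c • x := by
  have := Module.Finite.trans (R := ℂ) R W
  have := IsSimpleModule.nontrivial R W
  obtain ⟨c, hc⟩ := Module.End.exists_eigenvalue (f.restrictScalars ℂ : Module.End ℂ W)
  obtain ⟨x, hx, hx0⟩ := hc.exists_hasEigenvector
  rw [Module.End.mem_eigenspace_iff] at hx
  refine ⟨c, fun y => sub_eq_zero.mp ?_⟩
  have hf : f - c • LinearMap.id = 0 := by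
    refine (LinearMap.injective_or_eq_zero (f - c • LinearMap.id)).resolve_left fun hinj => hx0 ?_
    refine hinj ?_
    rw [map_zero]
    exact sub_eq_zero.mpr hx
  exact LinearMap.congr_fun hf y

/-! ### Corners and induced modules. -/

namespace TwistedAlgebra

variable {G : Type u} [Group G] {X : Type v} [MulAction G X] [Fintype X] (α : TwoCocycle G X)
  (x : X)

theorem stabilizerMap_of (σ : MulAction.stabilizer G x) (y : Unit) :
    stabilizerMap α x (of _ σ y) = of α σ x :=
  Module.Basis.constr_basis _ _ _ _

theorem stabilizerMap_one : stabilizerMap α x 1 = idem α x := by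
  rw [one_def, map_sum, Fintype.sum_unique, map_smul, stabilizerMap_of]
  rfl

theorem stabilizerMap_mul (r s : TwistedAlgebra (α.stabilizer x)) :
    stabilizerMap α x (r * s) = stabilizerMap α x r * stabilizerMap α x s := by
  classical
  induction r using induction_on with
  | hzero => simp
  | hadd a b ha hb => simp only [add_mul, map_add, ha, hb]
  | hsmul c a ha => simp only [smul_mul_assoc, map_smul, ha]
  | hof σ y =>
  induction s using induction_on with
  | hzero => simp
  | hadd a b ha hb => simp only [mul_add, map_add, ha, hb]
  | hsmul c a ha => simp only [mul_smul_comm, map_smul, ha]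
  | hof τ z =>
  have hτ : (τ : G) • x = x := τ.2
  rw [of_mul_of, if_pos (Subsingleton.elim _ _), map_smul, stabilizerMap_of, stabilizerMap_of,
    stabilizerMap_of, of_mul_of, if_pos hτ.symm]
  rfl

theorem idem_mul_stabilizerMap (s : TwistedAlgebra (α.stabilizer x)) :
    idem α x * stabilizerMap α x s = stabilizerMap α x s := by
  rw [← stabilizerMap_one, ← stabilizerMap_mul, one_mul]

theorem mul_idem_of_mem_leftIdeal {d : TwistedAlgebra α} (hd : d ∈ leftIdeal α x) :
    d * idem α x = d := by
  change d ∈ Submodule.span ℂ (Set.range fun σ : G => of α σ x) at hd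
  induction hd using Submodule.span_induction with
  | mem d hd => obtain ⟨σ, rfl⟩ := hd; exact of_mul_idem α σ x
  | zero => exact zero_mul _
  | add a b _ _ ha hb => rw [add_mul, ha, hb]
  | smul c a _ ha => rw [smul_mul_assoc, ha]

theorem idem_mem_leftIdeal : idem α x ∈ leftIdeal α x := by
  rw [← stabilizerMap_one]
  exact stabilizerMap_mem α x 1

/-- A basis element `σ ⊗ e(y)` survives both idempotents only if `y = x` and `σ` fixes `x`, so the
corner at `x` is `S(x)`. -/
theorem exists_idem_mul_mul_idem (a : TwistedAlgebra α) :
    ∃ s, idem α x * a * idem α x = stabilizerMap α x s := by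
  induction a using induction_on with
  | hzero => exact ⟨0, by simp⟩
  | hadd a b ha hb =>
    obtain ⟨s, hs⟩ := ha
    obtain ⟨t, ht⟩ := hb
    exact ⟨s + t, by rw [mul_add, add_mul, hs, ht, map_add]⟩
  | hsmul c a ha =>
    obtain ⟨s, hs⟩ := ha
    exact ⟨c • s, by rw [mul_smul_comm, smul_mul_assoc, hs, map_smul]⟩
  | hof σ y =>
    by_cases hy : y = x
    · subst hy
      by_cases hσ : y = σ • y
      · refine ⟨of _ ⟨σ, hσ.symm⟩ (), ?_⟩
        rw [stabilizerMap_of, mul_assoc, of_mul_idem]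
        nth_rw 1 [hσ]
        exact idem_mul_of α σ y
      · exact ⟨0, by rw [idem_mul_of_of_ne α hσ, zero_mul, map_zero]⟩
    · exact ⟨0, by rw [mul_assoc, of_mul_idem_of_ne α hy, mul_zero, map_zero]⟩

theorem idem_mul_mul_idem_of_notMem {y : X} (hy : y ∉ MulAction.orbit G x)
    (a : TwistedAlgebra α) : idem α y * a * idem α x = 0 := by
  induction a using induction_on with
  | hzero => simp
  | hadd a b ha hb => rw [mul_add, add_mul, ha, hb, add_zero]
  | hsmul c a ha => rw [mul_smul_comm, smul_mul_assoc, ha, smul_zero]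
  | hof σ z =>
    by_cases hz : z = x
    · subst hz
      rw [idem_mul_of_of_ne, zero_mul]
      rintro rfl
      exact hy ⟨σ, rfl⟩
    · rw [mul_assoc, of_mul_idem_of_ne α hz, mul_zero]

section Corner

variable {N : Type w} [AddCommGroup N] [Module (TwistedAlgebra α) N]

theorem exists_idem_smul_ne_zero {z : N} (hz : z ≠ 0) : ∃ y, idem α y • z ≠ 0 := by
  by_contra! h
  refine hz ?_
  rw [← one_smul (TwistedAlgebra α) z, ← sum_idem, Finset.sum_smul]
  exact Finset.sum_eq_zero fun y _ => h y

variable {α x} in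
/-- The corners at the points of one orbit vanish simultaneously. -/
theorem exists_ne_zero_of_idem_smul_ne_zero {y : X} (hy : y ∈ MulAction.orbit G x) {z : N}
    (hz : idem α y • z ≠ 0) : ∃ a : TwistedAlgebra α, a • z ≠ 0 ∧ idem α x • a • z = a • z := by
  obtain ⟨σ, rfl⟩ := hy
  refine ⟨inv α σ x, fun h => hz ?_, ?_⟩
  · change idem α (σ • x) • z = 0
    rw [← of_mul_inv, mul_smul, h, smul_zero]
  · rw [smul_smul, idem_mul_inv]

end Corner

section Induced

variable (W : Type w) [AddCommGroup W] [Module ℂ W] [Module (TwistedAlgebra (α.stabilizer x)) W]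

/-- The map `w ↦ e(x) ⊗ w` to the induced module. -/
def inducedMk : W →ₗ[ℂ] Induced α x W :=
  ((inducedRelations α x W).mkQ.restrictScalars ℂ) ∘ₗ
    TensorProduct.mk ℂ (leftIdeal α x) W ⟨idem α x, idem_mem_leftIdeal α x⟩

variable {W}

theorem mk_tmul (d : leftIdeal α x) (m : W) :
    (Submodule.Quotient.mk (d ⊗ₜ[ℂ] m) : Induced α x W) =
      (d : TwistedAlgebra α) • inducedMk α x W m := by
  have h : d ⊗ₜ[ℂ] m = (d : TwistedAlgebra α) •
      ((⟨idem α x, idem_mem_leftIdeal α x⟩ : leftIdeal α x) ⊗ₜ[ℂ] m) := by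
    rw [TensorProduct.smul_tmul']
    congr 1
    exact Subtype.ext (mul_idem_of_mem_leftIdeal α x d.2).symm
  rw [h]
  rfl

theorem stabilizerMap_smul_inducedMk (s : TwistedAlgebra (α.stabilizer x)) (m : W) :
    stabilizerMap α x s • inducedMk α x W m = inducedMk α x W (s • m) := by
  rw [← mk_tmul α x ⟨stabilizerMap α x s, stabilizerMap_mem α x s⟩ m]
  refine (Submodule.Quotient.eq _).mpr (Submodule.subset_span
    ⟨⟨idem α x, idem_mem_leftIdeal α x⟩, s, m, ?_⟩)
  congr 2
  exact Subtype.ext (idem_mul_stabilizerMap α x s).symm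

theorem idem_smul_inducedMk (m : W) : idem α x • inducedMk α x W m = inducedMk α x W m := by
  rw [← stabilizerMap_one, stabilizerMap_smul_inducedMk, one_smul]

theorem span_range_inducedMk :
    Submodule.span (TwistedAlgebra α) (Set.range (inducedMk α x W)) = ⊤ := by
  refine Submodule.eq_top_iff'.mpr fun z => ?_
  obtain ⟨t, rfl⟩ := Submodule.Quotient.mk_surjective _ z
  induction t using TensorProduct.induction_on with
  | zero => exact Submodule.zero_mem _
  | add s t hs ht => exact Submodule.add_mem _ hs ht
  | tmul d m =>
    rw [mk_tmul]
    exact Submodule.smul_mem _ _ (Submodule.subset_span ⟨m, rfl⟩)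

/-- The copy of `W` generates and is fixed by `e(x)`, so the corner of the induced module is `e(x) A
e(x) W = S(x) W`. -/
theorem exists_inducedMk_eq (z : Induced α x W) :
    ∃ m, inducedMk α x W m = idem α x • z := by
  have hz : z ∈ Submodule.span (TwistedAlgebra α) (Set.range (inducedMk α x W)) := by
    rw [span_range_inducedMk]
    trivial
  induction hz using Submodule.closure_induction with
  | zero => exact ⟨0, by simp⟩
  | add z z' _ _ hz hz' =>
    obtain ⟨m, hm⟩ := hz
    obtain ⟨m', hm'⟩ := hz'
    exact ⟨m + m', by rw [map_add, hm, hm', smul_add]⟩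
  | smul_mem a z hz =>
    obtain ⟨m, rfl⟩ := hz
    obtain ⟨s, hs⟩ := exists_idem_mul_mul_idem α x a
    refine ⟨s • m, ?_⟩
    rw [← stabilizerMap_smul_inducedMk, ← hs, mul_smul, mul_smul, idem_smul_inducedMk]

theorem idem_smul_eq_zero_of_notMem {y : X} (hy : y ∉ MulAction.orbit G x)
    (z : Induced α x W) : idem α y • z = 0 := by
  have hz : z ∈ Submodule.span (TwistedAlgebra α) (Set.range (inducedMk α x W)) := by
    rw [span_range_inducedMk]
    trivial
  induction hz using Submodule.closure_induction with
  | zero => exact smul_zero _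
  | add z z' _ _ hz hz' => rw [smul_add, hz, hz', add_zero]
  | smul_mem a z hz =>
    obtain ⟨m, rfl⟩ := hz
    rw [← idem_smul_inducedMk, smul_smul, smul_smul,
      idem_mul_mul_idem_of_notMem α x hy, zero_smul]

section Lift

variable {N : Type*} [AddCommGroup N] [Module ℂ N] [Module (TwistedAlgebra α) N]
  [IsScalarTower ℂ (TwistedAlgebra α) N] (h : W →ₗ[ℂ] N)
  (hh : ∀ s m, h (s • m) = stabilizerMap α x s • h m)

/-- The universal property of the induced module. -/
def inducedLift : Induced α x W →ₗ[TwistedAlgebra α] N :=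
  (inducedRelations α x W).liftQ
    (TensorProduct.AlgebraTensorModule.lift
      { toFun := fun d => (d : TwistedAlgebra α) • h
        map_add' := fun d d' => by rw [Submodule.coe_add, add_smul]
        map_smul' := fun a d => by
          rw [Submodule.coe_smul, smul_assoc, RingHom.id_apply] })
    (by
      rw [inducedRelations, Submodule.span_le]
      rintro _ ⟨d, s, m, rfl⟩
      rw [SetLike.mem_coe, LinearMap.mem_ker, map_sub, sub_eq_zero]
      simp only [TensorProduct.AlgebraTensorModule.lift_tmul]
      change ((d : TwistedAlgebra α) * stabilizerMap α x s) • h m =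
        (d : TwistedAlgebra α) • h (s • m)
      rw [hh, mul_smul])

theorem inducedLift_inducedMk (m : W) : inducedLift α x h hh (inducedMk α x W m) = h m := by
  have h1 : inducedLift α x h hh (inducedMk α x W m) = idem α x • h m := rfl
  rw [h1, ← stabilizerMap_one, ← hh, one_smul]

end Lift

variable {α x} in
/-- A nonzero submodule of the induced module meets the copy of `W`. -/
theorem exists_inducedMk_mem {K : Submodule (TwistedAlgebra α) (Induced α x W)} (hK : K ≠ ⊥) :
    ∃ m, m ≠ 0 ∧ inducedMk α x W m ∈ K := by
  obtain ⟨z, hzK, hz⟩ := K.ne_bot_iff.mp hK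
  obtain ⟨y, hy⟩ := exists_idem_smul_ne_zero α hz
  have hyx : y ∈ MulAction.orbit G x := by
    by_contra hyx
    exact hy (idem_smul_eq_zero_of_notMem α x hyx z)
  obtain ⟨a, ha, ha'⟩ := exists_ne_zero_of_idem_smul_ne_zero hyx hy
  obtain ⟨m, hm⟩ := exists_inducedMk_eq α x (a • z)
  rw [ha'] at hm
  refine ⟨m, ?_, ?_⟩
  · rintro rfl
    rw [map_zero] at hm
    exact ha hm.symm
  · rw [hm]
    exact K.smul_mem a hzK

/-- A nonzero submodule meets the copy of `W`, hence contains it by simplicity of `W`, hence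
contains the generators. Injectivity serves only to make the induced module nonzero. -/
theorem isSimpleModule_induced (hW : IsSimpleModule (TwistedAlgebra (α.stabilizer x)) W)
    (hinj : Function.Injective (inducedMk α x W)) :
    IsSimpleModule (TwistedAlgebra α) (Induced α x W) := by
  have := IsSimpleModule.nontrivial (TwistedAlgebra (α.stabilizer x)) W
  have := hinj.nontrivial
  refine { exists_pair_ne := ⟨⊥, ⊤, bot_ne_top⟩, eq_bot_or_eq_top := fun K => ?_ }
  refine or_iff_not_imp_left.mpr fun hK => ?_
  obtain ⟨m, hm, hmK⟩ := exists_inducedMk_mem hK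
  rw [eq_top_iff, ← span_range_inducedMk, Submodule.span_le]
  rintro _ ⟨m', rfl⟩
  obtain ⟨s, rfl⟩ := IsSimpleModule.toSpanSingleton_surjective
    (TwistedAlgebra (α.stabilizer x)) hm m'
  rw [LinearMap.toSpanSingleton_apply, ← stabilizerMap_smul_inducedMk]
  exact K.smul_mem _ hmK

variable {W' : Type*} [AddCommGroup W'] [Module ℂ W'] [Module (TwistedAlgebra (α.stabilizer x)) W']

/-- Simple modules are isomorphic if the induced modules are. -/
theorem nonempty_equiv_of_induced_equiv [IsSimpleModule (TwistedAlgebra (α.stabilizer x)) W]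
    [IsSimpleModule (TwistedAlgebra (α.stabilizer x)) W']
    (hinj : Function.Injective (inducedMk α x W)) (hinj' : Function.Injective (inducedMk α x W'))
    (g : Induced α x W ≃ₗ[TwistedAlgebra α] Induced α x W') :
    Nonempty (W ≃ₗ[TwistedAlgebra (α.stabilizer x)] W') := by
  -- `g` commutes with `e(x)`, so it maps corner to corner, that is, the copy of `W` into that of
  -- `W'`.
  have hex : ∀ m, ∃ m', inducedMk α x W' m' = g (inducedMk α x W m) := by
    intro m
    rw [← idem_smul_inducedMk, map_smul]
    exact exists_inducedMk_eq α x _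
  choose f hf using hex
  let F : W →ₗ[TwistedAlgebra (α.stabilizer x)] W' :=
    { toFun := f
      map_add' := fun m m' => hinj' (by simp only [hf, map_add])
      map_smul' := fun s m => hinj' (by
        simp only [hf, ← stabilizerMap_smul_inducedMk, map_smul, RingHom.id_apply]) }
  have hF : F ≠ 0 := by
    intro h0
    have := IsSimpleModule.nontrivial (TwistedAlgebra (α.stabilizer x)) W
    obtain ⟨m, hm⟩ := exists_ne (0 : W)
    have h1 := hf m
    rw [show f m = 0 from LinearMap.congr_fun h0 m, map_zero] at h1
    refine hm (hinj (g.injective ?_))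
    rw [← h1, map_zero, map_zero]
  exact ⟨LinearEquiv.ofBijective F (LinearMap.bijective_of_ne_zero hF)⟩

theorem mem_orbit_of_induced_equiv {y : X} {W' : Type*} [AddCommGroup W'] [Module ℂ W']
    [Module (TwistedAlgebra (α.stabilizer y)) W'] [Nontrivial W]
    (hinj : Function.Injective (inducedMk α x W))
    (g : Induced α x W ≃ₗ[TwistedAlgebra α] Induced α y W') : x ∈ MulAction.orbit G y := by
  by_contra hxy
  obtain ⟨m, hm⟩ := exists_ne (0 : W)
  refine hm (hinj (g.injective ?_))
  rw [← idem_smul_inducedMk, map_smul, idem_smul_eq_zero_of_notMem α y hxy, map_zero, map_zero]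

/-- A simple module with a nonzero corner at `x` receives an embedding of a simple module of the
stabilizer algebra. -/
theorem exists_injective_of_corner_ne_zero [Finite G] {Λ : Type*} {W : Λ → Type*}
    [∀ l, AddCommGroup (W l)] [∀ l, Module ℂ (W l)]
    [∀ l, Module (TwistedAlgebra (α.stabilizer x)) (W l)]
    [∀ l, IsScalarTower ℂ (TwistedAlgebra (α.stabilizer x)) (W l)]
    (hW : ∀ J : Submodule (TwistedAlgebra (α.stabilizer x)) (TwistedAlgebra (α.stabilizer x)),
      IsSimpleModule (TwistedAlgebra (α.stabilizer x)) J →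
        ∃ l, Nonempty (J ≃ₗ[TwistedAlgebra (α.stabilizer x)] W l))
    {N : Type*} [AddCommGroup N] [Module ℂ N] [Module (TwistedAlgebra α) N]
    [IsScalarTower ℂ (TwistedAlgebra α) N] {n : N} (hn : n ≠ 0) (hn' : idem α x • n = n) :
    ∃ (l : Λ) (h : W l →ₗ[ℂ] N), Function.Injective h ∧
      ∀ s m, h (s • m) = stabilizerMap α x s • h m := by
  -- `J` is the annihilator of `n`. On a complement the map `s ↦ s n` is injective, and the
  -- complement is nonzero because `1 ∉ J`, so it contains a simple left ideal.
  let J : Submodule (TwistedAlgebra (α.stabilizer x)) (TwistedAlgebra (α.stabilizer x)) :=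
    { carrier := {s | stabilizerMap α x s • n = 0}
      zero_mem' := by simp
      add_mem' := fun {a b} (ha : _ = _) (hb : _ = _) => by
        rw [Set.mem_ofPred_eq, map_add, add_smul, ha, hb, add_zero]
      smul_mem' := fun r s (hs : _ = _) => by
        rw [Set.mem_ofPred_eq, smul_eq_mul, stabilizerMap_mul, mul_smul, hs, smul_zero] }
  obtain ⟨J', hJ'⟩ := exists_isCompl J
  have hne : J' ≠ ⊥ := by
    rintro rfl
    have h1 : (1 : TwistedAlgebra (α.stabilizer x)) ∈ J := by
      rw [eq_top_of_isCompl_bot hJ']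
      trivial
    have h2 : stabilizerMap α x 1 • n = 0 := h1
    rw [stabilizerMap_one, hn'] at h2
    exact hn h2
  obtain ⟨I, hIJ, hI⟩ := (IsSemisimpleModule.eq_bot_or_exists_simple_le J').resolve_left hne
  obtain ⟨l, ⟨e⟩⟩ := hW I hI
  refine ⟨l, ((LinearMap.toSpanSingleton (TwistedAlgebra α) N n).restrictScalars ℂ ∘ₗ
    stabilizerMap α x) ∘ₗ ((I.subtype ∘ₗ e.symm.toLinearMap).restrictScalars ℂ), ?_, ?_⟩
  · rw [injective_iff_map_eq_zero]
    intro m hm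
    have h1 : (e.symm m : TwistedAlgebra (α.stabilizer x)) ∈ J := hm
    have h2 : (e.symm m : TwistedAlgebra (α.stabilizer x)) ∈ J' := hIJ (e.symm m).2
    have h3 := Submodule.disjoint_def.mp hJ'.disjoint _ h1 h2
    simpa using h3
  · intro s m
    change stabilizerMap α x (e.symm (s • m) : TwistedAlgebra (α.stabilizer x)) • n =
      stabilizerMap α x s • stabilizerMap α x (e.symm m : TwistedAlgebra (α.stabilizer x)) • n
    rw [map_smul, Submodule.coe_smul, smul_eq_mul, stabilizerMap_mul, mul_smul]

end Induced

end TwistedAlgebra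

/-! ### Multiplicity spaces: nonvanishing, irreducibility, inequivalence. -/

namespace StableFamily.Intertwiners

variable {V : Type u} [AddCommGroup V] [Module ℂ V] [VertexAlgebra V]
  {G : Subgroup (Aut V)} {T : ℕ} {S : StableFamily.{u, v} G T} (φ : S.Intertwiners)
  (hV : Module.rank ℂ V ≤ Cardinal.aleph0)

/-- The members of the family as modules over the twisted group algebra of the stabilizer. -/
abbrev stabilizerModule (i : S.index) : Module (φ.stabilizerAlgebra hV i) (S.carrier i) :=
  Module.compHom _ (φ.stabilizerAction hV i).toRingHom

section Multiplicity

variable {i : S.index} {W : Type u} [AddCommGroup W] [Module ℂ W]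
  [Module (φ.stabilizerAlgebra hV i) W]

/-- An element of the multiplicity space as a homomorphism of modules. -/
def multiplicityHom (f : φ.multiplicity hV i W) :
    letI := φ.stabilizerModule hV i
    W →ₗ[φ.stabilizerAlgebra hV i] S.carrier i :=
  letI := φ.stabilizerModule hV i
  { toFun := fun m => (f : W →ₗ[ℂ] S.carrier i) m
    map_add' := map_add _
    map_smul' := f.2 }

theorem injective_of_ne_zero [IsSimpleModule (φ.stabilizerAlgebra hV i) W]
    {f : φ.multiplicity hV i W} (hf : f ≠ 0) :
    Function.Injective (f : W →ₗ[ℂ] S.carrier i) := by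
  let := φ.stabilizerModule hV i
  refine LinearMap.injective_of_ne_zero (f := φ.multiplicityHom hV f) fun h => hf ?_
  exact Subtype.ext (LinearMap.ext fun m => LinearMap.congr_fun h m)

/-- Every simple module of the twisted group algebra of the stabilizer of `M` occurs in `M`. -/
theorem nontrivial_multiplicity [Finite G] (hT : 0 < T) (hsimple : VertexAlgebra.IsSimple V)
    [IsScalarTower ℂ (φ.stabilizerAlgebra hV i) W]
    [IsSimpleModule (φ.stabilizerAlgebra hV i) W] : Nontrivial (φ.multiplicity hV i W) := by
  obtain ⟨I, ⟨e⟩⟩ := IsSemisimpleRing.exists_linearEquiv_ideal_of_isSimpleModule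
    (φ.stabilizerAlgebra hV i) W
  have := IsSimpleModule.nontrivial (φ.stabilizerAlgebra hV i) W
  obtain ⟨m, hm⟩ := exists_ne (0 : W)
  have hem : (e m : φ.stabilizerAlgebra hV i) ≠ 0 := by simpa using hm
  have hact : φ.stabilizerAction hV i (e m : φ.stabilizerAlgebra hV i) ≠ 0 := by
    intro h
    exact hem (φ.stabilizerAction_injective hT hsimple hV i (by rw [h, map_zero]))
  obtain ⟨u, hu⟩ : ∃ u, φ.stabilizerAction hV i (e m : φ.stabilizerAlgebra hV i) u ≠ 0 := by
    by_contra! h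
    exact hact (LinearMap.ext h)
  -- With `W` realised as a left ideal, `w ↦ e(w) u` is a homomorphism. Faithfulness provided a `u`
  -- for which it is nonzero.
  let f : W →ₗ[ℂ] S.carrier i := (φ.stabilizerAction hV i).toLinearMap.flip u ∘ₗ
    (I.subtype ∘ₗ e.toLinearMap).restrictScalars ℂ
  have hf : ∀ m, f m = φ.stabilizerAction hV i (e m : φ.stabilizerAlgebra hV i) u := fun _ => rfl
  refine ⟨⟨⟨f, fun r m => ?_⟩, 0, fun h => hu ?_⟩⟩
  · rw [hf, hf, map_smul, Submodule.coe_smul, smul_eq_mul, map_mul, Module.End.mul_apply]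
  · rw [← hf]
    exact LinearMap.congr_fun (congrArg Subtype.val h) m

variable (W) in
theorem modeSum_multiplicityModule_apply (hT : 0 < T)
    (hW : IsSimpleModule (φ.stabilizerAlgebra hV i) W) (D : ℤ →₀ fixedPoints G)
    (f : φ.multiplicity hV i W) (m : W) :
    ((φ.multiplicityModule hV i W hT hW).modeSum D f : W →ₗ[ℂ] S.carrier i) m =
      ((S.str i).toFixedPoints G).modeSum D ((f : W →ₗ[ℂ] S.carrier i) m) :=
  WeakModule.map_modeSum (Y := φ.multiplicityModule hV i W hT hW)
    (Z := (S.str i).toFixedPoints G)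
    (LinearMap.applyₗ m ∘ₗ (φ.multiplicity hV i W).subtype) (fun _ _ _ => rfl) D f

/-- A nonzero homomorphism to the member `M` can be moved to any other one by an endomorphism
of `M`. -/
theorem exists_comp_eq [Finite G] [IsSimpleModule (φ.stabilizerAlgebra hV i) W]
    {f : φ.multiplicity hV i W} (hf : f ≠ 0) (g : φ.multiplicity hV i W) :
    ∃ E : S.carrier i →ₗ[ℂ] S.carrier i,
      (∀ r x, E (φ.stabilizerAction hV i r x) = φ.stabilizerAction hV i r (E x)) ∧
      ∀ m, E ((f : W →ₗ[ℂ] S.carrier i) m) = (g : W →ₗ[ℂ] S.carrier i) m := by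
  let := φ.stabilizerModule hV i
  have : IsScalarTower ℂ (φ.stabilizerAlgebra hV i) (S.carrier i) :=
    ⟨fun c r u => by
      change φ.stabilizerAction hV i (c • r) u = c • φ.stabilizerAction hV i r u
      rw [map_smul, LinearMap.smul_apply]⟩
  obtain ⟨E, hE⟩ := IsSemisimpleModule.extension_property (φ.multiplicityHom hV f)
    (φ.injective_of_ne_zero hV hf) (φ.multiplicityHom hV g)
  exact ⟨E.restrictScalars ℂ, fun r x => E.map_smul r x, fun m => LinearMap.congr_fun hE m⟩

/-- An endomorphism of `M` vanishing on the other homomorphic images of non-isomorphic simple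
modules and fixing the image of `f`. -/
theorem exists_comp_eq_self_and_comp_eq_zero [Finite G]
    [IsSimpleModule (φ.stabilizerAlgebra hV i) W] {W' : Type u} [AddCommGroup W'] [Module ℂ W']
    [Module (φ.stabilizerAlgebra hV i) W'] [IsSimpleModule (φ.stabilizerAlgebra hV i) W']
    (hne : ¬ Nonempty (W ≃ₗ[φ.stabilizerAlgebra hV i] W'))
    {f : φ.multiplicity hV i W} (hf : f ≠ 0) (g : φ.multiplicity hV i W') :
    ∃ E : S.carrier i →ₗ[ℂ] S.carrier i,
      (∀ r x, E (φ.stabilizerAction hV i r x) = φ.stabilizerAction hV i r (E x)) ∧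
      (∀ m, E ((f : W →ₗ[ℂ] S.carrier i) m) = (f : W →ₗ[ℂ] S.carrier i) m) ∧
      ∀ m, E ((g : W' →ₗ[ℂ] S.carrier i) m) = 0 := by
  let := φ.stabilizerModule hV i
  have : IsScalarTower ℂ (φ.stabilizerAlgebra hV i) (S.carrier i) :=
    ⟨fun c r u => by
      change φ.stabilizerAction hV i (c • r) u = c • φ.stabilizerAction hV i r u
      rw [map_smul, LinearMap.smul_apply]⟩
  -- `p` is a retraction of `f`, and `p ∘ g : W' → W` vanishes by Schur's lemma; so `f ∘ p` is the
  -- required operator.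
  obtain ⟨p, hp⟩ := IsSemisimpleModule.extension_property (φ.multiplicityHom hV f)
    (φ.injective_of_ne_zero hV hf) LinearMap.id
  have hpg : p ∘ₗ φ.multiplicityHom hV g = 0 := by
    by_contra h
    exact hne ⟨(LinearEquiv.ofBijective _ (LinearMap.bijective_of_ne_zero h)).symm⟩
  refine ⟨(φ.multiplicityHom hV f ∘ₗ p).restrictScalars ℂ, fun r x =>
    (φ.multiplicityHom hV f ∘ₗ p).map_smul r x, fun m => ?_, fun m => ?_⟩
  · exact congrArg (φ.multiplicityHom hV f) (LinearMap.congr_fun hp m)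
  · exact (congrArg (φ.multiplicityHom hV f) (LinearMap.congr_fun hpg m)).trans (map_zero _)

variable [IsScalarTower ℂ (φ.stabilizerAlgebra hV i) W]

/-- `W` is finite-dimensional. This lets density, which controls only finitely many vectors, prove
equalities of homomorphisms. -/
theorem exists_finite_ext [Finite G] (i : S.index) (W : Type u) [AddCommGroup W] [Module ℂ W]
    [Module (φ.stabilizerAlgebra hV i) W] [IsScalarTower ℂ (φ.stabilizerAlgebra hV i) W]
    [IsSimpleModule (φ.stabilizerAlgebra hV i) W] :
    ∃ t : Set W, t.Finite ∧ ∀ f g : φ.multiplicity hV i W,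
      (∀ m ∈ t, (f : W →ₗ[ℂ] S.carrier i) m = (g : W →ₗ[ℂ] S.carrier i) m) → f = g := by
  have : Module.Finite ℂ W := Module.Finite.trans (φ.stabilizerAlgebra hV i) W
  obtain ⟨t, ht⟩ := Module.Finite.fg_top (R := ℂ) (M := W)
  exact ⟨t, t.finite_toSet, fun f g h => Subtype.ext (LinearMap.ext_on ht h)⟩

/-- An operator commuting with the stabilizer algebra carries a nonzero `f` to an arbitrary `g`, and
modes of `V^G` imitate it on the values of `f` at a spanning set. Every submodule containing `f`
thus contains `g`. -/
theorem isIrreducible_multiplicityModule [Finite G] (hT : 0 < T)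
    (hsimple : VertexAlgebra.IsSimple V) (hW : IsSimpleModule (φ.stabilizerAlgebra hV i) W) :
    (φ.multiplicityModule hV i W hT hW).IsIrreducible := by
  refine ⟨φ.nontrivial_multiplicity hV hT hsimple, fun N hN => or_iff_not_imp_left.mpr fun h => ?_⟩
  obtain ⟨f, hfN, hf⟩ := N.ne_bot_iff.mp h
  refine Submodule.eq_top_iff'.mpr fun g => ?_
  obtain ⟨t, ht, hext⟩ := φ.exists_finite_ext hV i W
  obtain ⟨E, hE, hEf⟩ := φ.exists_comp_eq hV hf g
  -- A finite subset of the total space, cut into fibres by `Sigma.mk`, avoids transport along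
  -- equalities of indices.
  obtain ⟨D, hD, -⟩ := φ.exists_fixedPoints_modeSum_eq hT hV i E hE
    (fun k => Sigma.mk k ⁻¹' ((fun m => ⟨i, (f : W →ₗ[ℂ] S.carrier i) m⟩) '' t))
    (fun k => (ht.image _).preimage sigma_mk_injective.injOn)
  have hfg : (φ.multiplicityModule hV i W hT hW).modeSum D f = g := by
    refine hext _ _ fun m hm => ?_
    rw [modeSum_multiplicityModule_apply, hD _ ⟨m, hm, rfl⟩, hEf]
  rw [← hfg]
  exact WeakModule.modeSum_mem_of_isSubmodule hN D hfN

end Multiplicity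

/-- One sum `D` of modes of `V^G` fixes `f` and kills `h f`; since `h` commutes with `D`, `h f = h
(D f) = D (h f) = 0`. -/
theorem eq_zero_of_map_multiplicity [Finite G] (hT : 0 < T) {i k : S.index}
    {W : Type u} [AddCommGroup W] [Module ℂ W] [Module (φ.stabilizerAlgebra hV i) W]
    [IsScalarTower ℂ (φ.stabilizerAlgebra hV i) W]
    {W' : Type u} [AddCommGroup W'] [Module ℂ W'] [Module (φ.stabilizerAlgebra hV k) W']
    [IsScalarTower ℂ (φ.stabilizerAlgebra hV k) W']
    (hW : IsSimpleModule (φ.stabilizerAlgebra hV i) W)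
    (hW' : IsSimpleModule (φ.stabilizerAlgebra hV k) W')
    (h : φ.multiplicity hV i W →ₗ[ℂ] φ.multiplicity hV k W')
    (hh : ∀ (n : ℤ) (a : fixedPoints G) (f : φ.multiplicity hV i W),
      h ((φ.multiplicityModule hV i W hT hW).mode n a f) =
        (φ.multiplicityModule hV k W' hT hW').mode n a (h f))
    (f : φ.multiplicity hV i W) (E : S.carrier i →ₗ[ℂ] S.carrier i)
    (hE : ∀ r x, E (φ.stabilizerAction hV i r x) = φ.stabilizerAction hV i r (E x))
    (hEf : ∀ m, E ((f : W →ₗ[ℂ] S.carrier i) m) = (f : W →ₗ[ℂ] S.carrier i) m)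
    (hk : (k ∉ MulAction.orbit G i) ∨ ∃ e : k = i, ∀ m,
      E (e ▸ (h f : W' →ₗ[ℂ] S.carrier k) m) = 0) : h f = 0 := by
  obtain ⟨t, ht, hext⟩ := φ.exists_finite_ext hV i W
  obtain ⟨t', ht', hext'⟩ := φ.exists_finite_ext hV k W'
  obtain ⟨D, hD, hD'⟩ := φ.exists_fixedPoints_modeSum_eq hT hV i E hE
    (fun j => Sigma.mk j ⁻¹' ((fun m => ⟨i, (f : W →ₗ[ℂ] S.carrier i) m⟩) '' t ∪
      (fun m => ⟨k, (h f : W' →ₗ[ℂ] S.carrier k) m⟩) '' t'))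
    (fun j => ((ht.image _).union (ht'.image _)).preimage sigma_mk_injective.injOn)
  have h1 : (φ.multiplicityModule hV i W hT hW).modeSum D f = f := by
    refine hext _ _ fun m hm => ?_
    rw [modeSum_multiplicityModule_apply, hD _ (Or.inl ⟨m, hm, rfl⟩), hEf]
  have h2 : (φ.multiplicityModule hV k W' hT hW').modeSum D (h f) = 0 := by
    refine hext' _ _ fun m hm => ?_
    rw [modeSum_multiplicityModule_apply]
    rcases hk with hk | ⟨rfl, hk⟩
    · exact hD' k hk _ (Or.inr ⟨m, hm, rfl⟩)
    · rw [hD _ (Or.inr ⟨m, hm, rfl⟩)]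
      exact hk m
  rw [← h1, WeakModule.map_modeSum h hh, h2]

/-! ### The commuting actions on `𝓜`. -/

section DirectSum

theorem action_of_lof [DecidableEq S.index] (σ : G) (i k : S.index)
    (h : σ • i = k) (u : S.carrier i) :
    φ.action hV (TwistedAlgebra.of _ σ i) (DirectSum.lof ℂ S.index S.carrier i u) =
      DirectSum.lof ℂ S.index S.carrier k (φ.map σ i k h u) := by
  subst h
  have e : φ.action hV (TwistedAlgebra.of _ σ i) = _ := TwistedAlgebra.lift_of _ _ _ _ _ _ _
  rw [e]
  simp only [LinearMap.comp_apply, LinearEquiv.coe_coe, DirectSum.component.lof_self]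
  congr!

theorem action_of_lof_of_ne [DecidableEq S.index] (σ : G) {i k : S.index}
    (h : i ≠ k) (u : S.carrier k) :
    φ.action hV (TwistedAlgebra.of _ σ i) (DirectSum.lof ℂ S.index S.carrier k u) = 0 := by
  have e : φ.action hV (TwistedAlgebra.of _ σ i) = _ := TwistedAlgebra.lift_of _ _ _ _ _ _ _
  rw [e]
  simp only [LinearMap.comp_apply, DirectSum.component.of, dif_neg h.symm, map_zero]

theorem action_stabilizerMap_lof [DecidableEq S.index] (i : S.index) (s : φ.stabilizerAlgebra hV i)
    (u : S.carrier i) :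
    φ.action hV (TwistedAlgebra.stabilizerMap (φ.alpha hV) i s)
        (DirectSum.lof ℂ S.index S.carrier i u) =
      DirectSum.lof ℂ S.index S.carrier i (φ.stabilizerAction hV i s u) := by
  induction s using TwistedAlgebra.induction_on with
  | hzero => simp
  | hadd a b ha hb => simp only [map_add, LinearMap.add_apply, ha, hb]
  | hsmul c a ha => simp only [map_smul, LinearMap.smul_apply, ha]
  | hof σ y =>
    rw [TwistedAlgebra.stabilizerMap_of, φ.stabilizerAction_of]
    exact φ.action_of_lof hV σ i i _ u

theorem sumMode_action (x : φ.algebra hV) (n : ℤ) (a : fixedPoints G) (u : ⨁ i, S.carrier i) :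
    S.sumMode n a (φ.action hV x u) = φ.action hV x (S.sumMode n a u) := by
  classical
  induction x using TwistedAlgebra.induction_on with
  | hzero => simp
  | hadd a b ha hb => simp only [map_add, LinearMap.add_apply, ha, hb]
  | hsmul c a ha => simp only [map_smul, LinearMap.smul_apply, ha]
  | hof σ i =>
  induction u using DirectSum.induction_on with
  | zero => simp
  | add u u' h h' => simp only [map_add, h, h']
  | of k u =>
  change S.sumMode n a (φ.action hV _ (DirectSum.lof ℂ S.index S.carrier k u)) =
    φ.action hV _ (S.sumMode n a (DirectSum.lof ℂ S.index S.carrier k u))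
  have hs : ∀ j (v : S.carrier j), S.sumMode n a (DirectSum.lof ℂ S.index S.carrier j v) =
      DirectSum.lof ℂ S.index S.carrier j ((S.str j).mode n (a : V) v) :=
    fun j v => DirectSum.lmap_lof _ j v
  by_cases hik : i = k
  · subst hik
    rw [φ.action_of_lof hV σ i _ rfl, hs, hs, φ.action_of_lof hV σ i _ rfl, φ.map_mode, a.2 σ]
  · rw [φ.action_of_lof_of_ne hV σ hik, hs, φ.action_of_lof_of_ne hV σ hik, map_zero]

end DirectSum

end StableFamily.Intertwiners

/-! ### Abstract decomposition with multiplicity spaces. -/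

/-- A tensor is zero if all its contractions with functionals on the first factor are. -/
theorem TensorProduct.eq_zero_of_forall_rTensor {K M N : Type*} [Field K] [AddCommGroup M]
    [Module K M] [AddCommGroup N] [Module K N] (z : M ⊗[K] N)
    (h : ∀ ξ : M →ₗ[K] K, TensorProduct.lid K N (ξ.rTensor N z) = 0) : z = 0 := by
  classical
  let b := Module.Basis.ofVectorSpace K M
  apply (TensorProduct.equivFinsuppOfBasisLeft b).injective
  ext i
  rw [TensorProduct.equivFinsuppOfBasisLeft_apply, h, map_zero, Finsupp.zero_apply]

section Equivariant

variable {R : Type*} [Ring R] [Algebra ℂ R] {I : Type*} [AddCommGroup I] [Module ℂ I] [Module R I]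
  {N : Type*} [AddCommGroup N] [Module ℂ N] (ρ : R →ₐ[ℂ] Module.End ℂ N)

variable {ρ} in
/-- Equivariant maps are determined on generators. -/
theorem eq_of_equivariant {s : Set I} (hs : Submodule.span R s = ⊤) {g g' : I →ₗ[ℂ] N}
    (hg : ∀ x z, g (x • z) = ρ x (g z)) (hg' : ∀ x z, g' (x • z) = ρ x (g' z))
    (h : ∀ z ∈ s, g z = g' z) : g = g' := by
  refine LinearMap.ext fun z => ?_
  have hz : z ∈ Submodule.span R s := by rw [hs]; trivial
  induction hz using Submodule.closure_induction with
  | zero => rw [map_zero, map_zero]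
  | add z z' _ _ hz hz' => rw [map_add, map_add, hz, hz']
  | smul_mem x z hz => rw [hg, hg', h z hz]

/-- A family of equivariant maps that depends linearly on a parameter on a set of generators
depends linearly on the parameter. -/
def equivariantFamily {F : Type*} [AddCommGroup F] [Module ℂ F] (e : F → I →ₗ[ℂ] N)
    (he : ∀ f x z, e f (x • z) = ρ x (e f z)) {W : Type*} [AddCommGroup W] [Module ℂ W]
    (j : W →ₗ[ℂ] I) (hj : Submodule.span R (Set.range j) = ⊤) (ev : F →ₗ[ℂ] W →ₗ[ℂ] N)
    (hev : ∀ f w, e f (j w) = ev f w) : F →ₗ[ℂ] I →ₗ[ℂ] N where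
  toFun := e
  map_add' f g := by
    refine eq_of_equivariant (ρ := ρ) hj (he _) (fun x z => ?_) ?_
    · simp only [LinearMap.add_apply, he, map_add]
    · rintro _ ⟨w, rfl⟩
      simp only [LinearMap.add_apply, hev, map_add]
  map_smul' c f := by
    refine eq_of_equivariant (ρ := ρ) hj (he _) (fun x z => ?_) ?_
    · simp only [RingHom.id_apply, LinearMap.smul_apply, he, map_smul]
    · rintro _ ⟨w, rfl⟩
      simp only [RingHom.id_apply, LinearMap.smul_apply, hev, map_smul]

end Equivariant

section Density

variable {R : Type*} [Ring R] [Algebra ℂ R] {ι : Type*} [DecidableEq ι] {W : ι → Type*}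
  [∀ i, AddCommGroup (W i)] [∀ i, Module ℂ (W i)] [∀ i, Module R (W i)]
  [∀ i, IsScalarTower ℂ R (W i)] {F : ι → Type*} [∀ i, AddCommGroup (F i)] [∀ i, Module ℂ (F i)]

/-- The density theorem for a direct sum of simple modules with multiplicities. -/
theorem exists_smul_eq_lmap_rTensor (hs : ∀ i, IsSimpleModule R (W i))
    (hiso : ∀ i j, Nonempty (W i ≃ₗ[R] W j) → i = j)
    (hschur : ∀ i (f : W i →ₗ[R] W i), ∃ c : ℂ, ∀ x, f x = c • x)
    (E : ∀ i, W i →ₗ[ℂ] W i) (z : ⨁ i, W i ⊗[ℂ] F i) :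
    ∃ r : R, r • z = DirectSum.lmap (fun i => (E i).rTensor (F i)) z := by
  -- The finite set is chosen before `r`, so that sums of tensors are handled by unions.
  suffices h : ∃ s : Finset (⨁ i, W i), ∀ r : R, (∀ y ∈ s, ∀ i, r • y i = E i (y i)) →
      r • z = DirectSum.lmap (fun i => (E i).rTensor (F i)) z by
    obtain ⟨s, hs'⟩ := h
    obtain ⟨r, hr⟩ := exists_smul_eq_of_simple hs hiso hschur E s
    exact ⟨r, hs' r hr⟩
  classical
  induction z using DirectSum.induction_on with
  | zero => exact ⟨∅, fun r _ => by rw [smul_zero, map_zero]⟩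
  | add z z' h h' =>
    obtain ⟨s, hs⟩ := h
    obtain ⟨s', hs'⟩ := h'
    refine ⟨s ∪ s', fun r hr => ?_⟩
    rw [smul_add, map_add, hs r fun y hy => hr y (Finset.mem_union_left _ hy),
      hs' r fun y hy => hr y (Finset.mem_union_right _ hy)]
  | of i t =>
    induction t using TensorProduct.induction_on with
    | zero => exact ⟨∅, fun r _ => by rw [map_zero, smul_zero, map_zero]⟩
    | add t t' h h' =>
      obtain ⟨s, hs⟩ := h
      obtain ⟨s', hs'⟩ := h'
      refine ⟨s ∪ s', fun r hr => ?_⟩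
      rw [map_add, smul_add, map_add, hs r fun y hy => hr y (Finset.mem_union_left _ hy),
        hs' r fun y hy => hr y (Finset.mem_union_right _ hy)]
    | tmul x f =>
      refine ⟨{DirectSum.of W i x}, fun r hr => ?_⟩
      have h := hr _ (Finset.mem_singleton_self _) i
      rw [DirectSum.of_eq_same] at h
      rw [DirectSum.lmap_of, LinearMap.rTensor_tmul, ← h, ← TensorProduct.smul_tmul']
      exact ((DirectSum.lof R ι (fun i => W i ⊗[ℂ] F i) i).map_smul r (x ⊗ₜ[ℂ] f)).symm

/-- The decomposition of a module as a sum of simple modules with multiplicity spaces. -/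
theorem exists_equiv_directSum_tensor (hs : ∀ i, IsSimpleModule R (W i))
    (hiso : ∀ i j, Nonempty (W i ≃ₗ[R] W j) → i = j)
    (hschur : ∀ i (f : W i →ₗ[R] W i), ∃ c : ℂ, ∀ x, f x = c • x)
    {N : Type*} [AddCommGroup N] [Module ℂ N] (ρ : R →ₐ[ℂ] Module.End ℂ N)
    (e : ∀ i, F i →ₗ[ℂ] W i →ₗ[ℂ] N) (he : ∀ i f x z, e i f (x • z) = ρ x (e i f z))
    (hinj : ∀ i f, e i f = 0 → f = 0)
    (hsurj : ∀ N' : Submodule ℂ N, (∀ i f z, e i f z ∈ N') → N' = ⊤)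
    {τ : Type*} (μ : τ → N →ₗ[ℂ] N) (ν : τ → ∀ i, F i →ₗ[ℂ] F i)
    (hμ : ∀ t i f z, e i (ν t i f) z = μ t (e i f z)) :
    ∃ Φ : N ≃ₗ[ℂ] ⨁ i, W i ⊗[ℂ] F i, (∀ (x : R) (u : N), Φ (ρ x u) = x • Φ u) ∧
      ∀ t u, Φ (μ t u) = DirectSum.lmap (fun i => (ν t i).lTensor (W i)) (Φ u) := by
  let Ψ : (⨁ i, W i ⊗[ℂ] F i) →ₗ[ℂ] N :=
    DirectSum.toModule ℂ ι N fun i => TensorProduct.lift (e i).flip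
  have hΨ : ∀ i z f, Ψ (DirectSum.of (fun i => W i ⊗[ℂ] F i) i (z ⊗ₜ f)) = e i f z :=
    fun i z f => (DirectSum.toModule_lof (φ := fun i => TensorProduct.lift (e i).flip)
      ℂ i (z ⊗ₜ[ℂ] f)).trans (TensorProduct.lift.tmul z f)
  have ind : ∀ {P : (⨁ i, W i ⊗[ℂ] F i) → Prop}, P 0 → (∀ t t', P t → P t' → P (t + t')) →
      (∀ i z f, P (DirectSum.of (fun i => W i ⊗[ℂ] F i) i (z ⊗ₜ f))) → ∀ t, P t := by
    intro P h0 hadd htmul t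
    induction t using DirectSum.induction_on with
    | zero => exact h0
    | add t t' h h' => exact hadd t t' h h'
    | of i t =>
      induction t using TensorProduct.induction_on with
      | zero => rw [map_zero]; exact h0
      | add t t' h h' => rw [map_add]; exact hadd _ _ h h'
      | tmul z f => exact htmul i z f
  have hsmul : ∀ (x : R) t, Ψ (x • t) = ρ x (Ψ t) := by
    intro x
    refine ind (by simp) (fun t t' h h' => by rw [smul_add, map_add, h, h', map_add, map_add])
      fun i z f => ?_
    have h1 : x • DirectSum.of (fun i => W i ⊗[ℂ] F i) i (z ⊗ₜ f) =
        DirectSum.of (fun i => W i ⊗[ℂ] F i) i ((x • z) ⊗ₜ f) := by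
      rw [← TensorProduct.smul_tmul']
      exact ((DirectSum.lof R ι (fun i => W i ⊗[ℂ] F i) i).map_smul x (z ⊗ₜ[ℂ] f)).symm
    rw [h1, hΨ, hΨ, he]
  have hmode : ∀ t z, Ψ (DirectSum.lmap (fun i => (ν t i).lTensor (W i)) z) = μ t (Ψ z) := by
    intro t
    refine ind (by simp) (fun z z' h h' => by rw [map_add, map_add, h, h', map_add, map_add])
      fun i z f => ?_
    rw [DirectSum.lmap_of, LinearMap.lTensor_tmul, hΨ, hΨ, hμ]
  have hΨinj : Function.Injective Ψ := by
    rw [injective_iff_map_eq_zero]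
    intro t ht
    refine DFinsupp.ext fun i => ?_
    refine TensorProduct.eq_zero_of_forall_rTensor (t i) fun ξ => ?_
    refine hinj i _ (LinearMap.ext fun w => ?_)
    -- Some `r` acts on `t` as the rank-one operator `ξ(·) w` in block `i` and as zero elsewhere.
    -- Then `0 = ρ r (Ψ t) = Ψ (r t)` is the contraction of `t i` by `ξ`, evaluated at `w`.
    obtain ⟨r, hr⟩ := exists_smul_eq_lmap_rTensor (F := F) hs hiso hschur
      (Function.update (fun _ => 0) i (ξ.smulRight w)) t
    have key : ∀ t, Ψ (DirectSum.lmap (fun k => LinearMap.rTensor (F k)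
        ((Function.update (fun _ => 0) i (ξ.smulRight w) : ∀ k, W k →ₗ[ℂ] W k) k)) t) =
          e i (TensorProduct.lid ℂ (F i) (ξ.rTensor (F i) (t i))) w := by
      refine ind (by simp) (fun t t' h h' => by
        rw [map_add, map_add, h, h', DirectSum.add_apply, map_add, map_add, map_add,
          LinearMap.add_apply]) fun k z f => ?_
      rw [DirectSum.lmap_of, LinearMap.rTensor_tmul, hΨ]
      by_cases hk : k = i
      · subst hk
        rw [Function.update_self, DirectSum.of_eq_same, LinearMap.rTensor_tmul,
          TensorProduct.lid_tmul, LinearMap.smulRight_apply, map_smul, map_smul,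
          LinearMap.smul_apply]
      · rw [Function.update_of_ne hk, DirectSum.of_eq_of_ne _ _ _ (Ne.symm hk)]
        simp
    rw [← key, ← hr, hsmul, ht, map_zero, LinearMap.zero_apply]
  have hΨsurj : Function.Surjective Ψ := by
    rw [← LinearMap.range_eq_top]
    exact hsurj _ fun i f z => ⟨_, hΨ i z f⟩
  let Θ := LinearEquiv.ofBijective Ψ ⟨hΨinj, hΨsurj⟩
  refine ⟨Θ.symm, fun x u => ?_, fun t u => ?_⟩
  · rw [LinearEquiv.symm_apply_eq]
    obtain ⟨z, rfl⟩ := Θ.surjective u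
    rw [Θ.symm_apply_apply]
    exact (hsmul x z).symm
  · rw [LinearEquiv.symm_apply_eq]
    obtain ⟨z, rfl⟩ := Θ.surjective u
    rw [Θ.symm_apply_apply]
    exact (hmode t z).symm

end Density

/-! ### Homomorphisms from induced modules to `𝓜`. -/

namespace StableFamily.Intertwiners

variable {V : Type u} [AddCommGroup V] [Module ℂ V] [VertexAlgebra V]
  {G : Subgroup (Aut V)} {T : ℕ} {S : StableFamily.{u, v} G T} (φ : S.Intertwiners)
  (hV : Module.rank ℂ V ≤ Cardinal.aleph0)

/-- The direct sum of the members of the family as a module over `A_α(G, S)`. -/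
abbrev sumModule : Module (φ.algebra hV) (⨁ i, S.carrier i) :=
  Module.compHom _ (φ.action hV).toRingHom

theorem isScalarTower_sumModule :
    letI := φ.sumModule hV
    IsScalarTower ℂ (φ.algebra hV) (⨁ i, S.carrier i) :=
  letI := φ.sumModule hV
  ⟨fun c r u => by
    change φ.action hV (c • r) u = c • φ.action hV r u
    rw [map_smul, LinearMap.smul_apply]⟩

section Induced

variable {i : S.index} {W : Type u} [AddCommGroup W] [Module ℂ W]
  [Module (φ.stabilizerAlgebra hV i) W]

theorem lof_comp_smul [DecidableEq S.index] (f : φ.multiplicity hV i W)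
    (s : φ.stabilizerAlgebra hV i) (m : W) :
    (DirectSum.lof ℂ S.index S.carrier i ∘ₗ (f : W →ₗ[ℂ] S.carrier i)) (s • m) =
      φ.action hV (TwistedAlgebra.stabilizerMap (φ.alpha hV) i s)
        ((DirectSum.lof ℂ S.index S.carrier i ∘ₗ (f : W →ₗ[ℂ] S.carrier i)) m) := by
  rw [LinearMap.comp_apply, f.2 s m, ← φ.action_stabilizerMap_lof, LinearMap.comp_apply]

open Classical in
/-- The homomorphism from the induced module to `𝓜` determined by an element of the
multiplicity space. -/
def inducedHom (f : φ.multiplicity hV i W) :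
    TwistedAlgebra.Induced (φ.alpha hV) i W →ₗ[ℂ] ⨁ i, S.carrier i :=
  letI := φ.sumModule hV
  haveI := φ.isScalarTower_sumModule hV
  (TwistedAlgebra.inducedLift (φ.alpha hV) i
    (DirectSum.lof ℂ S.index S.carrier i ∘ₗ (f : W →ₗ[ℂ] S.carrier i))
    (φ.lof_comp_smul hV f)).restrictScalars ℂ

open Classical in
theorem inducedHom_smul (f : φ.multiplicity hV i W) (x : φ.algebra hV)
    (z : TwistedAlgebra.Induced (φ.alpha hV) i W) :
    φ.inducedHom hV f (x • z) = φ.action hV x (φ.inducedHom hV f z) := by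
  let := φ.sumModule hV
  have := φ.isScalarTower_sumModule hV
  exact LinearMap.map_smul (TwistedAlgebra.inducedLift (φ.alpha hV) i
    (DirectSum.lof ℂ S.index S.carrier i ∘ₗ (f : W →ₗ[ℂ] S.carrier i))
    (φ.lof_comp_smul hV f)) x z

open Classical in
theorem inducedHom_inducedMk [DecidableEq S.index] (f : φ.multiplicity hV i W) (m : W) :
    φ.inducedHom hV f (TwistedAlgebra.inducedMk (φ.alpha hV) i W m) =
      DirectSum.lof ℂ S.index S.carrier i ((f : W →ₗ[ℂ] S.carrier i) m) := by
  let := φ.sumModule hV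
  have := φ.isScalarTower_sumModule hV
  obtain rfl : ‹DecidableEq S.index› = fun a b => Classical.propDecidable (a = b) :=
    Subsingleton.elim _ _
  exact TwistedAlgebra.inducedLift_inducedMk (φ.alpha hV) i
    (DirectSum.lof ℂ S.index S.carrier i ∘ₗ (f : W →ₗ[ℂ] S.carrier i))
    (φ.lof_comp_smul hV f) m

open Classical in
variable (i W) in
/-- The evaluation `(f, z) ↦ f̃ z` for the homomorphism `f̃` on the induced module. -/
def inducedEval : φ.multiplicity hV i W →ₗ[ℂ] TwistedAlgebra.Induced (φ.alpha hV) i W →ₗ[ℂ]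
    ⨁ i, S.carrier i :=
  equivariantFamily (φ.action hV) (φ.inducedHom hV) (φ.inducedHom_smul hV)
    (TwistedAlgebra.inducedMk (φ.alpha hV) i W)
    (TwistedAlgebra.span_range_inducedMk (φ.alpha hV) i)
    (LinearMap.llcomp ℂ W (S.carrier i) (⨁ i, S.carrier i)
      (DirectSum.lof ℂ S.index S.carrier i) ∘ₗ (φ.multiplicity hV i W).subtype)
    (φ.inducedHom_inducedMk hV)

theorem inducedEval_apply (f : φ.multiplicity hV i W) :
    φ.inducedEval hV i W f = φ.inducedHom hV f := rfl

/-- Both sides are equivariant, the right one because `V^G` commutes with `A_α(G, S)`, and they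
agree on the generating copy of `W`. -/
theorem inducedHom_multiplicityMode (n : ℤ) (a : fixedPoints G) (f : φ.multiplicity hV i W) :
    φ.inducedHom hV (φ.multiplicityMode hV i W n a f) =
      S.sumMode n a ∘ₗ φ.inducedHom hV f := by
  classical
  refine eq_of_equivariant (TwistedAlgebra.span_range_inducedMk (φ.alpha hV) i)
    (φ.inducedHom_smul hV _) (fun x z => ?_) ?_
  · change S.sumMode n a (φ.inducedHom hV f (x • z)) =
      φ.action hV x (S.sumMode n a (φ.inducedHom hV f z))
    rw [inducedHom_smul, sumMode_action]
  · rintro _ ⟨m, rfl⟩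
    refine (φ.inducedHom_inducedMk hV _ m).trans ?_
    refine Eq.trans ?_ (congrArg (S.sumMode n a) (φ.inducedHom_inducedMk hV f m)).symm
    exact (DirectSum.lmap_lof (fun k => (S.str k).mode n (a : V)) i _).symm

/-- Since `W` occurs in `M`, there is a nonzero, hence injective, `f : W → M`. Its inclusion into
`𝓜` factors through `inducedMk`. -/
theorem inducedMk_injective [Finite G] (hT : 0 < T) (hsimple : VertexAlgebra.IsSimple V)
    [IsScalarTower ℂ (φ.stabilizerAlgebra hV i) W] [IsSimpleModule (φ.stabilizerAlgebra hV i) W] :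
    Function.Injective (TwistedAlgebra.inducedMk (φ.alpha hV) i W) := by
  classical
  have := φ.nontrivial_multiplicity hV (i := i) (W := W) hT hsimple
  obtain ⟨f, hf⟩ := exists_ne (0 : φ.multiplicity hV i W)
  intro m m' h
  have h1 := congrArg (φ.inducedHom hV f) h
  rw [φ.inducedHom_inducedMk, φ.inducedHom_inducedMk] at h1
  exact φ.injective_of_ne_zero hV hf (DirectSum.of_injective i h1)

end Induced

end StableFamily.Intertwiners

/-! ### Classification of the simple modules of `A_α(G, X)`. -/

/-- Clifford theory: the modules induced from simple modules of the stabilizer algebras at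
representatives of the orbits are a complete set of simple modules. -/
theorem TwistedAlgebra.isCompleteSimpleFamily_induced {G : Type u} [Group G] [Finite G] {X : Type u}
    [MulAction G X] [Fintype X] (α : TwoCocycle G X)
    (rep : MulAction.orbitRel.Quotient G X → X)
    (hrep : ∀ j, (Quotient.mk'' (rep j) : MulAction.orbitRel.Quotient G X) = j)
    {Λ : MulAction.orbitRel.Quotient G X → Type w} (W : ∀ j, Λ j → Type u)
    [∀ j l, AddCommGroup (W j l)] [∀ j l, Module ℂ (W j l)]
    [∀ j l, Module (TwistedAlgebra (α.stabilizer (rep j))) (W j l)]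
    [∀ j l, IsScalarTower ℂ (TwistedAlgebra (α.stabilizer (rep j))) (W j l)]
    (hW : ∀ j, IsCompleteSimpleFamily (TwistedAlgebra (α.stabilizer (rep j))) (W j))
    (hinj : ∀ j l, Function.Injective (inducedMk α (rep j) (W j l))) :
    IsCompleteSimpleFamily (TwistedAlgebra α)
      (fun p : Σ j, Λ j => Induced α (rep p.1) (W p.1 p.2)) where
  isSimple p := isSimpleModule_induced α (rep p.1) ((hW p.1).isSimple p.2) (hinj p.1 p.2)
  eq_of_iso := by
    rintro ⟨j, l⟩ ⟨k, m⟩ ⟨e⟩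
    have h1 := (hW j).isSimple l
    have h2 := (hW k).isSimple m
    have := IsSimpleModule.nontrivial (TwistedAlgebra (α.stabilizer (rep j))) (W j l)
    have horb := mem_orbit_of_induced_equiv α (rep j) (hinj j l) e
    have hjk : j = k := by
      rw [← hrep j, ← hrep k]
      exact Quotient.sound horb
    subst hjk
    obtain rfl : l = m := (hW j).eq_of_iso l m
      (nonempty_equiv_of_induced_equiv α (rep j) (hinj j l) (hinj j m) e)
    rfl
  complete N _ _ hN := by
    let : Module ℂ N := Module.compHom N (algebraMap ℂ (TwistedAlgebra α))
    have : IsScalarTower ℂ (TwistedAlgebra α) N := ⟨fun c r n => by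
      rw [Algebra.smul_def, mul_smul]
      rfl⟩
    have := IsSimpleModule.nontrivial (TwistedAlgebra α) N
    obtain ⟨n, hn⟩ := exists_ne (0 : N)
    obtain ⟨y, hy⟩ := exists_idem_smul_ne_zero α hn
    let j : MulAction.orbitRel.Quotient G X := Quotient.mk'' y
    have hyj : y ∈ MulAction.orbit G (rep j) :=
      MulAction.orbitRel_apply.mp (Quotient.exact (hrep j).symm)
    -- A nonzero corner at `y` is moved to the orbit representative. There some `W j l` embeds, and
    -- its extension to the induced module is a nonzero map of simple modules.
    obtain ⟨a, ha, ha'⟩ := exists_ne_zero_of_idem_smul_ne_zero hyj hy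
    obtain ⟨l, h, hh, hh'⟩ := exists_injective_of_corner_ne_zero α (rep j) (W := W j)
      (fun J hJ => (hW j).complete J hJ) ha ha'
    have h1 := (hW j).isSimple l
    have := IsSimpleModule.nontrivial (TwistedAlgebra (α.stabilizer (rep j))) (W j l)
    have := isSimpleModule_induced α (rep j) h1 (hinj j l)
    have hne : inducedLift α (rep j) h hh' ≠ 0 := by
      intro h0
      obtain ⟨m, hm⟩ := exists_ne (0 : W j l)
      refine hm (hh ?_)
      rw [map_zero, ← inducedLift_inducedMk α (rep j) h hh', h0, LinearMap.zero_apply]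
    exact ⟨⟨j, l⟩, ⟨(LinearEquiv.ofBijective _ (LinearMap.bijective_of_ne_zero hne)).symm⟩⟩

/-! ### Spanning of `𝓜`. -/

namespace StableFamily.Intertwiners

variable {V : Type u} [AddCommGroup V] [Module ℂ V] [VertexAlgebra V]
  {G : Subgroup (Aut V)} {T : ℕ} {S : StableFamily.{u, v} G T} (φ : S.Intertwiners)
  (hV : Module.rank ℂ V ≤ Cardinal.aleph0)

/-- A member of the family is spanned by the homomorphic images of simple modules over the
twisted group algebra of its stabilizer. -/
theorem eq_top_of_forall_multiplicity [Finite G] (i : S.index) {Λ : Type*} {W : Λ → Type u}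
    [∀ l, AddCommGroup (W l)] [∀ l, Module ℂ (W l)]
    [∀ l, Module (φ.stabilizerAlgebra hV i) (W l)]
    [∀ l, IsScalarTower ℂ (φ.stabilizerAlgebra hV i) (W l)]
    (hW : IsCompleteSimpleFamily (φ.stabilizerAlgebra hV i) W) (N : Submodule ℂ (S.carrier i))
    (hN : ∀ l (f : φ.multiplicity hV i (W l)) m, (f : W l →ₗ[ℂ] S.carrier i) m ∈ N) : N = ⊤ := by
  let := φ.stabilizerModule hV i
  have : IsScalarTower ℂ (φ.stabilizerAlgebra hV i) (S.carrier i) :=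
    ⟨fun c r u => by
      change φ.stabilizerAction hV i (c • r) u = c • φ.stabilizerAction hV i r u
      rw [map_smul, LinearMap.smul_apply]⟩
  let Q : Submodule (φ.stabilizerAlgebra hV i) (S.carrier i) :=
    Submodule.span _ {u | ∃ (l : Λ) (f : φ.multiplicity hV i (W l)) (m : W l),
      (f : W l →ₗ[ℂ] S.carrier i) m = u}
  have hQN : ∀ u ∈ Q, u ∈ N := by
    intro u hu
    induction hu using Submodule.closure_induction with
    | zero => exact N.zero_mem
    | add u u' _ _ h h' => exact N.add_mem h h'
    | smul_mem r u hu =>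
      obtain ⟨l, f, m, rfl⟩ := hu
      have := hN l f (r • m)
      rwa [f.2 r m] at this
  have hQ : Q = ⊤ := by
    rw [eq_top_iff, ← IsSemisimpleModule.sSup_simples_eq_top (φ.stabilizerAlgebra hV i)
      (S.carrier i)]
    refine sSup_le fun K hK u hu => ?_
    have hK' : IsSimpleModule (φ.stabilizerAlgebra hV i) K := hK
    -- `K` lives in the universe of the members of `S`. The quotient of the algebra by a maximal
    -- left ideal is an isomorphic module in the universe where completeness of `W` applies.
    obtain ⟨I, hI, ⟨e⟩⟩ := isSimpleModule_iff_quot_maximal.mp hK'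
    have hI' : IsSimpleModule (φ.stabilizerAlgebra hV i) (φ.stabilizerAlgebra hV i ⧸ I) :=
      IsSimpleModule.congr e.symm
    obtain ⟨l, ⟨e'⟩⟩ := hW.complete _ hI'
    let F := e'.symm.trans e.symm
    refine Submodule.subset_span ⟨l, ⟨(K.subtype ∘ₗ F.toLinearMap).restrictScalars ℂ,
      fun r m => (K.subtype ∘ₗ F.toLinearMap).map_smul r m⟩, F.symm ⟨u, hu⟩, ?_⟩
    change (F (F.symm ⟨u, hu⟩) : S.carrier i) = u
    rw [F.apply_symm_apply]
  exact Submodule.eq_top_iff'.mpr fun u => hQN u (hQ ▸ Submodule.mem_top)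

theorem eq_zero_of_inducedEval_eq_zero {i : S.index} {W : Type u} [AddCommGroup W] [Module ℂ W]
    [Module (φ.stabilizerAlgebra hV i) W] {f : φ.multiplicity hV i W}
    (hf : φ.inducedEval hV i W f = 0) : f = 0 := by
  classical
  refine Subtype.ext (LinearMap.ext fun m => ?_)
  have h1 := φ.inducedHom_inducedMk hV f m
  rw [← φ.inducedEval_apply, hf] at h1
  exact DirectSum.of_injective _ (h1.symm.trans (map_zero _).symm)

/-- The images of the induced modules span `𝓜`. -/
theorem eq_top_of_forall_inducedHom [Finite G]
    (rep : MulAction.orbitRel.Quotient G S.index → S.index)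
    (hrep : ∀ j, (Quotient.mk'' (rep j) : MulAction.orbitRel.Quotient G S.index) = j)
    {Λ : MulAction.orbitRel.Quotient G S.index → Type w}
    (W : ∀ j, Λ j → Type u) [∀ j l, AddCommGroup (W j l)] [∀ j l, Module ℂ (W j l)]
    [∀ j l, Module (φ.stabilizerAlgebra hV (rep j)) (W j l)]
    [∀ j l, IsScalarTower ℂ (φ.stabilizerAlgebra hV (rep j)) (W j l)]
    (hW : ∀ j, IsCompleteSimpleFamily (φ.stabilizerAlgebra hV (rep j)) (W j))
    (N : Submodule ℂ (⨁ i, S.carrier i))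
    (hN : ∀ j l (f : φ.multiplicity hV (rep j) (W j l)) z, φ.inducedHom hV f z ∈ N) : N = ⊤ := by
  classical
  refine Submodule.eq_top_iff'.mpr fun u => ?_
  induction u using DirectSum.induction_on with
  | zero => exact N.zero_mem
  | add u u' h h' => exact N.add_mem h h'
  | of k u =>
  let j : MulAction.orbitRel.Quotient G S.index := Quotient.mk'' k
  obtain ⟨σ, hσ⟩ : k ∈ MulAction.orbit G (rep j) :=
    MulAction.orbitRel_apply.mp (Quotient.exact (hrep j).symm)
  -- The summand at the representative is spanned by images of the `W j l`, and `σ ⊗ e(rep j)`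
  -- carries it onto the summand at `k`. Equivariance keeps the result in `N`.
  have htop := φ.eq_top_of_forall_multiplicity hV (rep j) (hW j)
    (N.comap (φ.action hV (TwistedAlgebra.of _ σ (rep j)) ∘ₗ
      DirectSum.lof ℂ S.index S.carrier (rep j))) fun l f m => by
        rw [Submodule.mem_comap, LinearMap.comp_apply, ← φ.inducedHom_inducedMk hV f m,
          ← φ.inducedHom_smul]
        exact hN j l f _
  have hu : (φ.map σ (rep j) k hσ).symm u ∈ N.comap
      (φ.action hV (TwistedAlgebra.of _ σ (rep j)) ∘ₗ
        DirectSum.lof ℂ S.index S.carrier (rep j)) := htop ▸ Submodule.mem_top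
  rw [Submodule.mem_comap, LinearMap.comp_apply, φ.action_of_lof hV σ (rep j) k hσ,
    LinearEquiv.apply_symm_apply] at hu
  exact hu

end StableFamily.Intertwiners

end

/-! ### The main theorem. -/

set_option maxHeartbeats 400000 in
theorem theorem1 {V : Type u} [AddCommGroup V] [Module ℂ V] [VertexAlgebra V]
    (hsimple : VertexAlgebra.IsSimple V) (hV : Module.rank ℂ V ≤ Cardinal.aleph0)
    (G : Subgroup (VertexAlgebra.Aut V)) [Finite G] (T : ℕ) (hT : 0 < T)
    (S : StableFamily.{u, v} G T) (φ : S.Intertwiners)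
    (rep : MulAction.orbitRel.Quotient G S.index → S.index)
    (hrep : ∀ j, (Quotient.mk'' (rep j) : MulAction.orbitRel.Quotient G S.index) = j)
    (Λ : MulAction.orbitRel.Quotient G S.index → Type w)
    (W : ∀ j, Λ j → Type u) [∀ j l, AddCommGroup (W j l)] [∀ j l, Module ℂ (W j l)]
    [∀ j l, Module (φ.stabilizerAlgebra hV (rep j)) (W j l)]
    [∀ j l, IsScalarTower ℂ (φ.stabilizerAlgebra hV (rep j)) (W j l)]
    (hW : ∀ j, IsCompleteSimpleFamily (φ.stabilizerAlgebra hV (rep j)) (W j)) :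
    IsCompleteSimpleFamily (φ.algebra hV)
      (fun p : Σ j, Λ j => TwistedAlgebra.Induced (φ.alpha hV) (rep p.1) (W p.1 p.2)) ∧
    (∃ Φ : (⨁ i, S.carrier i) ≃ₗ[ℂ]
        ⨁ p : Σ j, Λ j, TwistedAlgebra.Induced (φ.alpha hV) (rep p.1) (W p.1 p.2) ⊗[ℂ]
          φ.multiplicity hV (rep p.1) (W p.1 p.2),
      (∀ (x : φ.algebra hV) (u : ⨁ i, S.carrier i), Φ (φ.action hV x u) = x • Φ u) ∧
      (∀ (n : ℤ) (a : VertexAlgebra.fixedPoints G) (u : ⨁ i, S.carrier i),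
        Φ (S.sumMode n a u) =
          DirectSum.lmap (fun p : Σ j, Λ j =>
            (φ.multiplicityMode hV (rep p.1) (W p.1 p.2) n a).lTensor
              (TwistedAlgebra.Induced (φ.alpha hV) (rep p.1) (W p.1 p.2))) (Φ u))) ∧
    (∀ p : Σ j, Λ j,
      Nontrivial (φ.multiplicity hV (rep p.1) (W p.1 p.2)) ∧
      (φ.multiplicityModule hV (rep p.1) (W p.1 p.2) hT
        ((hW p.1).isSimple p.2)).IsIrreducible) ∧
    (∀ p q : Σ j, Λ j,
      (φ.multiplicityModule hV (rep p.1) (W p.1 p.2) hT ((hW p.1).isSimple p.2)).Iso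
        (φ.multiplicityModule hV (rep q.1) (W q.1 q.2) hT ((hW q.1).isSimple q.2)) ↔ p = q) := by
  classical
  have hs := fun j l => (hW j).isSimple l
  have hinj : ∀ j l, Function.Injective
      (TwistedAlgebra.inducedMk (φ.alpha hV) (rep j) (W j l)) := fun j l =>
    φ.inducedMk_injective hV hT hsimple
  have hfam := TwistedAlgebra.isCompleteSimpleFamily_induced (φ.alpha hV) rep hrep W hW hinj
  have hnt : ∀ j l, Nontrivial (φ.multiplicity hV (rep j) (W j l)) := fun j l =>
    φ.nontrivial_multiplicity hV hT hsimple
  have hsurj : ∀ N' : Submodule ℂ (⨁ i, S.carrier i),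
      (∀ (p : Σ j, Λ j) f z, φ.inducedEval hV (rep p.1) (W p.1 p.2) f z ∈ N') → N' = ⊤ :=
    fun N' hN' => φ.eq_top_of_forall_inducedHom hV rep hrep W hW N' fun j l f z =>
      hN' ⟨j, l⟩ f z
  have hschur : ∀ (p : Σ j, Λ j)
      (f : TwistedAlgebra.Induced (φ.alpha hV) (rep p.1) (W p.1 p.2) →ₗ[φ.algebra hV]
        TwistedAlgebra.Induced (φ.alpha hV) (rep p.1) (W p.1 p.2)), ∃ c : ℂ, ∀ x, f x = c • x :=
    fun p f =>
      have := hfam.isSimple p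
      IsSimpleModule.exists_eq_smul f
  refine ⟨hfam, ?_, fun p => ⟨hnt p.1 p.2, ?_⟩, ?_⟩
  · have H := @exists_equiv_directSum_tensor (φ.algebra hV) _ _ (Σ j, Λ j) _
      (fun p => TwistedAlgebra.Induced (φ.alpha hV) (rep p.1) (W p.1 p.2))
      (fun p => inferInstance) (fun p => inferInstance) (fun p => inferInstance)
      (fun p => inferInstance) (fun p => φ.multiplicity hV (rep p.1) (W p.1 p.2))
      (fun p => inferInstance) (fun p => inferInstance) hfam.isSimple hfam.eq_of_iso hschur
      (⨁ i, S.carrier i) inferInstance inferInstance (φ.action hV)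
      (fun p => φ.inducedEval hV (rep p.1) (W p.1 p.2)) (fun p f => φ.inducedHom_smul hV f)
      (fun p f => φ.eq_zero_of_inducedEval_eq_zero hV) hsurj (ℤ × VertexAlgebra.fixedPoints G)
      (fun t => S.sumMode t.1 t.2)
      (fun t p => φ.multiplicityMode hV (rep p.1) (W p.1 p.2) t.1 t.2)
      (fun t p f z => LinearMap.congr_fun (φ.inducedHom_multiplicityMode hV t.1 t.2 f) z)
    obtain ⟨Φ, h1, h2⟩ := H
    exact ⟨Φ, h1, fun n a => h2 (n, a)⟩
  · exact φ.isIrreducible_multiplicityModule hV hT hsimple _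
  · rintro ⟨j, l⟩ ⟨k, m⟩
    constructor
    · rintro ⟨h, hh⟩
      obtain ⟨f, hf⟩ := exists_ne (0 : φ.multiplicity hV (rep j) (W j l))
      have hzero := fun E hE hEf hk => φ.eq_zero_of_map_multiplicity hV hT (hs j l) (hs k m)
        h.toLinearMap hh f E hE hEf hk
      by_contra hne
      have hhf : h f ≠ 0 := by simpa using hf
      by_cases hjk : j = k
      · subst hjk
        have hlm : ¬ Nonempty (W j l ≃ₗ[φ.stabilizerAlgebra hV (rep j)] W j m) := by
          intro e
          obtain rfl := (hW j).eq_of_iso l m e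
          exact hne rfl
        -- Within one orbit the separation comes from `W j l` and `W j m` being non-isomorphic.
        obtain ⟨E, hE, hEf, hEg⟩ := φ.exists_comp_eq_self_and_comp_eq_zero hV hlm hf (h f)
        exact hhf (hzero E hE hEf (Or.inr ⟨rfl, hEg⟩))
      -- Across different orbits `E = id` suffices, since the approximating modes vanish on the
      -- relevant vectors outside the orbit.
      · refine hhf (hzero LinearMap.id (fun _ _ => rfl) (fun _ => rfl) (Or.inl fun horb => hjk ?_))
        rw [← hrep j, ← hrep k]
        exact (Quotient.sound horb).symm
    · intro hpq
      obtain ⟨rfl, h⟩ := Sigma.mk.inj_iff.mp hpq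
      obtain rfl := eq_of_heq h
      exact ⟨LinearEquiv.refl ℂ _, fun _ _ _ => rfl⟩
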